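/- Let $k$ be a field of characteristic $0$, let $Q$ be a finite quiver, and let $A=kQ$ be its path algebra, in which paths are multiplied so that $e_uAe_v$ is spanned by the paths from $u$ to $v$; $kQ_1$ denotes the span of the arrows and $R_{uv}=e_u(kQ_1)e_v$. Let $G$ be a finite group acting on $A$ by $k$-algebra automorphisms which permute the vertex idempotents $e_u$ (so $G$ acts on $Q_0$) and stabilize $kQ_1$. For $u\in Q_0$ let $O_u$ be its orbit, $G_u$ its stabilizer, and $G_{uv}=G_u\cap G_v$. Assume that $k$ is a splitting field for every $G_u$, i.e. $\operatorname{End}_{G_u}(V)=k$ for every irreducible representation $V$ of $G_u$ over $k$ (for example, $k$ algebraically closed). Let $AG$ be the skew group algebra, with $(ag)(bh)=a\,(g\cdot b)\,gh$. Choose a set $\tilde Q_0$ of representatives of the $G$-orbits on $Q_0$; for $u,v\in\tilde Q_0$ a set $O_{uv}$ of representatives of the $G$-orbits on $O_u\times O_v$; and for each $u\in \tilde Q_0$ and $u'\in O_u$ an element $g_{uu'}\in G$ with $g_{uu'}u=u'$. The quiver $Q_G$ has as vertices the pairs $(u,\rho)$ with $u\in\tilde Q_0$ and $\rho\in\operatorname{irr}(G_u)$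 an isomorphism class of irreducible representations (with representative $V_\rho$); its arrows from $(u,\rho)$ to $(v,\sigma)$ form a basis of $$\bigoplus_{(u',v')\in O_{uv}}\operatorname{Hom}_{G_{u'v'}}(V_\rho,\;R_{u'v'}\otimes V_\sigma),$$ where $h\in G_{u'}$ acts on $V_\rho$ as $g_{uu'}^{-1}hg_{uu'}\in G_u$, and similarly for $V_\sigma$. A representation of a finite quiver is a left module over its path algebra that is finite-dimensional over $k$; its dimension vector is $v\mapsto \dim_k e_vM$. A root of $Q_G$ is the dimension vector of an indecomposable representation of $Q_G$. A $G$-root of $Q$ is the dimension vector of a coherently $G$-indecomposable representation, that is, of a nonzero finite-dimensional representation $M$ of $Q$ with a coherent $G$-structure (an $AG$-module structure extending the $A$-module structure) such that $M$, with this structure, is not a direct sum of two nonzero representations with coherent $G$-structure (i.e. $M$ is indecomposable as an $AG$-module). Let $r:K_0(kQ_G)\to K_0(kQ)$, in the bases of the classes of vertex simples, be the linear map $$r([S_{(u,\rho)}])=\sum_{v\in O_u}\dim(V_\rho)\,[S_v].$$ 1. $r$ is the map induced by the functor $R$: if $e_{u\rho}\in k[G_u]$ are idempotents with $k[G_u]e_{u\rho}\cong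 V_\rho$ for all vertices $(u,\rho)$ of $Q_G$, regarded as elements of $AG$ through the embedding $k[G_u]\to e_u(AG)e_u$, $h\mapsto e_uh$, then $e=\sum_{(u,\rho)} e_{u\rho}$ is idempotent, and for every finite-dimensional left $e(AG)e$-module $N$ the $A$-module $R(N)=\operatorname{Hom}_{e(AG)e}(eAG,N)$ has dimension vector $r(\beta)$, where $\beta(u,\rho)=\dim_k e_{u\rho}N$. 2. A dimension vector $\alpha$ of $Q$ is a $G$-root if and only if there is a root $\beta$ of $Q_G$ such that $r(\beta)=\alpha$. -/

import Mathlib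

universe u v w z

open scoped TensorProduct

noncomputable section

/-! ## Path algebras -/

/-- A path of a quiver together with its endpoints: `⟨a, b, p⟩` with `p` a path from `a` to `b`. -/
abbrev QPath (V : Type v) [Quiver.{w} V] : Type (max v w) :=
  Σ a : V, Σ b : V, Quiver.Path a b

/-- The path algebra `k Γ`: the vector space with basis the paths of the quiver. -/
def PathAlgebra (k : Type u) (V : Type v) [Field k] [Quiver.{w} V] : Type (max u v w) :=
  QPath V →₀ k

namespace PathAlgebra

variable {k : Type u} {V : Type v} [Field k] [Quiver.{w} V]

instance : AddCommGroup (PathAlgebra k V) := inferInstanceAs (AddCommGroup (QPath V →₀ k))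
instance : Module k (PathAlgebra k V) := inferInstanceAs (Module k (QPath V →₀ k))

/-- The basis element attached to a path. -/
def ofPath (p : QPath V) : PathAlgebra k V := Finsupp.single p (1 : k)

open scoped Classical in
/-- The product of two paths: `p` followed by `q` if `p` ends where `q` starts, and `0` otherwise.
With this convention `e_a (k Γ) e_b` is spanned by the paths from `a` to `b`. -/
def pathMul (p q : QPath V) : PathAlgebra k V :=
  if h : p.2.1 = q.1 then ofPath ⟨p.1, q.2.1, p.2.2.comp (q.2.2.cast h.symm rfl)⟩ else 0

/-- The bilinear extension of `pathMul`. -/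
def mulLin : PathAlgebra k V →ₗ[k] PathAlgebra k V →ₗ[k] PathAlgebra k V :=
  Finsupp.linearCombination k fun p : QPath V =>
    (Finsupp.linearCombination k fun q : QPath V => (pathMul p q : PathAlgebra k V) :
      (QPath V →₀ k) →ₗ[k] PathAlgebra k V)

instance : Mul (PathAlgebra k V) := ⟨fun x y => mulLin x y⟩

/-- The idempotent `e_a`, the path of length `0` at the vertex `a`. -/
def idem (a : V) : PathAlgebra k V := ofPath ⟨a, a, Quiver.Path.nil⟩

/-- The element of the path algebra given by an arrow. -/
def ofArrow {a b : V} (f : a ⟶ b) : PathAlgebra k V := ofPath ⟨a, b, f.toPath⟩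

theorem mul_eq (x y : PathAlgebra k V) : x * y = mulLin x y := rfl

theorem ofPath_mul_ofPath (p q : QPath V) :
    (ofPath p * ofPath q : PathAlgebra k V) = pathMul p q := by
  have h (f : QPath V → PathAlgebra k V →ₗ[k] PathAlgebra k V) :
      Finsupp.linearCombination k f (Finsupp.single p 1) = f p := by
    rw [Finsupp.linearCombination_single, one_smul]
  have h' (f : QPath V → PathAlgebra k V) :
      Finsupp.linearCombination k f (Finsupp.single q 1) = f q := by
    rw [Finsupp.linearCombination_single, one_smul]
  exact (LinearMap.congr_fun (h _) (ofPath q)).trans (h' _)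

theorem pathMul_comp {a b c : V} (p : Quiver.Path a b) (q : Quiver.Path b c) :
    (pathMul ⟨a, b, p⟩ ⟨b, c, q⟩ : PathAlgebra k V) = ofPath ⟨a, c, p.comp q⟩ := by
  simp [pathMul]

theorem pathMul_of_ne {p q : QPath V} (h : p.2.1 ≠ q.1) :
    (pathMul p q : PathAlgebra k V) = 0 := by
  simp [pathMul, h]

@[elab_as_elim]
theorem induction {P : PathAlgebra k V → Prop} (x : PathAlgebra k V) (h0 : P 0)
    (hadd : ∀ x y, P x → P y → P (x + y)) (hs : ∀ (c : k) (p : QPath V), P (c • ofPath p)) :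
    P x := by
  refine Finsupp.induction_linear (motive := P) x h0 hadd fun p c => ?_
  have h := hs c p
  have h2 : (c • ofPath p : PathAlgebra k V) = Finsupp.single p c := by
    change c • Finsupp.single p (1 : k) = _
    simp
  rwa [h2] at h

theorem add_mul' (x y t : PathAlgebra k V) : (x + y) * t = x * t + y * t := by
  simp [mul_eq]

theorem mul_add' (x y t : PathAlgebra k V) : t * (x + y) = t * x + t * y := by
  simp [mul_eq]

theorem smul_mul' (c : k) (x y : PathAlgebra k V) : (c • x) * y = c • (x * y) := by
  simp [mul_eq]

theorem mul_smul' (c : k) (x y : PathAlgebra k V) : x * (c • y) = c • (x * y) := by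
  simp [mul_eq]

theorem zero_mul' (x : PathAlgebra k V) : 0 * x = 0 := by simp [mul_eq]

theorem mul_zero' (x : PathAlgebra k V) : x * 0 = 0 := by simp [mul_eq]

theorem mul_assoc_path (p q r : QPath V) :
    (ofPath p * ofPath q * ofPath r : PathAlgebra k V) = ofPath p * (ofPath q * ofPath r) := by
  obtain ⟨a, b, p⟩ := p
  obtain ⟨b', c, q⟩ := q
  obtain ⟨c', d, r⟩ := r
  simp only [ofPath_mul_ofPath]
  by_cases h1 : b = b'
  · subst h1
    by_cases h2 : c = c'
    · subst h2
      simp only [pathMul_comp, ofPath_mul_ofPath, Quiver.Path.comp_assoc]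
    · rw [pathMul_comp, ofPath_mul_ofPath, pathMul_of_ne h2, pathMul_of_ne h2, mul_zero']
  · rw [pathMul_of_ne h1, zero_mul']
    by_cases h2 : c = c'
    · subst h2
      rw [pathMul_comp, ofPath_mul_ofPath, pathMul_of_ne h1]
    · rw [pathMul_of_ne h2, mul_zero']

theorem mul_assoc' (x y t : PathAlgebra k V) : x * y * t = x * (y * t) := by
  induction x using PathAlgebra.induction with
  | h0 => simp only [zero_mul']
  | hadd x₁ x₂ h₁ h₂ => simp only [add_mul', h₁, h₂]
  | hs c p =>
    simp only [smul_mul']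
    congr 1
    induction y using PathAlgebra.induction with
    | h0 => simp only [zero_mul', mul_zero']
    | hadd x₁ x₂ h₁ h₂ => simp only [add_mul', mul_add', h₁, h₂]
    | hs c q =>
      simp only [smul_mul', mul_smul']
      congr 1
      induction t using PathAlgebra.induction with
      | h0 => simp only [mul_zero']
      | hadd x₁ x₂ h₁ h₂ => simp only [mul_add', h₁, h₂]
      | hs c r => simp only [mul_smul', mul_assoc_path]

variable [Fintype V]

instance : One (PathAlgebra k V) := ⟨∑ a : V, idem a⟩

theorem one_eq : (1 : PathAlgebra k V) = ∑ a : V, idem a := rfl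

theorem one_mul' (x : PathAlgebra k V) : 1 * x = x := by
  induction x using PathAlgebra.induction with
  | h0 => simp only [mul_zero']
  | hadd x₁ x₂ h₁ h₂ => simp only [mul_add', h₁, h₂]
  | hs c p =>
    obtain ⟨a, b, p⟩ := p
    rw [mul_smul', one_eq, mul_eq, map_sum, LinearMap.sum_apply]
    simp only [← mul_eq, idem, ofPath_mul_ofPath]
    rw [Finset.sum_eq_single a (fun a' _ h => pathMul_of_ne h) (by simp), pathMul_comp,
      Quiver.Path.nil_comp]

theorem mul_one' (x : PathAlgebra k V) : x * 1 = x := by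
  induction x using PathAlgebra.induction with
  | h0 => simp only [zero_mul']
  | hadd x₁ x₂ h₁ h₂ => simp only [add_mul', h₁, h₂]
  | hs c p =>
    obtain ⟨a, b, p⟩ := p
    rw [smul_mul', one_eq, mul_eq, map_sum]
    simp only [← mul_eq, idem, ofPath_mul_ofPath]
    rw [Finset.sum_eq_single b (fun b' _ h => pathMul_of_ne h.symm) (by simp), pathMul_comp,
      Quiver.Path.comp_nil]

instance : Ring (PathAlgebra k V) where
  __ : AddCommGroup (PathAlgebra k V) := inferInstance
  left_distrib a b c := mul_add' b c a
  right_distrib a b c := add_mul' a b c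
  zero_mul := zero_mul'
  mul_zero := mul_zero'
  mul_assoc := mul_assoc'
  one_mul := one_mul'
  mul_one := mul_one'

instance : Algebra k (PathAlgebra k V) := Algebra.ofModule smul_mul' mul_smul'

end PathAlgebra

/-- The span of the arrows, i.e. of the paths of length one. -/
def arrowSpan (k : Type u) (V : Type v) [Field k] [Quiver.{w} V] :
    Submodule k (PathAlgebra k V) :=
  Submodule.span k {x | ∃ (a b : V) (f : a ⟶ b), x = PathAlgebra.ofArrow f}

/-- The span `R_{ab}` of the arrows from `a` to `b`. -/
def arrowSpace (k : Type u) {V : Type v} [Field k] [Quiver.{w} V] (a b : V) :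
    Submodule k (PathAlgebra k V) :=
  Submodule.span k (Set.range fun f : a ⟶ b => PathAlgebra.ofArrow f)

/-! ## Modules, dimension vectors and roots -/

/-- A module is indecomposable if it is nonzero and not the direct sum of two nonzero
submodules. -/
def IsIndecomposableModule (R : Type u) (M : Type v) [Ring R] [AddCommGroup M] [Module R M] :
    Prop :=
  Nontrivial M ∧ ∀ N₁ N₂ : Submodule R M, IsCompl N₁ N₂ → N₁ = ⊥ ∨ N₂ = ⊥

/-- The dimension vector `x ↦ dim_k (ε x) M` of a module `M` over a `k`-algebra `R` with respect to
a family `ε` of idempotents of `R`. -/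
def dimVector (k : Type u) {R : Type v} {X : Type w} [Field k] [Ring R] [Algebra k R] (ε : X → R)
    (M : Type z) [AddCommGroup M] [Module k M] [Module R M] [IsScalarTower k R M] : X → ℕ :=
  fun x => Module.finrank k (LinearMap.range (Algebra.lsmul k k M (ε x)))

/-- `β` is a root of the quiver: it is the dimension vector of a finite-dimensional indecomposable
representation, a representation being a left module over the path algebra. -/
def IsQuiverRoot (k : Type u) (V : Type v) [Field k] [Quiver.{w} V] [Fintype V] (β : V → ℕ) :
    Prop :=
  ∃ (M : Type u) (_ : AddCommGroup M) (_ : Module k M) (_ : Module (PathAlgebra k V) M)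
    (_ : IsScalarTower k (PathAlgebra k V) M),
    FiniteDimensional k M ∧ IsIndecomposableModule (PathAlgebra k V) M ∧
      dimVector k (PathAlgebra.idem : V → PathAlgebra k V) M = β

/-! ## Group actions on path algebras and the skew group algebra -/

section Action

variable (k : Type u) (V : Type v) (G : Type z) [Field k] [Quiver.{w} V] [Fintype V] [Group G]
  [MulSemiringAction G (PathAlgebra k V)]

/-- The action of `G` on the path algebra permutes the idempotents `e_a`, through the given action
on vertices, and stabilizes the span of the arrows. -/
class IsQuiverAction [MulAction G V] : Prop where
  smul_idem : ∀ (g : G) (a : V),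
    g • (PathAlgebra.idem a : PathAlgebra k V) = PathAlgebra.idem (g • a)
  smul_mem_arrowSpan : ∀ (g : G) (x : PathAlgebra k V), x ∈ arrowSpan k V → g • x ∈ arrowSpan k V

/-- The skew group algebra `(kQ)G`, with `(a g)(b h) = a (g b) (g h)`; here `a g` is
`SkewMonoidAlgebra.single g a`. -/
abbrev SkewPathAlgebra : Type (max u v w z) := SkewMonoidAlgebra (PathAlgebra k V) G

/-- The idempotent `e_a` inside the skew group algebra. -/
def skewIdem (a : V) : SkewPathAlgebra k V G := SkewMonoidAlgebra.single 1 (PathAlgebra.idem a)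

/-- `α` is a `G`-root: it is the dimension vector of a finite-dimensional coherently
`G`-indecomposable representation, that is, of a representation with a coherent `G`-structure (an
`AG`-module structure, where `A = kQ`) which is not the direct sum of two nonzero representations
with coherent `G`-structure. -/
def IsGRoot [SMulCommClass G k (PathAlgebra k V)] (α : V → ℕ) : Prop :=
  ∃ (M : Type u) (_ : AddCommGroup M) (_ : Module k M) (_ : Module (SkewPathAlgebra k V G) M)
    (_ : IsScalarTower k (SkewPathAlgebra k V G) M),
    FiniteDimensional k M ∧ IsIndecomposableModule (SkewPathAlgebra k V G) M ∧
      dimVector k (skewIdem k V G) M = α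

end Action

/-! ## Irreducible representations -/

/-- Irreducible finite-dimensional representations, on the coordinate spaces `k ^ n`. -/
abbrev IrrRep (k : Type u) (H : Type z) [Field k] [Group H] : Type (max u z) :=
  Σ n : ℕ, {ρ : Representation k H (Fin n → k) // ρ.IsIrreducible}

/-- Isomorphism of irreducible representations. -/
def irrRepSetoid (k : Type u) (H : Type z) [Field k] [Group H] : Setoid (IrrRep k H) where
  r ρ σ := Nonempty (ρ.2.1.Equiv σ.2.1)
  iseqv := ⟨fun _ => ⟨.refl _⟩, fun ⟨e⟩ => ⟨e.symm⟩, fun ⟨e⟩ ⟨f⟩ => ⟨e.trans f⟩⟩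

/-- The set `irr(H)` of isomorphism classes of irreducible representations of `H`. -/
def Irr (k : Type u) (H : Type z) [Field k] [Group H] : Type (max u z) :=
  Quotient (irrRepSetoid k H)

namespace Irr

variable {k : Type u} {H : Type z} [Field k] [Group H]

/-- The dimension `d_ρ`. -/
def dim (x : Irr k H) : ℕ := (Quotient.out x).1

/-- The space `V_ρ`. -/
abbrev Space (x : Irr k H) : Type u := Fin x.dim → k

/-- A representative of the class. -/
def rep (x : Irr k H) : Representation k H x.Space := (Quotient.out x).2.1

theorem rep_isIrreducible (x : Irr k H) : x.rep.IsIrreducible := (Quotient.out x).2.2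

theorem eq_of_equiv {x y : Irr k H} (e : x.rep.Equiv y.rep) : x = y := by
  rw [← Quotient.out_eq x, ← Quotient.out_eq y]
  exact Quotient.sound ⟨e⟩

instance finite [CharZero k] [Finite H] : Finite (Irr k H) := by
  have : NeZero (Nat.card H : k) := ⟨by exact_mod_cast Nat.card_pos.ne'⟩
  have hs (x : Irr k H) : IsSimpleModule (MonoidAlgebra k H) x.rep.asModule :=
    (Representation.irreducible_iff_isSimpleModule_asModule _).1 x.rep_isIrreducible
  have : IsNoetherian k (MonoidAlgebra k H) := inferInstance
  have : IsNoetherianRing (MonoidAlgebra k H) := isNoetherian_of_tower k this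
  choose I hI using fun x : Irr k H =>
    IsSemisimpleRing.exists_linearEquiv_ideal_of_isSimpleModule (MonoidAlgebra k H) x.rep.asModule
  have hI' (x : Irr k H) : IsSimpleModule (MonoidAlgebra k H) (I x) :=
    .congr (hI x).some.symm
  let F : Irr k H → isotypicComponents (MonoidAlgebra k H) (MonoidAlgebra k H) := fun x =>
    ⟨isotypicComponent _ _ (I x), I x, hI' x, rfl⟩
  refine Finite.of_injective F fun x y hxy => ?_
  have h1 : isotypicComponent (MonoidAlgebra k H) (MonoidAlgebra k H) (I x)
      = isotypicComponent (MonoidAlgebra k H) (MonoidAlgebra k H) (I y) := congrArg Subtype.val hxy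
  have h2 : I x ≤ isotypicComponent (MonoidAlgebra k H) (MonoidAlgebra k H) (I y) :=
    h1 ▸ Submodule.le_isotypicComponent _
  have h3 := (isIsotypicOfType_submodule_iff.1
    (IsIsotypicOfType.isotypicComponent (MonoidAlgebra k H) (MonoidAlgebra k H) (I y))) (I x) h2
  obtain ⟨e⟩ := h3
  have e' : x.rep.asModule ≃ₗ[MonoidAlgebra k H] y.rep.asModule :=
    (hI x).some.trans (e.trans (hI y).some.symm)
  exact eq_of_equiv (Representation.IntertwiningMap.ofBijective
    ((Representation.IntertwiningMap.equivLinearMapAsModule x.rep y.rep).symm e'.toLinearMap)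
    e'.bijective)

instance [CharZero k] [Finite H] : Fintype (Irr k H) := Fintype.ofFinite _

end Irr

/-! ## The quiver `Q_G` -/

/-- The choices made in the construction of `Q_G`. -/
structure OrbitData (G : Type z) (V : Type v) [Group G] [MulAction G V] where
  /-- A set of representatives of the orbits of vertices. -/
  T : Set V
  existsUnique_T : ∀ a : V, ∃! u, u ∈ T ∧ a ∈ MulAction.orbit G u
  /-- A set of representatives of the orbits of the diagonal action on `O_u × O_v`. -/
  O : T → T → Set (V × V)
  O_subset : ∀ u v : T, O u v ⊆ MulAction.orbit G (u : V) ×ˢ MulAction.orbit G (v : V)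
  existsUnique_O : ∀ u v : T, ∀ p ∈ MulAction.orbit G (u : V) ×ˢ MulAction.orbit G (v : V),
    ∃! q, q ∈ O u v ∧ p ∈ MulAction.orbit G q
  /-- Elements with `t a • u = a` for `u ∈ T` and `a ∈ O_u`. -/
  t : V → G
  t_smul : ∀ u ∈ T, ∀ a ∈ MulAction.orbit G u, t a • u = a

theorem arrowSpace_le (k : Type u) (V : Type v) [Field k] [Quiver.{w} V] (a b : V) : arrowSpace k a b ≤ arrowSpan k V :=
  Submodule.span_mono (by rintro _ ⟨f, rfl⟩; exact ⟨a, b, f, rfl⟩)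

section QG

variable (k : Type u) (V : Type v) (G : Type z) [Field k] [Quiver.{w} V] [Fintype V] [Group G]
  [MulSemiringAction G (PathAlgebra k V)] [MulAction G V]

theorem idem_mul_mul_idem_mem (a b : V) (x : PathAlgebra k V) (hx : x ∈ arrowSpan k V) :
    PathAlgebra.idem a * x * PathAlgebra.idem b ∈ arrowSpace k a b := by
  induction hx using Submodule.span_induction with
  | zero => simp
  | add x y _ _ hx hy => rw [mul_add, add_mul]; exact add_mem hx hy
  | smul c x _ hx => rw [mul_smul_comm, smul_mul_assoc]; exact Submodule.smul_mem _ _ hx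
  | mem x hx =>
    obtain ⟨c, d, f, rfl⟩ := hx
    by_cases h1 : a = c
    · subst h1
      by_cases h2 : d = b
      · subst h2
        have : (PathAlgebra.idem a * PathAlgebra.ofArrow f * PathAlgebra.idem d : PathAlgebra k V)
            = PathAlgebra.ofArrow f := by
          simp only [PathAlgebra.idem, PathAlgebra.ofArrow, PathAlgebra.ofPath_mul_ofPath,
            PathAlgebra.pathMul_comp, Quiver.Path.nil_comp, Quiver.Path.comp_nil]
        rw [this]
        exact Submodule.subset_span ⟨f, rfl⟩
      · have : (PathAlgebra.ofArrow f * PathAlgebra.idem b : PathAlgebra k V) = 0 := by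
          simp only [PathAlgebra.idem, PathAlgebra.ofArrow, PathAlgebra.ofPath_mul_ofPath]
          exact PathAlgebra.pathMul_of_ne h2
        rw [mul_assoc, this, mul_zero]
        exact zero_mem _
    · have : (PathAlgebra.idem a * PathAlgebra.ofArrow f : PathAlgebra k V) = 0 := by
        simp only [PathAlgebra.idem, PathAlgebra.ofArrow, PathAlgebra.ofPath_mul_ofPath]
        exact PathAlgebra.pathMul_of_ne h1
      rw [this, zero_mul]
      exact zero_mem _

theorem idem_mul_mul_idem_eq (a b : V) (x : PathAlgebra k V) (hx : x ∈ arrowSpace k a b) :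
    PathAlgebra.idem a * x * PathAlgebra.idem b = x := by
  induction hx using Submodule.span_induction with
  | zero => simp
  | add x y _ _ hx hy => rw [mul_add, add_mul, hx, hy]
  | smul c x _ hx => rw [mul_smul_comm, smul_mul_assoc, hx]
  | mem x hx =>
    obtain ⟨f, rfl⟩ := hx
    simp only [PathAlgebra.idem, PathAlgebra.ofArrow, PathAlgebra.ofPath_mul_ofPath,
      PathAlgebra.pathMul_comp, Quiver.Path.nil_comp, Quiver.Path.comp_nil]

variable {V G} in
theorem smul_mem_arrowSpace [IsQuiverAction k V G] (g : G) {a b : V} {x : PathAlgebra k V}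
    (hx : x ∈ arrowSpace k a b) : g • x ∈ arrowSpace k (g • a) (g • b) := by
  rw [← idem_mul_mul_idem_eq k V a b x hx, smul_mul', smul_mul', IsQuiverAction.smul_idem,
    IsQuiverAction.smul_idem]
  exact idem_mul_mul_idem_mem k V _ _ _
    (IsQuiverAction.smul_mem_arrowSpan _ _ (arrowSpace_le k V a b hx))

variable [SMulCommClass G k (PathAlgebra k V)]

variable {V} in
/-- The representation of `G_{ab} = G_a ∩ G_b` on `R_{ab}` by restriction of the action of `G`. -/
def arrowRep [IsQuiverAction k V G] (a b : V) :
    Representation k ↥(MulAction.stabilizer G a ⊓ MulAction.stabilizer G b) (arrowSpace k a b) where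
  toFun g :=
    { toFun := fun x => ⟨(g : G) • (x : PathAlgebra k V), by
        have h := smul_mem_arrowSpace k (g : G) x.2
        rwa [MulAction.mem_stabilizer_iff.1 g.2.1, MulAction.mem_stabilizer_iff.1 g.2.2] at h⟩
      map_add' := fun x y => Subtype.ext (smul_add _ _ _)
      map_smul' := fun c x => Subtype.ext (smul_comm _ _ _) }
  map_one' := by ext x; simp
  map_mul' g h := by ext x; simp [mul_smul]

variable {k V G}

/-- If `g u = a`, the homomorphism `h ↦ g⁻¹ h g` from a subgroup of `G_a` to `G_u`. -/
def conjStabilizer {u a : V} (g : G) (hg : g • u = a) (H : Subgroup G)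
    (hH : H ≤ MulAction.stabilizer G a) : H →* MulAction.stabilizer G u where
  toFun h := ⟨g⁻¹ * h * g, by
    have := MulAction.mem_stabilizer_iff.1 (hH h.2)
    rw [MulAction.mem_stabilizer_iff, mul_smul, mul_smul, hg, this, ← hg, inv_smul_smul]⟩
  map_one' := by ext; simp
  map_mul' x y := by ext; simp [mul_assoc]

/-- `V_ρ` for `ρ ∈ irr(G_u)`, seen as a representation of a subgroup of `G_a`, `a ∈ O_u`, by means
of the chosen element carrying `u` to `a`. -/
def transportRep (D : OrbitData G V) (u : D.T) (ρ : Irr k (MulAction.stabilizer G (u : V)))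
    (a : V) (ha : a ∈ MulAction.orbit G (u : V)) (H : Subgroup G)
    (hH : H ≤ MulAction.stabilizer G a) : Representation k H ρ.Space :=
  ρ.rep.comp (conjStabilizer (D.t a) (D.t_smul u u.2 a ha) H hH)

variable (k) in
/-- The vertices `(u, ρ)` of `Q_G`: `u` is a chosen representative of an orbit of vertices and
`ρ ∈ irr(G_u)`. -/
def SkewVertex (D : OrbitData G V) : Type (max u v z) :=
  Σ u : D.T, Irr k (MulAction.stabilizer G (u : V))

instance (D : OrbitData G V) [CharZero k] [Finite G] : Fintype (SkewVertex k D) :=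
  have : Finite (SkewVertex k D) :=
    inferInstanceAs (Finite (Σ u : D.T, Irr k (MulAction.stabilizer G (u : V))))
  Fintype.ofFinite _

/-- The vector space `⨁_{(a, b) ∈ O_{uv}} Hom_{G_{ab}} (V_ρ, R_{ab} ⊗ V_σ)`. -/
abbrev ArrowHom [IsQuiverAction k V G] (D : OrbitData G V) (x y : SkewVertex k D) :
    Type (max u v w) :=
  ∀ p : D.O x.1 y.1, Representation.IntertwiningMap
    (transportRep D x.1 x.2 p.1.1 (D.O_subset _ _ p.2).1
      (MulAction.stabilizer G p.1.1 ⊓ MulAction.stabilizer G p.1.2) inf_le_left)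
    ((arrowRep k G p.1.1 p.1.2).tprod
      (transportRep D y.1 y.2 p.1.2 (D.O_subset _ _ p.2).2
        (MulAction.stabilizer G p.1.1 ⊓ MulAction.stabilizer G p.1.2) inf_le_right))

/-- The quiver `Q_G`: the arrows from `(u, ρ)` to `(v, σ)` are the elements of a basis of
`⨁_{(a, b) ∈ O_{uv}} Hom_{G_{ab}} (V_ρ, R_{ab} ⊗ V_σ)`. -/
instance [IsQuiverAction k V G] (D : OrbitData G V) : Quiver (SkewVertex k D) where
  Hom x y := Module.Basis.ofVectorSpaceIndex k (ArrowHom D x y)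

open scoped Classical in
/-- The linear map `r : K₀(kQ_G) → K₀(kQ)`, in the bases of vertex simples:
`r [S_(u, ρ)] = ∑_{a ∈ O_u} dim V_ρ [S_a]`. -/
def rMap [CharZero k] [Finite G] (D : OrbitData G V) : (SkewVertex k D → ℤ) →ₗ[ℤ] (V → ℤ) :=
  ∑ x : SkewVertex k D, (LinearMap.proj x).smulRight
    fun a => if a ∈ MulAction.orbit G (x.1 : V) then (x.2.dim : ℤ) else 0

/-! ## The functor `R` -/

variable (k) in
/-- `ε` consists of primitive idempotents `ε (u, ρ)` of `k[G_u]` corresponding to `ρ`: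
the left ideal generated by `ε (u, ρ)` is isomorphic to `V_ρ`. -/
def IsPrimitiveIdempotentFamily (D : OrbitData G V)
    (ε : ∀ x : SkewVertex k D, MonoidAlgebra k (MulAction.stabilizer G (x.1 : V))) : Prop :=
  ∀ x : SkewVertex k D, IsIdempotentElem (ε x) ∧
    Nonempty (Ideal.span {ε x} ≃ₗ[MonoidAlgebra k (MulAction.stabilizer G (x.1 : V))]
      x.2.rep.asModule)

/-- The embedding `k[G_a] → e_a (AG) e_a`, `h ↦ e_a h`. -/
def stabilizerEmb (a : V) (c : MonoidAlgebra k (MulAction.stabilizer G a)) :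
    SkewPathAlgebra k V G :=
  c.coeff.sum fun h s => SkewMonoidAlgebra.single (h : G) (s • PathAlgebra.idem a)

end QG

section Corner

variable {k : Type u} {R : Type v} [Field k] [Ring R] [Algebra k R] {e : R}
  (he : IsIdempotentElem e)

instance cornerModule : Module k he.Corner where
  smul c x := ⟨c • x.1, by
    obtain ⟨y, hy⟩ := x.2
    exact ⟨c • y, by simp only [← hy, mul_smul_comm, smul_mul_assoc]⟩⟩
  one_smul x := Subtype.ext (one_smul k x.1)
  mul_smul a b x := Subtype.ext (mul_smul a b x.1)
  smul_zero a := Subtype.ext (smul_zero a)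
  smul_add a x y := Subtype.ext (smul_add a x.1 y.1)
  add_smul a b x := Subtype.ext (add_smul a b x.1)
  zero_smul x := Subtype.ext (zero_smul k x.1)

instance cornerAlgebra : Algebra k he.Corner :=
  Algebra.ofModule (fun c x y => Subtype.ext (smul_mul_assoc c x.1 y.1))
    (fun c x y => Subtype.ext (mul_smul_comm c x.1 y.1))

/-- The element `e x e` of the corner ring `e R e`. -/
def toCorner (x : R) : he.Corner := ⟨e * x * e, x, rfl⟩

/-- The `(e R e, R)`-bimodule `e R`. -/
def EIdeal (e : R) : AddSubgroup R where
  carrier := {x | e * x = x}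
  zero_mem' := mul_zero e
  add_mem' {x y} hx hy := by
    change e * (x + y) = x + y
    rw [mul_add, show e * x = x from hx, show e * y = y from hy]
  neg_mem' {x} hx := by
    change e * (-x) = -x
    rw [mul_neg, show e * x = x from hx]

instance : Module he.Corner (EIdeal e) where
  smul b x := ⟨b.1 * x.1, by
    change e * (b.1 * x.1) = b.1 * x.1
    rw [← mul_assoc, ((Subsemigroup.mem_corner_iff he).1 b.2).1]⟩
  one_smul x := Subtype.ext x.2
  mul_smul a b x := Subtype.ext (mul_assoc a.1 b.1 x.1)
  smul_zero a := Subtype.ext (mul_zero a.1)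
  smul_add a x y := Subtype.ext (mul_add a.1 x.1 y.1)
  add_smul a b x := Subtype.ext (add_mul a.1 b.1 x.1)
  zero_smul x := Subtype.ext (zero_mul x.1)

/-- Right multiplication by `a ∈ R` on `e R`, a map of left `e R e`-modules. -/
def EIdeal.mulRight (a : R) : EIdeal e →ₗ[he.Corner] EIdeal e where
  toFun x := ⟨x.1 * a, by
    change e * (x.1 * a) = x.1 * a
    rw [← mul_assoc, show e * x.1 = x from x.2]⟩
  map_add' x y := Subtype.ext (add_mul x.1 y.1 a)
  map_smul' b x := Subtype.ext (mul_assoc b.1 x.1 a)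

variable (N : Type z) [AddCommGroup N] [Module k N] [Module he.Corner N]
  [IsScalarTower k he.Corner N]

/-- `R_e N = Hom_{eRe} (eR, N)`. -/
def CornerHom : Type (max v z) := EIdeal e →ₗ[he.Corner] N

namespace CornerHom

instance : AddCommGroup (CornerHom he N) :=
  inferInstanceAs (AddCommGroup (EIdeal e →ₗ[he.Corner] N))

instance : Module k (CornerHom he N) :=
  inferInstanceAs (Module k (EIdeal e →ₗ[he.Corner] N))

/-- The left `R`-module structure `(a f)(x) = f (x a)` on `Hom_{eRe} (eR, N)`. -/
instance : Module R (CornerHom he N) where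
  smul a f := LinearMap.comp (show EIdeal e →ₗ[he.Corner] N from f) (EIdeal.mulRight he a)
  one_smul f := LinearMap.ext fun x =>
    congrArg (show EIdeal e →ₗ[he.Corner] N from f) (Subtype.ext (mul_one x.1))
  mul_smul a b f := LinearMap.ext fun x =>
    congrArg (show EIdeal e →ₗ[he.Corner] N from f) (Subtype.ext (mul_assoc x.1 a b).symm)
  smul_zero _ := LinearMap.ext fun _ => rfl
  smul_add _ _ _ := LinearMap.ext fun _ => rfl
  add_smul a b f := LinearMap.ext fun x =>
    (congrArg (show EIdeal e →ₗ[he.Corner] N from f) (Subtype.ext (mul_add x.1 a b))).trans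
      (map_add (show EIdeal e →ₗ[he.Corner] N from f) _ _)
  zero_smul f := LinearMap.ext fun x =>
    (congrArg (show EIdeal e →ₗ[he.Corner] N from f) (Subtype.ext (mul_zero x.1))).trans
      (map_zero (show EIdeal e →ₗ[he.Corner] N from f))

instance : IsScalarTower k R (CornerHom he N) where
  smul_assoc c a f := LinearMap.ext fun x => by
    let F : EIdeal e →ₗ[he.Corner] N := f
    change F (EIdeal.mulRight he (c • a) x) = c • F (EIdeal.mulRight he a x)
    have h : EIdeal.mulRight he (c • a) x
        = (c • (1 : he.Corner)) • EIdeal.mulRight he a x := Subtype.ext <| by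
      change x.1 * (c • a) = (c • e) * (x.1 * a)
      rw [mul_smul_comm, smul_mul_assoc, ← mul_assoc, show e * x.1 = x from x.2]
    rw [h, map_smul, smul_assoc, one_smul]

end CornerHom

end Corner

end

/-! Let `e` be the sum of the idempotents attached to the vertices `(u, ρ)` of $Q_G$. Two facts
carry the theorem: `e` is a full idempotent of $AG$, so that $AG$ and $e(AG)e$ are Morita
equivalent, and $e(AG)e$ is the path algebra of $Q_G$.

Fullness is made explicit by `matrixSystem`. For each vertex `(u, ρ)`, each $a \in O_u$ and each
coordinate of $V_\rho$ there is a column $s_i$ ending in the idempotent $E_{(u,\rho)}$ and starting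
in $e_a$, and a dual row $t_i$, with $t_i s_i = E$, $t_i s_j = 0$ for $i \ne j$, and $\sum s_i t_i =
1$. Consequently an $AG$-module $M$ and the module $eM$ have isomorphic submodule lattices
(`submoduleOrderIso`), so indecomposability passes between them. Also $e_a M$ is the direct sum of
the $s_i E_{c(i)} M$ over the indices lying at $a$. There are $\dim V_\rho$ of these for every `(u,
ρ)` with $a \in O_u$, which is exactly the formula for $r$ (`rMap_dimVector`).

For the second fact, $AG$ is graded by path length, is generated in degrees 0 and 1, and compatible
maps on these two degrees extend to the whole algebra (`SkewPathAlgebra.exists_lift`). The lemma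
`exists_corner_equiv` carries this freeness over to the corner, so only degrees 0 and 1 of $e(AG)e$
remain to be computed. Degree 0 is spanned by the $E_x$, by Schur's lemma and the splitting
hypothesis (`mul_mul_mem_span`). In degree 1, right multiplication by $z \in E_x (AG)_1 E_y$ maps a
copy of $V_\rho$ to $(AG)_1 E_y$. Its components in the spaces $R_{ab} \otimes V_\sigma$, for
$(a,b)$ in the chosen set of representatives, are intertwining maps, and they determine $z$;
averaging over $G_u$ realizes every family of such maps (`orbitHomEquiv`).

The rows and columns come from the representation theory of the groups $G_u$: an element of $k[H]$
is determined by its action on the irreducible representations (Maschke), and that action can be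
prescribed arbitrarily (density and splitting). -/

noncomputable section

set_option linter.unusedSectionVars false

/-! ### Schur's lemma, Maschke's theorem and density for the group algebra -/

namespace Irr

variable {k : Type u} {H : Type z} [Field k] [Group H]

/-- The action of the group algebra on the representative of an irreducible class. -/
def act (x : Irr k H) : MonoidAlgebra k H →ₐ[k] Module.End k x.Space :=
  x.rep.asAlgebraHom

theorem act_single (x : Irr k H) (h : H) (v : x.Space) :
    x.act (MonoidAlgebra.single h 1) v = x.rep h v := by
  simp [act]

instance (x : Irr k H) : x.rep.IsIrreducible := x.rep_isIrreducible

instance (x : Irr k H) : Nontrivial x.Space :=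
  IsSimpleModule.nontrivial (MonoidAlgebra k H) x.rep.asModule

theorem commuting_eq_zero {x y : Irr k H} (hxy : x ≠ y) (f : x.Space →ₗ[k] y.Space)
    (hf : ∀ w v, f (x.act w v) = y.act w (f v)) : f = 0 := by
  let F : Representation.IntertwiningMap x.rep y.rep :=
    f.intertwiningMap_of_isIntertwiningMap _ _ fun g v => by
      simpa [act_single] using hf (MonoidAlgebra.single g 1) v
  rcases Representation.IsIrreducible.bijective_or_eq_zero F with h | h
  · exact absurd (eq_of_equiv (Representation.IntertwiningMap.ofBijective F h)) hxy
  · exact congrArg Representation.IntertwiningMap.toLinearMap h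

/-- Splitting is used here: the intertwining maps form a line containing the nonzero identity. -/
theorem commuting_eq_smul {x : Irr k H}
    (hx : Module.finrank k (Representation.IntertwiningMap x.rep x.rep) = 1)
    (f : x.Space →ₗ[k] x.Space) (hf : ∀ w v, f (x.act w v) = x.act w (f v)) :
    ∃ c : k, ∀ v, f v = c • v := by
  let F : Representation.IntertwiningMap x.rep x.rep :=
    f.intertwiningMap_of_isIntertwiningMap _ _ fun g v => by
      simpa [act_single] using hf (MonoidAlgebra.single g 1) v
  have h1 : (1 : Representation.IntertwiningMap x.rep x.rep) ≠ 0 := by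
    obtain ⟨v, hv⟩ := exists_ne (0 : x.Space)
    intro h
    exact hv (DFunLike.congr_fun h v)
  obtain ⟨c, hc⟩ := exists_smul_eq_of_finrank_eq_one hx h1 F
  exact ⟨c, fun v => (DFunLike.congr_fun hc v).symm⟩

/-- A basis moves the action to a coordinate space. The representative stored by the class of the
result is only isomorphic to this one, whence the second equivalence. -/
theorem exists_equiv_of_isSimpleModule [CharZero k] [Finite H] (M : Type*) [AddCommGroup M]
    [Module k M] [Module (MonoidAlgebra k H) M] [IsScalarTower k (MonoidAlgebra k H) M]
    [FiniteDimensional k M] [IsSimpleModule (MonoidAlgebra k H) M] :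
    ∃ (x : Irr k H) (e : M ≃ₗ[k] x.Space), ∀ w m, e (w • m) = x.act w (e m) := by
  let b : M ≃ₗ[k] (Fin (Module.finrank k M) → k) := (Module.finBasis k M).equivFun
  let F : MonoidAlgebra k H →ₐ[k] Module.End k (Fin (Module.finrank k M) → k) :=
    (b.conjAlgEquiv k).toAlgHom.comp (Algebra.lsmul k k M)
  have hF (w m) : F w (b m) = b (w • m) := by
    simp [F, LinearEquiv.conjAlgEquiv_apply]
  let ρ : Representation k H (Fin (Module.finrank k M) → k) := (MonoidAlgebra.lift k _ H).symm F
  have hρ : ρ.asAlgebraHom = F := (MonoidAlgebra.lift k _ H).apply_symm_apply F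
  let B : M ≃ₗ[MonoidAlgebra k H] ρ.asModule :=
    { b.toAddEquiv with
      map_smul' := fun w m => by
        change b (w • m) = ρ.asAlgebraHom w (b m)
        rw [hρ, hF] }
  have hirr : ρ.IsIrreducible :=
    (Representation.irreducible_iff_isSimpleModule_asModule _).2 (.congr B.symm)
  let x : Irr k H := Quotient.mk _ ⟨_, ρ, hirr⟩
  have hx : Nonempty ((Quotient.out x).2.1.Equiv ρ) :=
    Quotient.mk_out (s := irrRepSetoid k H) (⟨_, ρ, hirr⟩ : IrrRep k H)
  obtain ⟨e⟩ := hx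
  refine ⟨x, b.trans e.symm.toLinearEquiv, fun w m => ?_⟩
  have key : ∀ w n, e.symm (ρ.asAlgebraHom w n) = x.act w (e.symm n) := by
    intro w n
    induction w using MonoidAlgebra.induction_linear with
    | zero => rw [map_zero, map_zero]; exact map_zero _
    | add f g hf hg =>
      rw [map_add, map_add]
      exact (map_add e.symm _ _).trans (congrArg₂ _ hf hg)
    | single g c =>
      have h1 := e.symm.toIntertwiningMap.isIntertwining _ _ g n
      rw [act, Representation.asAlgebraHom_single, Representation.asAlgebraHom_single]
      exact (map_smul e.symm _ _).trans (congrArg (c • ·) h1)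
  change e.symm (b (w • m)) = _
  rw [← hF, ← hρ, key]
  rfl

/-- By Maschke, the group algebra is the sum of its simple left ideals. Each is isomorphic to some
$V_\rho$, hence killed by `w`, so `w` kills 1. -/
theorem eq_zero_of_act_eq_zero [CharZero k] [Finite H] (w : MonoidAlgebra k H)
    (hw : ∀ x : Irr k H, x.act w = 0) : w = 0 := by
  have : NeZero (Nat.card H : k) := ⟨by exact_mod_cast Nat.card_pos.ne'⟩
  have key : ∀ m : MonoidAlgebra k H, w • m = 0 := by
    intro m
    have hm : m ∈ sSup {N : Submodule (MonoidAlgebra k H) (MonoidAlgebra k H) |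
        IsSimpleModule (MonoidAlgebra k H) N} := by
      rw [IsSemisimpleModule.sSup_simples_eq_top]; trivial
    rw [sSup_eq_iSup'] at hm
    induction hm using Submodule.iSup_induction' with
    | zero => simp
    | add a b _ _ ha hb => rw [smul_add, ha, hb, add_zero]
    | mem N m hm =>
      have : IsSimpleModule (MonoidAlgebra k H) N.1 := N.2
      obtain ⟨x, e, he⟩ := exists_equiv_of_isSimpleModule (k := k) (H := H) N.1
      have h2 := he w ⟨m, hm⟩
      rw [hw, LinearMap.zero_apply, LinearEquiv.map_eq_zero_iff] at h2
      exact congrArg Subtype.val h2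
  simpa using key 1

/-- The Jacobson density theorem for the sum of one copy of each irreducible representation: by
Schur and splitting its endomorphisms act on each summand by a scalar, so every family of linear
maps commutes with them. -/
theorem exists_act_eq [CharZero k] [Finite H]
    (hs : ∀ x : Irr k H, Module.finrank k (Representation.IntertwiningMap x.rep x.rep) = 1)
    (f : ∀ x : Irr k H, Module.End k x.Space) : ∃ w, ∀ x : Irr k H, x.act w = f x := by
  classical
  have : NeZero (Nat.card H : k) := ⟨by exact_mod_cast Nat.card_pos.ne'⟩
  let M := ∀ x : Irr k H, x.rep.asModule
  let sg (x : Irr k H) : x.rep.asModule →ₗ[MonoidAlgebra k H] M :=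
    LinearMap.single (MonoidAlgebra k H) (fun x : Irr k H => x.rep.asModule) x
  have hφ : ∀ (φ : Module.End (MonoidAlgebra k H) M) (x : Irr k H),
      ∃ c : k, ∀ m : M, φ m x = c • m x := by
    intro φ x
    let g (y : Irr k H) : y.Space →ₗ[k] x.Space :=
      { toFun := fun v => φ (sg y v) x
        map_add' := fun a b => by
          have : sg y (a + b) = sg y a + sg y b := map_add _ _ _
          rw [this, map_add]; rfl
        map_smul' := fun c a => by
          have : sg y (c • a) = c • sg y a := LinearMap.map_smul_of_tower (sg y) c a
          rw [this, LinearMap.map_smul_of_tower]; rfl }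
    have hg (y : Irr k H) (w v) : g y (y.act w v) = x.act w (g y v) := by
      change φ (sg y (w • (show y.rep.asModule from v))) x = w • φ (sg y v) x
      rw [map_smul, map_smul]; rfl
    obtain ⟨c, hc⟩ := commuting_eq_smul (hs x) (g x) (hg x)
    refine ⟨c, fun m => ?_⟩
    have hm : m = ∑ y, sg y (m y) := (Finset.univ_sum_single m).symm
    conv_lhs => rw [hm, map_sum, Finset.sum_apply]
    rw [Finset.sum_eq_single x]
    · exact hc (m x)
    · intro y _ hy
      exact LinearMap.congr_fun (commuting_eq_zero hy (g y) (hg y)) (m y)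
    · simp
  let F : Module.End (Module.End (MonoidAlgebra k H) M) M :=
    { toFun := fun m x => f x (m x)
      map_add' := fun a b => funext fun x => (f x).map_add _ _
      map_smul' := fun φ m => funext fun x => by
        obtain ⟨c, hc⟩ := hφ φ x
        change f x (φ m x) = φ (fun x => f x (m x)) x
        refine (congrArg (f x) (hc m)).trans (((f x).map_smul _ _).trans ?_)
        exact (hc fun x => f x (m x)).symm }
  -- Density only gives agreement on finite sets; the standard basis vectors of all the summands
  -- suffice.
  let s : Finset M := Finset.univ.image fun p : (Σ x : Irr k H, Fin x.dim) =>
    sg p.1 (Pi.single p.2 (1 : k) : p.1.Space)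
  obtain ⟨r, hr⟩ := jacobson_density F s
  refine ⟨r, fun x => ?_⟩
  refine LinearMap.pi_ext' fun i => LinearMap.ext_ring ?_
  have h1 := congrFun (hr (sg x (Pi.single i (1 : k) : x.Space))
    (Finset.mem_image.2 ⟨⟨x, i⟩, Finset.mem_univ _, rfl⟩)) x
  have h2 : (sg x (Pi.single i (1 : k) : x.Space)) x = (Pi.single i (1 : k) : x.Space) :=
    Pi.single_eq_same (M := fun x : Irr k H => x.rep.asModule) _ _
  change f x ((sg x (Pi.single i (1 : k) : x.Space)) x)
    = x.act r ((sg x (Pi.single i (1 : k) : x.Space)) x) at h1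
  rw [h2] at h1
  exact h1.symm

end Irr

/-! ### Primitive idempotents of the group algebra and their dual families -/

namespace Irr

variable {k : Type u} {H : Type z} [Field k] [Group H]

theorem act_injective [CharZero k] [Finite H] {a b : MonoidAlgebra k H}
    (h : ∀ (x : Irr k H) (v : x.Space), x.act a v = x.act b v) : a = b := by
  rw [← sub_eq_zero]
  refine eq_zero_of_act_eq_zero _ fun x => LinearMap.ext fun v => ?_
  rw [map_sub, LinearMap.sub_apply, h, sub_self, LinearMap.zero_apply]

/-- Coordinates on the ideals `k[H] ε_ρ ≃ V_ρ` generated by primitive idempotents of a group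
algebra: the embedding `ι` of `V_ρ` and a dual family `t`. -/
structure IdempotentData (ε : Irr k H → MonoidAlgebra k H) where
  /-- The embedding of `V_ρ` with image `k[H] ε_ρ`. -/
  ι : ∀ x : Irr k H, x.Space →ₗ[k] MonoidAlgebra k H
  /-- The vector corresponding to `ε_ρ`. -/
  v₀ : ∀ x : Irr k H, x.Space
  /-- The dual family. -/
  t : ∀ x : Irr k H, Fin x.dim → MonoidAlgebra k H
  mul_ι : ∀ x w v, w * ι x v = ι x (x.act w v)
  ι_v₀ : ∀ x, ι x (v₀ x) = ε x
  ι_mul : ∀ x v, ι x v * ε x = ι x v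
  act_ι : ∀ (x : Irr k H) (v), x.act (ι x v) (v₀ x) = v
  mul_t : ∀ x i, ε x * t x i = t x i
  t_mul_ι : ∀ x i v, t x i * ι x v = v i • ε x
  t_mul_ι_of_ne : ∀ x y i v, x ≠ y → t x i * ι y v = 0
  corner : ∀ x w, ∃ c : k, ε x * w * ε x = c • ε x
  corner_of_ne : ∀ x y w, x ≠ y → ε x * w * ε y = 0

/-- The sum fixes every `d.ι y v` under left multiplication, by duality. Applying both sides to
`d.v₀ y`, which `d.ι y v` sends to `v`, shows that it acts as the identity on every irreducible
representation. -/
theorem IdempotentData.sum [CharZero k] [Finite H] {ε : Irr k H → MonoidAlgebra k H}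
    (d : IdempotentData ε) : ∑ x, ∑ i, d.ι x (Pi.single i 1) * d.t x i = 1 := by
  classical
  refine act_injective fun y v => ?_
  have key : ∀ (x : Irr k H) (v : x.Space),
      (∑ x, ∑ i, d.ι x (Pi.single i 1) * d.t x i) * d.ι x v = d.ι x v := by
    intro x v
    rw [Finset.sum_mul, Finset.sum_eq_single x]
    · rw [Finset.sum_mul]
      simp only [mul_assoc, d.t_mul_ι, mul_smul_comm, d.ι_mul]
      simp only [← map_smul, ← map_sum]
      congr 1
      ext j
      simp [Finset.sum_apply, Pi.single_apply]
    · intro z _ hz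
      rw [Finset.sum_mul]
      exact Finset.sum_eq_zero fun i _ => by rw [mul_assoc, d.t_mul_ι_of_ne _ _ _ _ hz, mul_zero]
    · simp
  have h := congrArg (fun a => y.act a (d.v₀ y)) (key y v)
  simpa [map_mul, d.act_ι] using h

theorem exists_embedding (x : Irr k H) {ε : MonoidAlgebra k H} (hid : IsIdempotentElem ε)
    (θ : Ideal.span {ε} ≃ₗ[MonoidAlgebra k H] x.rep.asModule) :
    ∃ (ι : x.Space →ₗ[k] MonoidAlgebra k H) (v₀ : x.Space),
      (∀ w v, w * ι v = ι (x.act w v)) ∧ ι v₀ = ε ∧ (∀ v, ι v * ε = ι v) ∧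
        ∀ v, x.act (ι v) v₀ = v := by
  let ι : x.Space →ₗ[k] MonoidAlgebra k H :=
    { toFun := fun v => (θ.symm v : MonoidAlgebra k H)
      map_add' := fun a b => congrArg Subtype.val (θ.symm.map_add a b)
      map_smul' := fun c a => congrArg Subtype.val
        (LinearMap.map_smul_of_tower θ.symm.toLinearMap c (show x.rep.asModule from a)) }
  let v₀ : x.Space := θ ⟨ε, Ideal.subset_span rfl⟩
  have hv₀ : ι v₀ = ε := congrArg Subtype.val (θ.symm_apply_apply _)
  have mul_ι w v : w * ι v = ι (x.act w v) :=
    (congrArg Subtype.val (θ.symm.map_smul w (show x.rep.asModule from v))).symm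
  have ι_inj : Function.Injective ι := fun a b h => θ.symm.injective (Subtype.ext h)
  have ι_mul v : ι v * ε = ι v := by
    obtain ⟨a, ha⟩ := Ideal.mem_span_singleton'.1 (θ.symm v).2
    change _ = ι v at ha
    rw [← ha, mul_assoc, hid.eq]
  exact ⟨ι, v₀, mul_ι, hv₀, ι_mul, fun v => ι_inj (by rw [← mul_ι, hv₀, ι_mul])⟩

/-- For fixed `n`, the map `v ↦ y.act (ι v) n` intertwines two non-isomorphic irreducible
representations. The next lemma applies the same map within one class. -/
theorem act_embedding_of_ne {x y : Irr k H} (hxy : x ≠ y) {ι : x.Space →ₗ[k] MonoidAlgebra k H}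
    (hι : ∀ w v, w * ι v = ι (x.act w v)) (v : x.Space) (n : y.Space) : y.act (ι v) n = 0 := by
  let f : x.Space →ₗ[k] y.Space := (LinearMap.applyₗ n).comp (y.act.toLinearMap.comp ι)
  have hf v : f v = y.act (ι v) n := rfl
  rw [← hf, commuting_eq_zero hxy f fun w v => by rw [hf, hf, ← hι, map_mul]; rfl,
    LinearMap.zero_apply]

theorem exists_act_embedding {x : Irr k H}
    (hx : Module.finrank k (Representation.IntertwiningMap x.rep x.rep) = 1)
    {ι : x.Space →ₗ[k] MonoidAlgebra k H}
    (hι : ∀ w v, w * ι v = ι (x.act w v)) (n : x.Space) :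
    ∃ c : k, ∀ v, x.act (ι v) n = c • v := by
  let f : x.Space →ₗ[k] x.Space := (LinearMap.applyₗ n).comp (x.act.toLinearMap.comp ι)
  have hf v : f v = x.act (ι v) n := rfl
  exact commuting_eq_smul hx f fun w v => by rw [hf, hf, ← hι, map_mul]; rfl

/-- All identities are tested on the irreducible representations. There `ε x` is zero away from `x`,
and on $V_x$ it has rank one, with image the line through `v₀ x`. -/
theorem nonempty_idempotentData [CharZero k] [Finite H]
    (hs : ∀ x : Irr k H, Module.finrank k (Representation.IntertwiningMap x.rep x.rep) = 1)
    (ε : Irr k H → MonoidAlgebra k H)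
    (hε : ∀ x, IsIdempotentElem (ε x) ∧
      Nonempty (Ideal.span {ε x} ≃ₗ[MonoidAlgebra k H] x.rep.asModule)) :
    Nonempty (IdempotentData ε) := by
  classical
  choose ι v₀ mul_ι hv₀ ι_mul act_ι using fun x => exists_embedding x (hε x).1 (hε x).2.some
  have orth (x y : Irr k H) (hxy : x ≠ y) (v) (n) : y.act (ι x v) n = 0 :=
    act_embedding_of_ne hxy (mul_ι x) v n
  choose c hc using fun (x : Irr k H) n => exists_act_embedding (hs x) (mul_ι x) n
  have hε0 (x y : Irr k H) (hxy : x ≠ y) n : y.act (ε x) n = 0 := by rw [← hv₀]; exact orth x y hxy _ n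
  have hε1 (x : Irr k H) (n) : x.act (ε x) n = c x n • v₀ x := by rw [← hv₀]; exact hc x n _
  have hεv (x : Irr k H) : x.act (ε x) (v₀ x) = v₀ x := by rw [← hv₀]; exact act_ι x _
  -- The dual element `t x i` is prescribed to act as $n \mapsto n_i v_0$ on $V_x$ and as zero on
  -- the other classes.
  choose t ht using fun (x : Irr k H) (i : Fin x.dim) => exists_act_eq hs
    (Function.update 0 x ((LinearMap.proj i : x.Space →ₗ[k] k).smulRight (v₀ x)))
  have ht0 (x y : Irr k H) (hxy : x ≠ y) i n : y.act (t x i) n = 0 := by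
    rw [ht, Function.update_of_ne hxy.symm]; rfl
  have ht1 (x : Irr k H) (i) n : x.act (t x i) n = n i • v₀ x := by
    rw [ht, Function.update_self]; rfl
  have corner (x : Irr k H) (w) : ∃ c : k, ε x * w * ε x = c • ε x := by
    refine ⟨c x (x.act w (v₀ x)), act_injective fun (y : Irr k H) n => ?_⟩
    by_cases hxy : x = y
    · subst hxy
      simp only [map_mul, Module.End.mul_apply, map_smul, LinearMap.smul_apply, hε1]
      rw [smul_comm]
    · simp [map_mul, hε0 x y hxy]
  refine ⟨⟨ι, v₀, t, mul_ι, hv₀, ι_mul, act_ι, fun x i => ?_, fun x i v => ?_,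
    fun x y i v hxy => ?_, corner, fun x y w hxy => ?_⟩⟩
  · refine act_injective fun (y : Irr k H) n => ?_
    by_cases hxy : x = y
    · subst hxy
      simp [map_mul, ht1, hεv]
    · simp [map_mul, hε0 x y hxy, ht0 x y hxy]
  · rw [mul_ι, ht1, map_smul, hv₀]
  · rw [mul_ι, ht0 _ _ hxy, map_zero]
  · refine act_injective fun (z : Irr k H) n => ?_
    by_cases hxz : x = z
    · subst hxz
      simp [map_mul, hε0 y x (Ne.symm hxy)]
    · simp [map_mul, hε0 x z hxz]

/-- By density there is an element acting on $V_x$ as the projection to one coordinate line and as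
zero elsewhere. Its left ideal is identified with $V_x$ by acting on the vector `e x` spanning that
line. -/
theorem exists_idempotents [CharZero k] [Finite H]
    (hs : ∀ x : Irr k H, Module.finrank k (Representation.IntertwiningMap x.rep x.rep) = 1) :
    ∃ ε : Irr k H → MonoidAlgebra k H, ∀ x, IsIdempotentElem (ε x) ∧
      Nonempty (Ideal.span {ε x} ≃ₗ[MonoidAlgebra k H] x.rep.asModule) := by
  classical
  have hne (x : Irr k H) : ∃ i : Fin x.dim, True := by
    by_contra h
    have : IsEmpty (Fin x.dim) := ⟨fun i => h ⟨i, trivial⟩⟩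
    exact not_subsingleton x.Space inferInstance
  choose i₀ _ using hne
  let e (x : Irr k H) : x.Space := Pi.single (i₀ x) 1
  have he x : e x (i₀ x) = 1 := Pi.single_eq_same _ _
  choose ε hε using fun x : Irr k H => exists_act_eq hs
    (Function.update 0 x ((LinearMap.proj (i₀ x) : x.Space →ₗ[k] k).smulRight (e x)))
  have h0 (x y : Irr k H) (hxy : x ≠ y) n : y.act (ε x) n = 0 := by
    rw [hε, Function.update_of_ne hxy.symm]; rfl
  have h1 (x : Irr k H) (n) : x.act (ε x) n = n (i₀ x) • e x := by
    rw [hε, Function.update_self]; rfl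
  have hid x : IsIdempotentElem (ε x) := by
    refine act_injective fun (y : Irr k H) n => ?_
    by_cases hxy : x = y
    · subst hxy
      simp [map_mul, h1, he]
    · simp [map_mul, h0 x y hxy]
  refine ⟨ε, fun x => ⟨hid x, ?_⟩⟩
  let F : MonoidAlgebra k H →ₗ[MonoidAlgebra k H] x.rep.asModule :=
    LinearMap.toSpanSingleton _ _ (show x.rep.asModule from e x)
  have hF w : F w = x.act w (e x) := rfl
  refine ⟨LinearEquiv.ofBijective (F.domRestrict (Ideal.span {ε x})) ⟨?_, ?_⟩⟩
  · rw [injective_iff_map_eq_zero]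
    rintro ⟨w, hw⟩ h
    obtain ⟨a, rfl⟩ := Ideal.mem_span_singleton'.1 hw
    replace h : x.act (a * ε x) (e x) = 0 := h
    rw [map_mul, Module.End.mul_apply, h1, he, one_smul] at h
    refine Subtype.ext (act_injective fun (y : Irr k H) n => ?_)
    by_cases hxy : x = y
    · subst hxy
      simp [map_mul, h1, h]
    · simp [map_mul, h0 x y hxy]
  · intro v
    obtain ⟨w, hw⟩ := exists_act_eq hs
      (Function.update 0 x ((LinearMap.proj (i₀ x) : x.Space →ₗ[k] k).smulRight
        (show x.Space from v)))
    refine ⟨⟨w * ε x, Ideal.mem_span_singleton'.2 ⟨w, rfl⟩⟩, ?_⟩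
    change x.act (w * ε x) (e x) = v
    rw [map_mul, Module.End.mul_apply, h1, he, one_smul, hw, Function.update_self]
    change e x (i₀ x) • (show x.Space from v) = v
    rw [he, one_smul]

end Irr

/-! ### Generators and the universal property of the path algebra -/

namespace PathAlgebra

variable {k : Type u} {V : Type v} [Field k] [Quiver.{w} V]

theorem ofPath_comp {a b c : V} (p : Quiver.Path a b) (q : Quiver.Path b c) :
    (ofPath ⟨a, c, p.comp q⟩ : PathAlgebra k V) = ofPath ⟨a, b, p⟩ * ofPath ⟨b, c, q⟩ := by
  rw [ofPath_mul_ofPath, pathMul_comp]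

theorem idem_mul_idem_self (a : V) : (idem a * idem a : PathAlgebra k V) = idem a := by
  rw [idem, ← ofPath_comp]; rfl

theorem idem_mul_idem_of_ne {a b : V} (h : a ≠ b) :
    (idem a * idem b : PathAlgebra k V) = 0 := by
  rw [idem, idem, ofPath_mul_ofPath, pathMul_of_ne h]

theorem idem_mul_ofArrow {a b : V} (f : a ⟶ b) :
    (idem a * ofArrow f : PathAlgebra k V) = ofArrow f := by
  rw [idem, ofArrow, ← ofPath_comp, Quiver.Path.nil_comp]

theorem ofArrow_mul_idem {a b : V} (f : a ⟶ b) :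
    (ofArrow f * idem b : PathAlgebra k V) = ofArrow f := by
  rw [idem, ofArrow, ← ofPath_comp, Quiver.Path.comp_nil]

/-- A subspace which is closed under products and contains the vertex idempotents and the arrows
is everything. -/
theorem mem_of_mul_mem (Q : Submodule k (PathAlgebra k V))
    (hmul : ∀ x ∈ Q, ∀ y ∈ Q, x * y ∈ Q) (hidem : ∀ a, idem a ∈ Q)
    (harrow : ∀ (a b : V) (f : a ⟶ b), ofArrow f ∈ Q) (x : PathAlgebra k V) : x ∈ Q := by
  induction x using PathAlgebra.induction with
  | h0 => exact zero_mem _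
  | hadd x y hx hy => exact add_mem hx hy
  | hs c p =>
    refine Q.smul_mem c ?_
    obtain ⟨a, b, p⟩ := p
    induction p with
    | nil => exact hidem a
    | cons p f ih =>
      rw [← Quiver.Path.comp_toPath_eq_cons, ofPath_comp]
      exact hmul _ ih _ (harrow _ _ f)

/-- A path is sent to the product of the images of its arrows. The map need not be unital: for a
finite quiver, 1 goes to the sum of the idempotents `ε a`. This is what allows it to land in a
corner. -/
theorem exists_lift {T : Type*} [Ring T] [Algebra k T] (ε : V → T)
    (hε : ∀ a, ε a * ε a = ε a) (hε' : ∀ a b, a ≠ b → ε a * ε b = 0)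
    (θ : ∀ {a b : V}, (a ⟶ b) → T) (hl : ∀ {a b : V} (f : a ⟶ b), ε a * θ f = θ f)
    (hr : ∀ {a b : V} (f : a ⟶ b), θ f * ε b = θ f) :
    ∃ L : PathAlgebra k V →ₗ[k] T, (∀ x y, L (x * y) = L x * L y) ∧ (∀ a, L (idem a) = ε a) ∧
      ∀ (a b : V) (f : a ⟶ b), L (ofArrow f) = θ f := by
  let ev (a : V) {b : V} (p : Quiver.Path a b) : T :=
    Quiver.Path.rec (motive := fun _ _ => T) (ε a) (fun _ f r => r * θ f) p
  have ev_nil a : ev a Quiver.Path.nil = ε a := rfl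
  have ev_cons a {b c : V} (p : Quiver.Path a b) (f : b ⟶ c) :
      ev a (p.cons f) = ev a p * θ f := rfl
  have ev_l a {b : V} (p : Quiver.Path a b) : ε a * ev a p = ev a p := by
    induction p with
    | nil => exact hε a
    | cons p f ih => rw [ev_cons, ← mul_assoc, ih]
  have ev_r a {b : V} (p : Quiver.Path a b) : ev a p * ε b = ev a p := by
    induction p with
    | nil => exact hε a
    | cons p f ih => rw [ev_cons, mul_assoc, hr]
  have ev_comp a {b c : V} (p : Quiver.Path a b) (q : Quiver.Path b c) :
      ev a (p.comp q) = ev a p * ev b q := by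
    induction q with
    | nil => exact (ev_r a p).symm
    | cons q f ih => rw [Quiver.Path.comp_cons, ev_cons, ev_cons, ih, mul_assoc]
  let L : PathAlgebra k V →ₗ[k] T := Finsupp.linearCombination k fun p : QPath V => ev p.1 p.2.2
  have L_path (p : QPath V) : L (ofPath p) = ev p.1 p.2.2 :=
    (Finsupp.linearCombination_single k 1 p).trans (one_smul _ _)
  refine ⟨L, fun x y => ?_, fun a => L_path _, fun a b f => ?_⟩
  · induction x using PathAlgebra.induction with
    | h0 => simp only [zero_mul', map_zero, zero_mul]
    | hadd x x' hx hx' => simp only [add_mul', map_add, add_mul, hx, hx']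
    | hs c p =>
      simp only [smul_mul', map_smul, smul_mul_assoc]
      congr 1
      induction y using PathAlgebra.induction with
      | h0 => simp only [mul_zero', map_zero, mul_zero]
      | hadd x x' hx hx' => simp only [mul_add', map_add, mul_add, hx, hx']
      | hs c q =>
        simp only [mul_smul', map_smul, mul_smul_comm]
        congr 1
        obtain ⟨a, b, p⟩ := p
        obtain ⟨b', c, q⟩ := q
        by_cases h : b = b'
        · subst h
          rw [← ofPath_comp, L_path, L_path, L_path, ev_comp]
        · rw [ofPath_mul_ofPath, pathMul_of_ne h, map_zero, L_path, L_path]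
          change 0 = ev a p * ev b' q
          rw [← ev_r, ← ev_l b', mul_assoc, ← mul_assoc (ε b), hε' _ _ h, zero_mul, mul_zero]
  · rw [ofArrow, L_path]
    exact hl f

/-- The span of the vertex idempotents. -/
def vertexSpan (k : Type u) (V : Type v) [Field k] [Quiver.{w} V] :
    Submodule k (PathAlgebra k V) :=
  Submodule.span k (Set.range idem)

end PathAlgebra

/-! ### Subspaces of the skew group algebra defined by their coefficients -/

namespace SkewPathAlgebra

variable {k : Type u} {V : Type v} {G : Type z} [Field k] [Quiver.{w} V] [Fintype V]

/-- The elements of the skew group algebra with all coefficients in a given subspace. -/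
def coeffIn (G : Type z) (W : Submodule k (PathAlgebra k V)) :
    Submodule k (SkewMonoidAlgebra (PathAlgebra k V) G) where
  carrier := {x | ∀ g, x.coeff g ∈ W}
  zero_mem' g := by simp
  add_mem' hx hy g := by
    rw [SkewMonoidAlgebra.coeff_add]
    exact add_mem (hx g) (hy g)
  smul_mem' c x hx g := by
    rw [SkewMonoidAlgebra.coeff_smul]
    exact W.smul_mem c (hx g)

theorem single_mem_coeffIn {W : Submodule k (PathAlgebra k V)} {c : PathAlgebra k V} (hc : c ∈ W)
    (g : G) : (SkewMonoidAlgebra.single g c : SkewMonoidAlgebra (PathAlgebra k V) G) ∈ coeffIn G W := by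
  classical
  intro h
  rw [SkewMonoidAlgebra.coeff_single_apply]
  split_ifs
  · exact hc
  · exact zero_mem _

theorem eq_sum_single {G : Type*} [Fintype G] (x : SkewMonoidAlgebra (PathAlgebra k V) G) :
    x = ∑ g, SkewMonoidAlgebra.single g (x.coeff g) := by
  conv_lhs => rw [← SkewMonoidAlgebra.sum_single x, SkewMonoidAlgebra.sum_def]
  exact Finsupp.sum_fintype _ _ fun g => SkewMonoidAlgebra.single_zero g

variable [Group G] [MulSemiringAction G (PathAlgebra k V)]

theorem coeffIn_mul_mem [Finite G] {W₁ W₂ W₃ : Submodule k (PathAlgebra k V)}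
    (h : ∀ a ∈ W₁, ∀ b ∈ W₂, ∀ g : G, a * g • b ∈ W₃) {x y : SkewPathAlgebra k V G}
    (hx : x ∈ coeffIn G W₁) (hy : y ∈ coeffIn G W₂) : x * y ∈ coeffIn G W₃ := by
  have := Fintype.ofFinite G
  rw [eq_sum_single x, eq_sum_single y, Finset.sum_mul_sum]
  refine sum_mem fun g _ => sum_mem fun g' _ => ?_
  rw [SkewMonoidAlgebra.single_mul_single]
  exact single_mem_coeffIn (h _ (hx g) _ (hy g') g) _

theorem single_one_mul_single (g h : G) (c : PathAlgebra k V) :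
    (SkewMonoidAlgebra.single g 1 * SkewMonoidAlgebra.single h c : SkewPathAlgebra k V G) =
      SkewMonoidAlgebra.single (g * h) (g • c) := by
  rw [SkewMonoidAlgebra.single_mul_single, one_mul]

theorem single_mul_single_one (g h : G) (c : PathAlgebra k V) :
    (SkewMonoidAlgebra.single g c * SkewMonoidAlgebra.single h 1 : SkewPathAlgebra k V G) =
      SkewMonoidAlgebra.single (g * h) c := by
  rw [SkewMonoidAlgebra.single_mul_single, smul_one, mul_one]

end SkewPathAlgebra

/-! ### The spans of the vertices and of the arrows -/

namespace PathAlgebra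

variable {k : Type u} {V : Type v} [Field k] [Quiver.{w} V]

theorem idem_mem_vertexSpan (a : V) : (idem a : PathAlgebra k V) ∈ vertexSpan k V :=
  Submodule.subset_span ⟨a, rfl⟩

theorem ofArrow_mem_arrowSpan {a b : V} (f : a ⟶ b) :
    (ofArrow f : PathAlgebra k V) ∈ arrowSpan k V :=
  Submodule.subset_span ⟨a, b, f, rfl⟩

theorem one_mem_vertexSpan [Fintype V] : (1 : PathAlgebra k V) ∈ vertexSpan k V :=
  sum_mem fun a _ => idem_mem_vertexSpan a

variable [Fintype V]

theorem mul_mem_vertexSpan {x y : PathAlgebra k V} (hx : x ∈ vertexSpan k V)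
    (hy : y ∈ vertexSpan k V) : x * y ∈ vertexSpan k V := by
  induction hx, hy using Submodule.span_induction₂ with
  | mem_mem x y hx hy =>
    obtain ⟨a, rfl⟩ := hx
    obtain ⟨b, rfl⟩ := hy
    by_cases h : a = b
    · subst h
      rw [idem_mul_idem_self]
      exact idem_mem_vertexSpan a
    · rw [idem_mul_idem_of_ne h]
      exact zero_mem _
  | zero_left y hy => rw [zero_mul]; exact zero_mem _
  | zero_right x hx => rw [mul_zero]; exact zero_mem _
  | add_left x y z _ _ _ h₁ h₂ => rw [add_mul]; exact add_mem h₁ h₂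
  | add_right x y z _ _ _ h₁ h₂ => rw [mul_add]; exact add_mem h₁ h₂
  | smul_left r x y _ _ h => rw [smul_mul_assoc]; exact Submodule.smul_mem _ _ h
  | smul_right r x y _ _ h => rw [mul_smul_comm]; exact Submodule.smul_mem _ _ h

theorem vertexSpan_mul_mem_arrowSpan {x y : PathAlgebra k V} (hx : x ∈ vertexSpan k V)
    (hy : y ∈ arrowSpan k V) : x * y ∈ arrowSpan k V := by
  induction hx, hy using Submodule.span_induction₂ with
  | mem_mem x y hx hy =>
    obtain ⟨a, rfl⟩ := hx
    obtain ⟨b, c, f, rfl⟩ := hy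
    by_cases h : a = b
    · subst h
      rw [idem_mul_ofArrow]
      exact ofArrow_mem_arrowSpan f
    · rw [← idem_mul_ofArrow, ← mul_assoc, idem_mul_idem_of_ne h, zero_mul]
      exact zero_mem _
  | zero_left y hy => rw [zero_mul]; exact zero_mem _
  | zero_right x hx => rw [mul_zero]; exact zero_mem _
  | add_left x y z _ _ _ h₁ h₂ => rw [add_mul]; exact add_mem h₁ h₂
  | add_right x y z _ _ _ h₁ h₂ => rw [mul_add]; exact add_mem h₁ h₂
  | smul_left r x y _ _ h => rw [smul_mul_assoc]; exact Submodule.smul_mem _ _ h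
  | smul_right r x y _ _ h => rw [mul_smul_comm]; exact Submodule.smul_mem _ _ h

theorem mul_vertexSpan_mem_arrowSpan {x y : PathAlgebra k V} (hx : x ∈ arrowSpan k V)
    (hy : y ∈ vertexSpan k V) : x * y ∈ arrowSpan k V := by
  induction hx, hy using Submodule.span_induction₂ with
  | mem_mem x y hx hy =>
    obtain ⟨a, rfl⟩ := hy
    obtain ⟨b, c, f, rfl⟩ := hx
    by_cases h : c = a
    · subst h
      rw [ofArrow_mul_idem]
      exact ofArrow_mem_arrowSpan f
    · rw [← ofArrow_mul_idem, mul_assoc, idem_mul_idem_of_ne h, mul_zero]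
      exact zero_mem _
  | zero_left y hy => rw [zero_mul]; exact zero_mem _
  | zero_right x hx => rw [mul_zero]; exact zero_mem _
  | add_left x y z _ _ _ h₁ h₂ => rw [add_mul]; exact add_mem h₁ h₂
  | add_right x y z _ _ _ h₁ h₂ => rw [mul_add]; exact add_mem h₁ h₂
  | smul_left r x y _ _ h => rw [smul_mul_assoc]; exact Submodule.smul_mem _ _ h
  | smul_right r x y _ _ h => rw [mul_smul_comm]; exact Submodule.smul_mem _ _ h

variable {G : Type z} [Group G] [MulSemiringAction G (PathAlgebra k V)] [MulAction G V]
  [SMulCommClass G k (PathAlgebra k V)] [IsQuiverAction k V G]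

theorem smul_mem_vertexSpan (g : G) {x : PathAlgebra k V} (hx : x ∈ vertexSpan k V) :
    g • x ∈ vertexSpan k V := by
  induction hx using Submodule.span_induction with
  | mem x hx =>
    obtain ⟨a, rfl⟩ := hx
    rw [IsQuiverAction.smul_idem]
    exact idem_mem_vertexSpan _
  | zero => rw [smul_zero]; exact zero_mem _
  | add x y _ _ hx hy => rw [smul_add]; exact add_mem hx hy
  | smul c x _ hx => rw [smul_comm]; exact Submodule.smul_mem _ _ hx

end PathAlgebra

/-! ### Degrees zero and one generate the skew group algebra freely -/

namespace SkewPathAlgebra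

open PathAlgebra

section

variable (k : Type u) (V : Type v) (G : Type z) [Field k] [Quiver.{w} V] [Fintype V]

/-- The elements of degree zero of the skew group algebra. -/
def degZero : Submodule k (SkewMonoidAlgebra (PathAlgebra k V) G) := coeffIn G (vertexSpan k V)

/-- The elements of degree one of the skew group algebra. -/
def degOne : Submodule k (SkewMonoidAlgebra (PathAlgebra k V) G) := coeffIn G (arrowSpan k V)

end

variable {k : Type u} {V : Type v} {G : Type z} [Field k] [Quiver.{w} V] [Fintype V] [Group G]
  [Finite G] [MulSemiringAction G (PathAlgebra k V)] [MulAction G V]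
  [SMulCommClass G k (PathAlgebra k V)] [IsQuiverAction k V G]

theorem mul_mem_degZero {x y : SkewPathAlgebra k V G} (hx : x ∈ degZero k V G)
    (hy : y ∈ degZero k V G) : x * y ∈ degZero k V G :=
  coeffIn_mul_mem (fun _ ha _ hb g => mul_mem_vertexSpan ha (smul_mem_vertexSpan g hb)) hx hy

theorem degZero_mul_mem_degOne {x y : SkewPathAlgebra k V G} (hx : x ∈ degZero k V G)
    (hy : y ∈ degOne k V G) : x * y ∈ degOne k V G :=
  coeffIn_mul_mem (fun _ ha _ hb g => vertexSpan_mul_mem_arrowSpan ha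
    (IsQuiverAction.smul_mem_arrowSpan g _ hb)) hx hy

theorem mul_degZero_mem_degOne {x y : SkewPathAlgebra k V G} (hx : x ∈ degOne k V G)
    (hy : y ∈ degZero k V G) : x * y ∈ degOne k V G :=
  coeffIn_mul_mem (fun _ ha _ hb g => mul_vertexSpan_mem_arrowSpan ha
    (smul_mem_vertexSpan g hb)) hx hy

omit [Finite G] [MulSemiringAction G (PathAlgebra k V)] [MulAction G V]
  [SMulCommClass G k (PathAlgebra k V)] [IsQuiverAction k V G] [Group G] in
theorem single_one_mem_degZero (g : G) :
    (SkewMonoidAlgebra.single g 1 : SkewMonoidAlgebra (PathAlgebra k V) G) ∈ degZero k V G :=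
  single_mem_coeffIn one_mem_vertexSpan g

/-- The inclusion of the path algebra in the skew group algebra. -/
def ofPathAlgebra (k : Type u) (V : Type v) (G : Type z) [Field k] [Quiver.{w} V] [Fintype V]
    [Group G] : PathAlgebra k V →ₗ[k] SkewMonoidAlgebra (PathAlgebra k V) G where
  toFun c := SkewMonoidAlgebra.single 1 c
  map_add' := SkewMonoidAlgebra.single_add 1
  map_smul' r c := (SkewMonoidAlgebra.smul_single r 1 c).symm

omit [Finite G] [MulAction G V] [SMulCommClass G k (PathAlgebra k V)] [IsQuiverAction k V G] in
theorem ofPathAlgebra_mul (c d : PathAlgebra k V) :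
    (ofPathAlgebra k V G (c * d) : SkewPathAlgebra k V G) =
      ofPathAlgebra k V G c * ofPathAlgebra k V G d := by
  change SkewMonoidAlgebra.single _ _ = SkewMonoidAlgebra.single _ _ * SkewMonoidAlgebra.single _ _
  rw [SkewMonoidAlgebra.single_mul_single, one_smul, one_mul]

omit [Finite G] [MulAction G V] [SMulCommClass G k (PathAlgebra k V)] [IsQuiverAction k V G] in
theorem single_eq_mul (g : G) (c : PathAlgebra k V) :
    (SkewMonoidAlgebra.single g c : SkewPathAlgebra k V G) =
      ofPathAlgebra k V G c * SkewMonoidAlgebra.single g 1 := by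
  change _ = SkewMonoidAlgebra.single _ _ * SkewMonoidAlgebra.single _ _
  rw [single_mul_single_one, one_mul]

omit [MulAction G V] [SMulCommClass G k (PathAlgebra k V)] [IsQuiverAction k V G] in
/-- The skew group algebra is generated by its elements of degree zero and one. -/
theorem mem_of_mul_mem (Q : Submodule k (SkewPathAlgebra k V G))
    (hmul : ∀ x ∈ Q, ∀ y ∈ Q, x * y ∈ Q) (h0 : degZero k V G ≤ Q) (h1 : degOne k V G ≤ Q)
    (x : SkewPathAlgebra k V G) : x ∈ Q := by
  have := Fintype.ofFinite G
  rw [eq_sum_single x]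
  refine sum_mem fun g _ => ?_
  rw [single_eq_mul]
  refine hmul _ ?_ _ (h0 (single_one_mem_degZero g))
  refine PathAlgebra.mem_of_mul_mem (Q.comap (ofPathAlgebra k V G)) (fun x hx y hy => ?_)
    (fun a => h0 (single_mem_coeffIn (idem_mem_vertexSpan a) 1))
    (fun a b f => h1 (single_mem_coeffIn (ofArrow_mem_arrowSpan f) 1)) _
  rw [Submodule.mem_comap, ofPathAlgebra_mul]
  exact hmul _ hx _ hy

/-- A pair of linear maps which are compatible with products of elements of degree zero and one
extends to a multiplicative linear map on the skew group algebra. -/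
theorem exists_lift {T : Type*} [Ring T] [Algebra k T] (f₀ f₁ : SkewPathAlgebra k V G →ₗ[k] T)
    (h00 : ∀ x ∈ degZero k V G, ∀ y ∈ degZero k V G, f₀ (x * y) = f₀ x * f₀ y)
    (h01 : ∀ x ∈ degZero k V G, ∀ y ∈ degOne k V G, f₁ (x * y) = f₀ x * f₁ y)
    (h10 : ∀ x ∈ degOne k V G, ∀ y ∈ degZero k V G, f₁ (x * y) = f₁ x * f₀ y) :
    ∃ L : SkewPathAlgebra k V G →ₗ[k] T, (∀ x y, L (x * y) = L x * L y) ∧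
      (∀ x ∈ degZero k V G, L x = f₀ x) ∧ ∀ x ∈ degOne k V G, L x = f₁ x := by
  have := Fintype.ofFinite G
  let j := ofPathAlgebra k V G
  have j_mul (c d) : (j (c * d) : SkewPathAlgebra k V G) = j c * j d := ofPathAlgebra_mul c d
  let σ (g : G) : SkewPathAlgebra k V G := SkewMonoidAlgebra.single g 1
  have σ_mul g h : σ g * σ h = σ (g * h) := by
    simp only [σ, single_one_mul_single, smul_one]
  have hσ g : σ g ∈ degZero k V G := single_one_mem_degZero g
  have hj0 {c} (hc : c ∈ vertexSpan k V) : j c ∈ degZero k V G := single_mem_coeffIn hc 1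
  have hj1 {c} (hc : c ∈ arrowSpan k V) : j c ∈ degOne k V G := single_mem_coeffIn hc 1
  have σj g c : σ g * j c = j (g • c) * σ g := by
    change SkewMonoidAlgebra.single _ _ * SkewMonoidAlgebra.single _ _ =
      SkewMonoidAlgebra.single _ _ * SkewMonoidAlgebra.single _ _
    rw [single_one_mul_single, single_mul_single_one, mul_one, one_mul]
  -- First the restriction to the path algebra is built, from the images of the vertices and the
  -- arrows.
  obtain ⟨LA, LA_mul, LA_idem, LA_arrow⟩ := PathAlgebra.exists_lift (k := k) (V := V)
    (fun a => f₀ (j (idem a)))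
    (fun a => by
      rw [← h00 _ (hj0 (idem_mem_vertexSpan a)) _ (hj0 (idem_mem_vertexSpan a)), ← j_mul,
        idem_mul_idem_self])
    (fun a b hab => by
      rw [← h00 _ (hj0 (idem_mem_vertexSpan a)) _ (hj0 (idem_mem_vertexSpan b)), ← j_mul,
        idem_mul_idem_of_ne hab, map_zero, map_zero])
    (fun f => f₁ (j (ofArrow f)))
    (fun f => by
      rw [← h01 _ (hj0 (idem_mem_vertexSpan _)) _ (hj1 (ofArrow_mem_arrowSpan f)), ← j_mul,
        idem_mul_ofArrow])
    (fun f => by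
      rw [← h10 _ (hj1 (ofArrow_mem_arrowSpan f)) _ (hj0 (idem_mem_vertexSpan _)), ← j_mul,
        ofArrow_mul_idem])
  have LA0 {c} (hc : c ∈ vertexSpan k V) : LA c = f₀ (j c) := by
    induction hc using Submodule.span_induction with
    | mem x hx => obtain ⟨a, rfl⟩ := hx; exact LA_idem a
    | zero => simp
    | add x y _ _ hx hy => simp [hx, hy]
    | smul c x _ hx => simp [hx]
  have LA1 {c} (hc : c ∈ arrowSpan k V) : LA c = f₁ (j c) := by
    induction hc using Submodule.span_induction with
    | mem x hx => obtain ⟨a, b, f, rfl⟩ := hx; exact LA_arrow a b f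
    | zero => simp
    | add x y _ _ hx hy => simp [hx, hy]
    | smul c x _ hx => simp [hx]
  -- The defining relation of the skew group algebra, preserved by the images. The elements `c`
  -- satisfying it form a subspace closed under products, so vertices and arrows suffice.
  have comm g c : f₀ (σ g) * LA c = LA (g • c) * f₀ (σ g) := by
    let act : PathAlgebra k V →ₗ[k] PathAlgebra k V := DistribSMul.toLinearMap k _ g
    have hact c : act c = g • c := rfl
    let Q : Submodule k (PathAlgebra k V) := LinearMap.ker
      ((LinearMap.mulLeft k (f₀ (σ g))).comp LA - (LinearMap.mulRight k (f₀ (σ g))).comp (LA.comp act))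
    have hQ c : c ∈ Q ↔ f₀ (σ g) * LA c = LA (g • c) * f₀ (σ g) := by
      simp [Q, sub_eq_zero, hact]
    refine (hQ c).1 (PathAlgebra.mem_of_mul_mem Q (fun x hx y hy => ?_) (fun a => ?_)
      (fun a b f => ?_) c)
    · rw [hQ] at hx hy ⊢
      rw [LA_mul, _root_.smul_mul', LA_mul, ← mul_assoc, hx, mul_assoc, hy, mul_assoc]
    · have ha := idem_mem_vertexSpan (k := k) a
      rw [hQ, LA0 ha, LA0 (smul_mem_vertexSpan g ha), ← h00 _ (hσ g) _ (hj0 ha),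
        ← h00 _ (hj0 (smul_mem_vertexSpan g ha)) _ (hσ g), σj]
    · have ha := ofArrow_mem_arrowSpan (k := k) f
      have ha' := IsQuiverAction.smul_mem_arrowSpan g _ ha
      rw [hQ, LA1 ha, LA1 ha', ← h01 _ (hσ g) _ (hj1 ha), ← h10 _ (hj1 ha') _ (hσ g), σj]
  let L : SkewPathAlgebra k V G →ₗ[k] T := ∑ g, (LinearMap.mulRight k (f₀ (σ g))).comp
    (LA.comp ((Finsupp.lapply g).comp SkewMonoidAlgebra.coeffLinearEquiv.toLinearMap))
  have L_apply x : L x = ∑ g, LA (x.coeff g) * f₀ (σ g) := by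
    simp [L, LinearMap.sum_apply]
    rfl
  have L_single g c : L (SkewMonoidAlgebra.single g c) = LA c * f₀ (σ g) := by
    classical
    rw [L_apply, Finset.sum_eq_single g]
    · rw [SkewMonoidAlgebra.coeff_single_apply, if_pos rfl]
    · intro h _ hh
      rw [SkewMonoidAlgebra.coeff_single_apply, if_neg hh.symm, map_zero, zero_mul]
    · simp
  refine ⟨L, fun x y => ?_, fun x hx => ?_, fun x hx => ?_⟩
  · rw [eq_sum_single x, eq_sum_single y, Finset.sum_mul_sum, map_sum, map_sum, map_sum,
      Finset.sum_mul_sum]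
    refine Finset.sum_congr rfl fun g _ => ?_
    rw [map_sum]
    refine Finset.sum_congr rfl fun h _ => ?_
    rw [SkewMonoidAlgebra.single_mul_single, L_single, L_single, L_single, LA_mul, ← σ_mul,
      h00 _ (hσ g) _ (hσ h), mul_assoc, mul_assoc, ← mul_assoc (LA (g • _)), ← comm, mul_assoc]
  · rw [eq_sum_single x, map_sum, map_sum]
    refine Finset.sum_congr rfl fun g _ => ?_
    rw [L_single, LA0 (hx g), ← h00 _ (hj0 (hx g)) _ (hσ g), ← single_eq_mul]
  · rw [eq_sum_single x, map_sum, map_sum]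
    refine Finset.sum_congr rfl fun g _ => ?_
    rw [L_single, LA1 (hx g), ← h10 _ (hj1 (hx g)) _ (hσ g), ← single_eq_mul]

end SkewPathAlgebra

/-! ### Matrix systems, and corners that are path algebras -/

theorem LinearIndependent.exists_linearMap {k : Type*} {ι M N : Type*} [Field k] [AddCommGroup M]
    [Module k M] [AddCommGroup N] [Module k N] {v : ι → M} (hv : LinearIndependent k v)
    (f : ι → N) : ∃ g : M →ₗ[k] N, ∀ i, g (v i) = f i := by
  obtain ⟨g, hg⟩ := LinearMap.exists_extend
    ((Finsupp.linearCombination k f).comp hv.repr)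
  refine ⟨g, fun i => ?_⟩
  have h := LinearMap.congr_fun hg ⟨v i, Submodule.subset_span ⟨i, rfl⟩⟩
  rw [LinearMap.comp_apply, LinearMap.comp_apply, Submodule.subtype_apply] at h
  rw [h, hv.repr_eq_single i _ rfl, Finsupp.linearCombination_single, one_smul]

/-- Orthogonal idempotents `E x` of a ring together with a system of elements `s i`, `t i` which
identifies the ring with a ring of generalized matrices over the Peirce components
`E x * R * E y`. -/
structure MatrixSystem (R X I : Type*) [Ring R] [Fintype I] where
  /-- The idempotents. -/
  E : X → R
  /-- The idempotent to which an index belongs. -/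
  c : I → X
  /-- The columns. -/
  s : I → R
  /-- The rows. -/
  t : I → R
  E_mul_self : ∀ x, E x * E x = E x
  E_mul_of_ne : ∀ x y, x ≠ y → E x * E y = 0
  s_mul : ∀ i, s i * E (c i) = s i
  mul_t : ∀ i, E (c i) * t i = t i
  t_mul_s : ∀ i, t i * s i = E (c i)
  t_mul_s_of_ne : ∀ i j, i ≠ j → t i * s j = 0
  sum : ∑ i, s i * t i = 1

namespace MatrixSystem

variable {R X I : Type*} [Ring R] [Fintype I] [Fintype X] (M : MatrixSystem R X I)

/-- The sum of the idempotents. -/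
def e : R := ∑ x, M.E x

theorem e_mul_E (x : X) : M.e * M.E x = M.E x := by
  rw [e, Finset.sum_mul, Finset.sum_eq_single x (fun y _ h => M.E_mul_of_ne y x h) (by simp),
    M.E_mul_self]

theorem E_mul_e (x : X) : M.E x * M.e = M.E x := by
  rw [e, Finset.mul_sum, Finset.sum_eq_single x (fun y _ h => M.E_mul_of_ne x y h.symm) (by simp),
    M.E_mul_self]

theorem isIdempotentElem_e : IsIdempotentElem M.e := by
  rw [IsIdempotentElem]
  nth_rw 2 [e]
  rw [Finset.mul_sum]
  exact Finset.sum_congr rfl fun x _ => M.e_mul_E x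

theorem s_mul_e (i : I) : M.s i * M.e = M.s i := by
  rw [← M.s_mul, mul_assoc, E_mul_e]

theorem e_mul_t (i : I) : M.e * M.t i = M.t i := by
  rw [← M.mul_t, ← mul_assoc, e_mul_E]

section Iso

variable {k : Type*} [Field k] [Algebra k R] [Quiver X]

/-- `S` and `B` play the roles of degrees zero and one. Since `hlift` only yields maps out of the
whole ring, not out of a corner, the inverse of the map `F` from the path algebra is obtained by
mapping all of `R` to matrices: the entries of `w` are the coordinates of `t i * w * s j`, which lie
in the spans of `E` and `b` for `w` in `S` and `B`. This matrix map is then compressed to the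
corner. -/
theorem exists_corner_equiv (S B : Submodule k R)
    (hSS : ∀ x ∈ S, ∀ y ∈ S, x * y ∈ S) (hSB : ∀ x ∈ S, ∀ y ∈ B, x * y ∈ B)
    (hBS : ∀ x ∈ B, ∀ y ∈ S, x * y ∈ B)
    (hgen : ∀ Q : Submodule k R, (∀ x ∈ Q, ∀ y ∈ Q, x * y ∈ Q) → S ≤ Q → B ≤ Q → ∀ x, x ∈ Q)
    (hlift : ∀ f₀ f₁ : R →ₗ[k] Matrix I I (PathAlgebra k X),
      (∀ x ∈ S, ∀ y ∈ S, f₀ (x * y) = f₀ x * f₀ y) →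
      (∀ x ∈ S, ∀ y ∈ B, f₁ (x * y) = f₀ x * f₁ y) →
      (∀ x ∈ B, ∀ y ∈ S, f₁ (x * y) = f₁ x * f₀ y) →
      ∃ L : R →ₗ[k] Matrix I I (PathAlgebra k X), (∀ x y, L (x * y) = L x * L y) ∧
        (∀ x ∈ S, L x = f₀ x) ∧ ∀ x ∈ B, L x = f₁ x)
    (hES' : ∀ x, M.E x ∈ S) (hs : ∀ i, M.s i ∈ S) (ht : ∀ i, M.t i ∈ S)
    (hES : ∀ w ∈ S, ∀ x y, M.E x * w * M.E y ∈ Submodule.span k (Set.range M.E))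
    (hE : LinearIndependent k M.E)
    (b : (Σ x y : X, x ⟶ y) → R) (hb : LinearIndependent k b) (hbB : ∀ f, b f ∈ B)
    (hbl : ∀ f, M.E f.1 * b f = b f) (hbr : ∀ f, b f * M.E f.2.1 = b f)
    (hEB : ∀ w ∈ B, ∀ x y, M.E x * w * M.E y ∈ Submodule.span k (Set.range b))
    {e : R} (hMe : e = M.e) (he : IsIdempotentElem e) :
    ∃ Φ : PathAlgebra k X ≃+* he.Corner, (∀ (c : k) p, Φ (c • p) = c • Φ p) ∧
      ∀ x, (Φ (PathAlgebra.idem x)).1 = M.E x := by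
  subst hMe
  let P := PathAlgebra k X
  -- The coordinate maps are extended arbitrarily to `R`; only their values on the spans of `E` and
  -- `b` are used.
  obtain ⟨l₀, hl₀⟩ := hE.exists_linearMap fun x => (PathAlgebra.idem x : PathAlgebra k X)
  obtain ⟨l₁, hl₁⟩ := hb.exists_linearMap fun f => (PathAlgebra.ofArrow f.2.2 : PathAlgebra k X)
  obtain ⟨F, F_mul, F_idem, F_arrow⟩ := PathAlgebra.exists_lift (k := k) (V := X) M.E
    M.E_mul_self M.E_mul_of_ne (fun {x y} f => b ⟨x, y, f⟩) (fun f => hbl ⟨_, _, f⟩)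
    (fun f => hbr ⟨_, _, f⟩)
  set K := Submodule.span k (Set.range M.E) with hK
  set L := Submodule.span k (Set.range b) with hL
  -- compatibility of the coordinate maps with products
  have l00 {x y} (hx : x ∈ K) (hy : y ∈ K) : l₀ (x * y) = l₀ x * l₀ y := by
    induction hx, hy using Submodule.span_induction₂ with
    | mem_mem x y hx hy =>
      obtain ⟨a, rfl⟩ := hx
      obtain ⟨b, rfl⟩ := hy
      by_cases h : a = b
      · subst h
        rw [M.E_mul_self, hl₀, PathAlgebra.idem_mul_idem_self]
      · rw [M.E_mul_of_ne _ _ h, hl₀, hl₀, PathAlgebra.idem_mul_idem_of_ne h, map_zero]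
    | zero_left y hy => simp
    | zero_right x hx => simp
    | add_left x y z _ _ _ h₁ h₂ => simp only [add_mul, map_add, h₁, h₂]
    | add_right x y z _ _ _ h₁ h₂ => simp only [mul_add, map_add, h₁, h₂]
    | smul_left r x y _ _ h => simp only [smul_mul_assoc, map_smul, h]
    | smul_right r x y _ _ h => simp only [mul_smul_comm, map_smul, h]
  have l01 {x y} (hx : x ∈ K) (hy : y ∈ L) : l₁ (x * y) = l₀ x * l₁ y := by
    induction hx, hy using Submodule.span_induction₂ with
    | mem_mem x y hx hy =>
      obtain ⟨a, rfl⟩ := hx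
      obtain ⟨f, rfl⟩ := hy
      rw [hl₀, hl₁]
      by_cases h : a = f.1
      · subst h
        rw [hbl, hl₁, PathAlgebra.idem_mul_ofArrow]
      · rw [← hbl, ← mul_assoc, M.E_mul_of_ne _ _ h, ← PathAlgebra.idem_mul_ofArrow,
          ← mul_assoc, PathAlgebra.idem_mul_idem_of_ne h, zero_mul, zero_mul, map_zero]
    | zero_left y hy => simp
    | zero_right x hx => simp
    | add_left x y z _ _ _ h₁ h₂ => simp only [add_mul, map_add, h₁, h₂]
    | add_right x y z _ _ _ h₁ h₂ => simp only [mul_add, map_add, h₁, h₂]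
    | smul_left r x y _ _ h => simp only [smul_mul_assoc, map_smul, h]
    | smul_right r x y _ _ h => simp only [mul_smul_comm, map_smul, h]
  have l10 {x y} (hx : x ∈ L) (hy : y ∈ K) : l₁ (x * y) = l₁ x * l₀ y := by
    induction hx, hy using Submodule.span_induction₂ with
    | mem_mem x y hx hy =>
      obtain ⟨a, rfl⟩ := hy
      obtain ⟨f, rfl⟩ := hx
      rw [hl₀, hl₁]
      by_cases h : f.2.1 = a
      · subst h
        rw [hbr, hl₁, PathAlgebra.ofArrow_mul_idem]
      · rw [← hbr, mul_assoc, M.E_mul_of_ne _ _ h, ← PathAlgebra.ofArrow_mul_idem,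
          mul_assoc, PathAlgebra.idem_mul_idem_of_ne h, mul_zero, mul_zero, map_zero]
    | zero_left y hy => simp
    | zero_right x hx => simp
    | add_left x y z _ _ _ h₁ h₂ => simp only [add_mul, map_add, h₁, h₂]
    | add_right x y z _ _ _ h₁ h₂ => simp only [mul_add, map_add, h₁, h₂]
    | smul_left r x y _ _ h => simp only [smul_mul_assoc, map_smul, h]
    | smul_right r x y _ _ h => simp only [mul_smul_comm, map_smul, h]
  -- matrix entries of elements of degree zero and one
  have hts (w i j) : M.t i * w * M.s j = M.E (M.c i) * (M.t i * w * M.s j) * M.E (M.c j) := by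
    rw [mul_assoc (M.E _), mul_assoc _ (M.s j), M.s_mul, ← mul_assoc, ← mul_assoc, M.mul_t]
  have memK {w} (hw : w ∈ S) (i j) : M.t i * w * M.s j ∈ K := by
    rw [hts]
    exact hES _ (hSS _ (hSS _ (ht i) _ hw) _ (hs j)) _ _
  have memL {w} (hw : w ∈ B) (i j) : M.t i * w * M.s j ∈ L := by
    rw [hts]
    exact hEB _ (hBS _ (hSB _ (ht i) _ hw) _ (hs j)) _ _
  have heS : M.e ∈ S := sum_mem fun x _ => hES' x
  have ese {w} (hw : w ∈ S) : M.e * w * M.e ∈ K := by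
    rw [e, Finset.sum_mul, Finset.sum_mul]
    exact sum_mem fun x _ => by rw [Finset.mul_sum]; exact sum_mem fun y _ => hES _ hw _ _
  have es (i) : M.e * M.s i ∈ K := by
    rw [← M.s_mul_e, ← mul_assoc]
    exact ese (hs i)
  have te (i) : M.t i * M.e ∈ K := by
    rw [← M.e_mul_t]
    exact ese (ht i)
  have insert (w w' : R) : w * w' = ∑ j, w * M.s j * (M.t j * w') := by
    simp only [mul_assoc, ← Finset.mul_sum]
    simp only [← mul_assoc, ← Finset.sum_mul, M.sum, one_mul]
  let entry (l : R →ₗ[k] P) : R →ₗ[k] Matrix I I P :=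
    LinearMap.pi fun i => LinearMap.pi fun j =>
      l.comp ((LinearMap.mulRight k (M.s j)).comp (LinearMap.mulLeft k (M.t i)))
  have entry_apply (l w i j) : entry l w i j = l (M.t i * w * M.s j) := rfl
  have split (w w' i j) : M.t i * (w * w') * M.s j
      = ∑ m, (M.t i * w * M.s m) * (M.t m * w' * M.s j) := by
    rw [← mul_assoc, mul_assoc (M.t i * w), insert (M.t i * w)]
    simp only [mul_assoc]
  obtain ⟨Ψ, Ψ_mul, Ψ_S, Ψ_B⟩ := hlift (entry l₀) (entry l₁)
    (fun x hx y hy => by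
      ext i j : 2
      rw [entry_apply, split, map_sum, Matrix.mul_apply]
      exact Finset.sum_congr rfl fun m _ => l00 (memK hx i m) (memK hy m j))
    (fun x hx y hy => by
      ext i j : 2
      rw [entry_apply, split, map_sum, Matrix.mul_apply]
      exact Finset.sum_congr rfl fun m _ => l01 (memK hx i m) (memL hy m j))
    (fun x hx y hy => by
      ext i j : 2
      rw [entry_apply, split, map_sum, Matrix.mul_apply]
      exact Finset.sum_congr rfl fun m _ => l10 (memL hx i m) (memK hy m j))
  -- a left inverse of `F`
  let row : Matrix Unit I P := fun _ i => l₀ (M.e * M.s i)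
  let col : Matrix I Unit P := fun i _ => l₀ (M.t i * M.e)
  have col_row : col * row = Ψ M.e := by
    ext i j : 2
    rw [Ψ_S _ heS, entry_apply, Matrix.mul_apply]
    simp only [Finset.univ_unique, Finset.sum_singleton]
    rw [← l00 (te i) (es j)]
    congr 1
    rw [mul_assoc, ← mul_assoc M.e, M.isIdempotentElem_e.eq, mul_assoc]
  -- Because `col * row` is the matrix of `M.e`, this compression satisfies `Ξ w * Ξ w' = Ξ (w * M.e
  -- * w')`, hence is multiplicative on the corner.
  let Ξ (w : R) : P := (row * Ψ w * col) () ()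
  have Ξ_S {w} (hw : w ∈ S) : Ξ w = l₀ (M.e * w * M.e) := by
    have h1 : M.e * w * M.e = ∑ j, ∑ i, (M.e * M.s i) * (M.t i * w * M.s j) * (M.t j * M.e) := by
      rw [insert (M.e * w) M.e]
      refine Finset.sum_congr rfl fun j _ => ?_
      rw [mul_assoc M.e, insert M.e, ← Finset.sum_mul]
      simp only [mul_assoc]
    rw [h1, map_sum]
    change ∑ j, (row * Ψ w) () j * col j () = _
    refine Finset.sum_congr rfl fun j _ => ?_
    rw [map_sum, Matrix.mul_apply, Finset.sum_mul]
    refine Finset.sum_congr rfl fun i _ => ?_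
    rw [Ψ_S _ hw, entry_apply, l00 _ (te j), l00 (es i) (memK hw i j)]
    have : (M.e * M.s i) * (M.t i * w * M.s j)
        = M.e * ((M.s i * (M.t i * w)) * M.s j) * M.e := by
      conv_lhs => rw [← M.s_mul_e j]
      simp only [mul_assoc]
    rw [this]
    exact ese (hSS _ (hSS _ (hs i) _ (hSS _ (ht i) _ hw)) _ (hs j))
  have Ξ_B {w} (hw : w ∈ B) : Ξ w = l₁ (M.e * w * M.e) := by
    have h1 : M.e * w * M.e = ∑ j, ∑ i, (M.e * M.s i) * (M.t i * w * M.s j * (M.t j * M.e)) := by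
      rw [insert (M.e * w) M.e]
      refine Finset.sum_congr rfl fun j _ => ?_
      rw [mul_assoc M.e, insert M.e, Finset.sum_mul]
      simp only [mul_assoc]
    rw [h1, map_sum]
    change ∑ j, (row * Ψ w) () j * col j () = _
    refine Finset.sum_congr rfl fun j _ => ?_
    rw [map_sum, Matrix.mul_apply, Finset.sum_mul]
    refine Finset.sum_congr rfl fun i _ => ?_
    rw [Ψ_B _ hw, entry_apply, l01 (es i), l10 (memL hw i j) (te j), mul_assoc]
    have : M.t i * w * M.s j * (M.t j * M.e)
        = M.E (M.c i) * (M.t i * w * (M.s j * M.t j)) * M.e := by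
      rw [← mul_assoc (M.E _), ← mul_assoc (M.E _), M.mul_t]
      simp only [mul_assoc]
    rw [this, e, Finset.mul_sum]
    exact sum_mem fun x _ => hEB _ (hBS _ (hSB _ (ht i) _ hw) _ (hSS _ (hs j) _ (ht j))) _ _
  have Ξ_mul (w w') : Ξ w * Ξ w' = Ξ (w * M.e * w') := by
    have h1 : Ξ w * Ξ w' = ((row * Ψ w * col) * (row * Ψ w' * col)) () () := by
      rw [Matrix.mul_apply]
      simp [Ξ]
    rw [h1]
    change _ = (row * Ψ (w * M.e * w') * col) () ()
    rw [Ψ_mul, Ψ_mul, ← col_row]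
    simp only [Matrix.mul_assoc]
  have F_e (p) : M.e * F p = F p ∧ F p * M.e = F p := by
    have h1 : F 1 = M.e := by
      rw [PathAlgebra.one_eq, map_sum, e]
      exact Finset.sum_congr rfl fun x _ => F_idem x
    rw [← h1, ← F_mul, ← F_mul, one_mul, mul_one]
    exact ⟨rfl, rfl⟩
  have Ξ_F (p) : Ξ (F p) = p := by
    have add (p q) : Ξ (F (p + q)) = Ξ (F p) + Ξ (F q) := by
      change (row * Ψ (F (p + q)) * col) () () = _
      rw [map_add, map_add, Matrix.mul_add, Matrix.add_mul]
      rfl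
    have smul (c : k) (p) : Ξ (F (c • p)) = c • Ξ (F p) := by
      change (row * Ψ (F (c • p)) * col) () () = _
      rw [map_smul, map_smul, Matrix.mul_smul, Matrix.smul_mul]
      rfl
    let Ξl : P →ₗ[k] P := { toFun := fun p => Ξ (F p), map_add' := add, map_smul' := smul }
    have hΞl p : Ξl p = Ξ (F p) := rfl
    have mem p : p ∈ LinearMap.ker (Ξl - LinearMap.id) ↔ Ξ (F p) = p := by
      rw [LinearMap.mem_ker, LinearMap.sub_apply, sub_eq_zero, hΞl, LinearMap.id_apply]
    -- The elements fixed by `Ξ ∘ F` are closed under products, so vertices and arrows suffice.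
    refine (mem p).1 (PathAlgebra.mem_of_mul_mem _ (fun x hx y hy => ?_) (fun x => ?_)
      (fun x y f => ?_) p)
    · rw [mem] at hx hy ⊢
      rw [F_mul]
      nth_rw 1 [← (F_e x).2]
      rw [← Ξ_mul, hx, hy]
    · rw [mem, F_idem, Ξ_S (hES' x), M.e_mul_E, M.E_mul_e, hl₀]
    · rw [mem, F_arrow, Ξ_B (hbB _), ← F_arrow, (F_e _).1, (F_e _).2, F_arrow, hl₁]
  -- surjectivity
  have K_le : K ≤ LinearMap.range F := by
    rw [hK, Submodule.span_le]
    rintro _ ⟨x, rfl⟩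
    exact ⟨_, F_idem x⟩
  have L_le : L ≤ LinearMap.range F := by
    rw [hL, Submodule.span_le]
    rintro _ ⟨f, rfl⟩
    exact ⟨_, F_arrow _ _ f.2.2⟩
  have range_mul {w w'} (hw : w ∈ LinearMap.range F) (hw' : w' ∈ LinearMap.range F) :
      w * w' ∈ LinearMap.range F := by
    obtain ⟨p, rfl⟩ := hw
    obtain ⟨q, rfl⟩ := hw'
    exact ⟨p * q, F_mul p q⟩
  have surj (w i j) : M.t i * w * M.s j ∈ LinearMap.range F := by
    -- The elements all of whose entries lie in the image of `F` are closed under products by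
    -- `split`, and include `S` and `B`.
    let Q : Submodule k R :=
      { carrier := {w | ∀ i j, M.t i * w * M.s j ∈ LinearMap.range F}
        zero_mem' := fun i j => by simp
        add_mem' := fun hx hy i j => by
          rw [mul_add, add_mul]
          exact add_mem (hx i j) (hy i j)
        smul_mem' := fun c x hx i j => by
          rw [mul_smul_comm, smul_mul_assoc]
          exact Submodule.smul_mem _ c (hx i j) }
    exact hgen Q (fun x hx y hy i j => by
        rw [split]
        exact sum_mem fun m _ => range_mul (hx i m) (hy m j))
      (fun x hx i j => K_le (memK hx i j)) (fun x hx i j => L_le (memL hx i j)) w i j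
  have surj' (w) : M.e * w * M.e ∈ LinearMap.range F := by
    rw [insert (M.e * w) M.e]
    refine sum_mem fun j _ => ?_
    rw [mul_assoc M.e, insert M.e, Finset.sum_mul]
    refine sum_mem fun i _ => ?_
    rw [← mul_assoc (M.t i)]
    exact range_mul (range_mul (K_le (es i)) (surj w i j)) (K_le (te j))
  let Φ : P →+* he.Corner :=
    { toFun := fun p => ⟨F p, F p, (congrArg (· * M.e) (F_e p).1).trans (F_e p).2⟩
      map_one' := Subtype.ext <| by
        change F 1 = M.e
        rw [PathAlgebra.one_eq, map_sum, e]
        exact Finset.sum_congr rfl fun x _ => F_idem x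
      map_mul' := fun p q => Subtype.ext (F_mul p q)
      map_zero' := Subtype.ext (map_zero F)
      map_add' := fun p q => Subtype.ext (map_add F p q) }
  refine ⟨RingEquiv.ofBijective Φ ⟨fun p q h => ?_, fun ⟨w, hw⟩ => ?_⟩, fun c p => ?_, F_idem⟩
  · have h1 : F p = F q := congrArg Subtype.val h
    rw [← Ξ_F p, h1, Ξ_F]
  · obtain ⟨r, rfl⟩ := hw
    obtain ⟨p, hp⟩ := surj' r
    exact ⟨p, Subtype.ext hp⟩
  · exact Subtype.ext (map_smul F c p)

end Iso

end MatrixSystem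

/-! ### Submodule lattices and dimension vectors under passage to a corner -/

theorem isIndecomposableModule_iff_of_orderIso {R T M N : Type*} [Ring R] [Ring T]
    [AddCommGroup M] [Module R M] [AddCommGroup N] [Module T N]
    (φ : Submodule R M ≃o Submodule T N) :
    IsIndecomposableModule R M ↔ IsIndecomposableModule T N := by
  unfold IsIndecomposableModule
  -- A module is nonzero exactly when its submodule lattice is nontrivial, so indecomposability is a
  -- property of that lattice alone.
  rw [← Submodule.nontrivial_iff R (M := M), ← Submodule.nontrivial_iff T (M := N),
    φ.toEquiv.nontrivial_congr]
  refine and_congr_right fun _ => ⟨fun h K L hKL => ?_, fun h K L hKL => ?_⟩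
  · have := h _ _ (φ.symm.isCompl hKL)
    simpa using this
  · have := h _ _ (φ.isCompl hKL)
    simpa using this

theorem mem_range_lsmul_iff {k R M : Type*} [Field k] [Ring R] [Algebra k R] [AddCommGroup M]
    [Module k M] [Module R M] [IsScalarTower k R M] {e : R} (he : e * e = e) (m : M) :
    m ∈ LinearMap.range (Algebra.lsmul k k M e) ↔ e • m = m := by
  constructor
  · rintro ⟨n, rfl⟩
    rw [Algebra.lsmul_coe, ← mul_smul, he]
  · exact fun h => ⟨m, h⟩

namespace MatrixSystem

section Corner

variable {R X I : Type*} [Ring R] [Fintype I] [Fintype X] (S : MatrixSystem R X I)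
  {T M N : Type*} [Ring T] [AddCommGroup M] [Module R M] [AddCommGroup N] [Module T N]

/-- The correspondence between submodules of `M` and of its part `e M`. -/
def submoduleOrderIso (j : N →+ M) (hj : Function.Injective j)
    (hje : ∀ m, S.e • m = m ↔ ∃ n, j n = m) (hT : ∀ τ : T, ∃ r : R, ∀ n, j (τ • n) = r • j n)
    (hR : ∀ r : R, ∃ τ : T, ∀ n, j (τ • n) = S.e • r • j n) :
    Submodule R M ≃o Submodule T N :=
  Equiv.toOrderIso
    { toFun := fun K =>
        { carrier := {n | j n ∈ K}
          zero_mem' := by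
            change j 0 ∈ K
            rw [map_zero]; exact zero_mem _
          add_mem' := fun {a b} ha hb => by
            change j (a + b) ∈ K
            rw [map_add]; exact add_mem ha hb
          smul_mem' := fun τ n hn => by
            obtain ⟨r, hr⟩ := hT τ
            change j (τ • n) ∈ K
            rw [hr]; exact K.smul_mem r hn }
      -- The submodule attached to `L` consists of the `m` with $eRm \subseteq L$. That it recovers
      -- `K` follows from $m = \sum s_i e t_i m$.
      invFun := fun L =>
        { carrier := {m | ∀ r : R, ∃ n ∈ L, j n = S.e • r • m}
          zero_mem' := fun r => ⟨0, zero_mem _, by rw [map_zero, smul_zero, smul_zero]⟩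
          add_mem' := fun {a b} ha hb r => by
            obtain ⟨n, hn, h⟩ := ha r
            obtain ⟨n', hn', h'⟩ := hb r
            exact ⟨n + n', add_mem hn hn', by rw [map_add, h, h', smul_add, smul_add]⟩
          smul_mem' := fun r' m hm r => by
            obtain ⟨n, hn, h⟩ := hm (r * r')
            exact ⟨n, hn, by rw [h, mul_smul]⟩ }
      left_inv := fun K => by
        ext m
        constructor
        · intro h
          rw [← one_smul R m, ← S.sum, Finset.sum_smul]
          refine sum_mem fun i _ => ?_
          obtain ⟨n, hn, h'⟩ := h (S.t i)
          rw [mul_smul, ← S.e_mul_t, mul_smul, ← h']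
          exact K.smul_mem _ hn
        · intro h r
          obtain ⟨n, hn⟩ := (hje (S.e • r • m)).1 (by
            rw [← mul_smul, S.isIdempotentElem_e.eq])
          refine ⟨n, ?_, hn⟩
          change j n ∈ K
          rw [hn]
          exact K.smul_mem _ (K.smul_mem _ h)
      right_inv := fun L => by
        ext n
        constructor
        · intro h
          obtain ⟨n', hn', h'⟩ := h 1
          rw [one_smul, (hje (j n)).2 ⟨n, rfl⟩] at h'
          exact hj h' ▸ hn'
        · intro h r
          obtain ⟨τ, hτ⟩ := hR r
          exact ⟨τ • n, L.smul_mem τ h, hτ n⟩ }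
    (fun _ _ h _ hn => h hn)
    (fun _ _ h _ hm r => by
      obtain ⟨n, hn, h'⟩ := hm r
      exact ⟨n, h hn, h'⟩)

end Corner

section Dim

variable {k R X I : Type*} [Field k] [Ring R] [Algebra k R] [Fintype I]
  (S : MatrixSystem R X I) {M : Type*} [AddCommGroup M] [Module k M] [Module R M]
  [IsScalarTower k R M]

/-- Since $m = \sum s_i t_i m$, the module is a quotient of a finite sum of the spaces $E_x M$. -/
theorem finiteDimensional_of_range
    (hM : ∀ x, FiniteDimensional k (LinearMap.range (Algebra.lsmul k k M (S.E x)))) :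
    FiniteDimensional k M := by
  let f : (∀ i, LinearMap.range (Algebra.lsmul k k M (S.E (S.c i)))) →ₗ[k] M :=
    ∑ i, (Algebra.lsmul k k M (S.s i)).comp ((Submodule.subtype _).comp (LinearMap.proj i))
  have hf n : f n = ∑ i, S.s i • (n i : M) := by simp [f, LinearMap.sum_apply]
  refine Module.Finite.of_surjective f fun m =>
    ⟨fun i => ⟨S.t i • m, (mem_range_lsmul_iff (S.E_mul_self _) _).2 ?_⟩, ?_⟩
  · rw [← mul_smul, S.mul_t]
  · rw [hf]
    simp only [← mul_smul, ← Finset.sum_smul, S.sum, one_smul]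

/-- The map $(n_i) \mapsto \sum s_i n_i$ identifies the sum of the $E_{c(i)} M$, over the indices
with $a(i) = v$, with $\varepsilon_v M$. Multiplication by $t_i$ recovers $n_i$, and $\varepsilon_v
s_i = 0$ at the other indices. -/
theorem dimVector_eq_sum {V : Type*} [DecidableEq V] (ε : V → R) (a : I → V)
    (hε : ∀ v, ε v * ε v = ε v)
    (hs : ∀ i, ε (a i) * S.s i = S.s i) (hs' : ∀ i v, v ≠ a i → ε v * S.s i = 0)
    [FiniteDimensional k M] (v : V) :
    dimVector k ε M v = ∑ i with a i = v, dimVector k S.E M (S.c i) := by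
  have hsv {i} (h : a i = v) : ε v * S.s i = S.s i := by subst h; exact hs i
  let J := {i : I // a i = v}
  let f : (∀ i : J, LinearMap.range (Algebra.lsmul k k M (S.E (S.c i)))) →ₗ[k] M :=
    ∑ i : J, (Algebra.lsmul k k M (S.s i)).comp ((Submodule.subtype _).comp (LinearMap.proj i))
  have hf n : f n = ∑ i : J, S.s i • (n i : M) := by simp [f, LinearMap.sum_apply]
  have hfix {i} (n : LinearMap.range (Algebra.lsmul k k M (S.E (S.c i)))) :
      S.E (S.c i) • (n : M) = n := (mem_range_lsmul_iff (S.E_mul_self _) _).1 n.2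
  have hinj : Function.Injective f := by
    rw [injective_iff_map_eq_zero]
    intro n hn
    funext i
    have h : S.t i • f n = 0 := by rw [hn, smul_zero]
    rw [hf, Finset.smul_sum, Finset.sum_eq_single i] at h
    · rw [← mul_smul, S.t_mul_s, hfix] at h
      exact Subtype.ext h
    · intro j _ hj
      rw [← mul_smul, S.t_mul_s_of_ne _ _ fun h => hj (Subtype.ext h.symm), zero_smul]
    · simp
  have hrange : LinearMap.range f = LinearMap.range (Algebra.lsmul k k M (ε v)) := by
    ext m
    rw [mem_range_lsmul_iff (hε v)]
    constructor
    · rintro ⟨n, rfl⟩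
      rw [hf, Finset.smul_sum]
      refine Finset.sum_congr rfl fun i _ => ?_
      rw [← mul_smul, hsv i.2]
    · intro hm
      refine ⟨fun i => ⟨S.t i • m, (mem_range_lsmul_iff (S.E_mul_self _) _).2 ?_⟩, ?_⟩
      · rw [← mul_smul, S.mul_t]
      · rw [hf]
        simp only [← mul_smul]
        have h1 : ε v = ∑ i, ε v * (S.s i * S.t i) := by rw [← Finset.mul_sum, S.sum, mul_one]
        conv_rhs => rw [← hm, h1, Finset.sum_smul]
        rw [← Finset.sum_subset (Finset.subset_univ (Finset.univ.filter fun i => a i = v))]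
        · rw [Finset.sum_subtype (p := fun i => a i = v) (Finset.univ.filter fun i => a i = v)
            (by simp)]
          exact Finset.sum_congr rfl fun i _ => by rw [← mul_assoc, hsv i.2]
        · intro i _ hi
          rw [← mul_assoc, hs' i v fun h => hi (by simp [h]), zero_mul, zero_smul]
  have h1 := LinearMap.finrank_range_of_inj hinj
  rw [hrange, Module.finrank_pi_fintype] at h1
  rw [dimVector, h1]
  exact (Finset.sum_subtype (p := fun i => a i = v) (Finset.univ.filter fun i => a i = v)
    (by simp) fun i => dimVector k S.E M (S.c i)).symm

end Dim

end MatrixSystem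

/-- The embedding need not be onto, only reach all of $\varepsilon_x M$. This covers $N \subseteq
\operatorname{Hom}_{eRe}(eR, N)$ and $eM \subseteq M$ as well as isomorphisms. -/
theorem dimVector_eq_of_injective {k R T X M N : Type*} [Field k] [Ring R] [Algebra k R] [Ring T]
    [Algebra k T] [AddCommGroup M] [Module k M] [Module R M] [IsScalarTower k R M]
    [AddCommGroup N] [Module k N] [Module T N] [IsScalarTower k T N] (j : N →ₗ[k] M)
    (hj : Function.Injective j) (ε : X → R) (ε' : X → T) (hε : ∀ x, ε x * ε x = ε x)
    (h : ∀ x n, j (ε' x • n) = ε x • j n) (x : X) (hx : ∀ m, ε x • m = m → ∃ n, j n = m) :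
    dimVector k ε' N x = dimVector k ε M x := by
  have h1 : (LinearMap.range (Algebra.lsmul k k N (ε' x))).map j =
      LinearMap.range (Algebra.lsmul k k M (ε x)) := by
    ext m
    constructor
    · rintro ⟨_, ⟨n, rfl⟩, rfl⟩
      exact ⟨j n, (h x n).symm⟩
    · intro hm
      rw [mem_range_lsmul_iff (hε x)] at hm
      obtain ⟨n, rfl⟩ := hx m hm
      exact ⟨ε' x • n, ⟨n, rfl⟩, by rw [h, hm]⟩
  rw [dimVector, dimVector, ← h1]
  exact (Submodule.equivMapOfInjective j hj _).finrank_eq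

/-! ### The embedding of a corner module in its coinduced module -/

namespace CornerHom

variable {k : Type u} {R : Type v} [Field k] [Ring R] [Algebra k R] {e : R}
  (he : IsIdempotentElem e) (N : Type z) [AddCommGroup N] [Module k N] [Module he.Corner N]
  [IsScalarTower k he.Corner N]

theorem toCorner_add (x y : R) : toCorner he (x + y) = toCorner he x + toCorner he y :=
  Subtype.ext (by change e * (x + y) * e = e * x * e + e * y * e; rw [mul_add, add_mul])

/-- The embedding of `N` in `Hom_{eRe} (eR, N)` with image `e Hom_{eRe} (eR, N)`. -/
def embed : N →ₗ[k] CornerHom he N where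
  toFun n := (show EIdeal e →ₗ[he.Corner] N from
    { toFun := fun x => toCorner he x.1 • n
      map_add' := fun x y => by
        rw [← add_smul, ← toCorner_add]; rfl
      map_smul' := fun b x => by
        rw [RingHom.id_apply, ← mul_smul]
        congr 1
        refine Subtype.ext ?_
        change e * (b.1 * x.1) * e = b.1 * (e * x.1 * e)
        obtain ⟨h1, h2⟩ := (Subsemigroup.mem_corner_iff he).1 b.2
        rw [show e * x.1 = x.1 from x.2, ← mul_assoc e, h1, mul_assoc] })
  map_add' a b := LinearMap.ext fun x => smul_add _ _ _
  map_smul' c a := LinearMap.ext fun x => smul_comm (toCorner he x.1) c a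

theorem embed_injective : Function.Injective (embed (k := k) he N) := by
  have key n : (show EIdeal e →ₗ[he.Corner] N from embed (k := k) he N n) ⟨e, he⟩ = n := by
    change toCorner he e • n = n
    have : toCorner he e = 1 := Subtype.ext (by change e * e * e = e; rw [he.eq, he.eq])
    rw [this, one_smul]
  intro a b h
  rw [← key a, h, key]

theorem embed_smul (τ : he.Corner) (n : N) :
    embed (k := k) he N (τ • n) = τ.1 • embed (k := k) he N n := by
  refine LinearMap.ext fun x => ?_
  change toCorner he x.1 • τ • n = toCorner he (x.1 * τ.1) • n
  rw [← mul_smul]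
  congr 1
  refine Subtype.ext ?_
  obtain ⟨h1, h2⟩ := (Subsemigroup.mem_corner_iff he).1 τ.2
  change e * x.1 * e * τ.1 = e * (x.1 * τ.1) * e
  simp only [mul_assoc, h1, h2]

/-- If $ef = f$ then $f(x) = f(xe) = (exe) f(e)$, so $f$ is determined by its value at $e$. -/
theorem smul_eq_self_iff (f : CornerHom he N) :
    e • f = f ↔ ∃ n, embed (k := k) he N n = f := by
  constructor
  · intro h
    let F : EIdeal e →ₗ[he.Corner] N := f
    refine ⟨F ⟨e, he⟩, LinearMap.ext fun x => ?_⟩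
    change toCorner he x.1 • F ⟨e, he⟩ = F x
    have h1 : F x = F (EIdeal.mulRight he e x) := (LinearMap.congr_fun h x).symm
    rw [h1, ← map_smul]
    congr 1
    refine Subtype.ext ?_
    change e * x.1 * e * e = x.1 * e
    rw [mul_assoc, he.eq, show e * x.1 = x.1 from x.2]
  · rintro ⟨n, rfl⟩
    have := embed_smul (k := k) he N 1 n
    rw [one_smul] at this
    exact this.symm

end CornerHom

/-! ### Group algebras of stabilizers inside the skew group algebra -/

namespace SkewPathAlgebra

open PathAlgebra

variable {k : Type u} {V : Type v} {G : Type z} [Field k] [Quiver.{w} V] [Fintype V] [Group G]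
  [MulSemiringAction G (PathAlgebra k V)] [MulAction G V]

/-- A group element, as an element of the skew group algebra. -/
def unit (k : Type u) (V : Type v) [Field k] [Quiver.{w} V] [Fintype V] {G : Type z} [Group G]
    [MulSemiringAction G (PathAlgebra k V)] (g : G) : SkewPathAlgebra k V G :=
  SkewMonoidAlgebra.single g 1

theorem unit_mul (g h : G) : unit k V (g * h) = unit k V g * unit k V h := by
  rw [unit, unit, unit, single_one_mul_single, smul_one]

theorem unit_one : unit k V (1 : G) = 1 := rfl

theorem unit_inv_mul (g : G) : unit k V g⁻¹ * unit k V g = 1 := by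
  rw [← unit_mul, inv_mul_cancel, unit_one]

theorem unit_mul_inv (g : G) : unit k V g * unit k V g⁻¹ = 1 := by
  rw [← unit_mul, mul_inv_cancel, unit_one]

theorem skewIdem_mul_self (a : V) :
    skewIdem k V G a * skewIdem k V G a = skewIdem k V G a := by
  rw [skewIdem, SkewMonoidAlgebra.single_mul_single, one_smul, idem_mul_idem_self, one_mul]

theorem skewIdem_mul_of_ne {a b : V} (h : a ≠ b) :
    skewIdem k V G a * skewIdem k V G b = 0 := by
  rw [skewIdem, skewIdem, SkewMonoidAlgebra.single_mul_single, one_smul, idem_mul_idem_of_ne h,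
    SkewMonoidAlgebra.single_zero]

theorem sum_skewIdem : ∑ a, skewIdem k V G a = 1 := by
  have h := map_sum (ofPathAlgebra k V G) (fun a : V => (idem a : PathAlgebra k V)) Finset.univ
  exact h.symm

theorem skewIdem_mul_unit (a : V) (g : G) :
    skewIdem k V G a * unit k V g = SkewMonoidAlgebra.single g (idem a) := by
  rw [skewIdem, unit, single_mul_single_one, one_mul]

section

variable [SMulCommClass G k (PathAlgebra k V)] [IsQuiverAction k V G]

theorem unit_mul_skewIdem (g : G) (a : V) :
    unit k V g * skewIdem k V G a = skewIdem k V G (g • a) * unit k V g := by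
  rw [skewIdem_mul_unit, skewIdem, unit, single_one_mul_single, IsQuiverAction.smul_idem, mul_one]

/-- `stabilizerEmb` as a linear map. -/
def stabEmb (a : V) : MonoidAlgebra k (MulAction.stabilizer G a) →ₗ[k] SkewPathAlgebra k V G where
  toFun := stabilizerEmb a
  map_add' x y := by
    refine Finsupp.sum_add_index' (fun _ => ?_) fun _ _ _ => ?_
    · rw [zero_smul, SkewMonoidAlgebra.single_zero]
    · rw [add_smul, SkewMonoidAlgebra.single_add]
  map_smul' c x := by
    rw [stabilizerEmb, stabilizerEmb, RingHom.id_apply, MonoidAlgebra.coeff_smul, Finsupp.smul_sum,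
      Finsupp.sum_smul_index' (fun _ => by rw [zero_smul, SkewMonoidAlgebra.single_zero])]
    refine Finsupp.sum_congr fun h _ => ?_
    rw [SkewMonoidAlgebra.smul_single, smul_assoc]

theorem stabEmb_single (a : V) (h : MulAction.stabilizer G a) (c : k) :
    stabEmb a (MonoidAlgebra.single h c) = c • (skewIdem k V G a * unit k V (h : G)) := by
  change stabilizerEmb a _ = _
  rw [stabilizerEmb, MonoidAlgebra.coeff_single, Finsupp.sum_single_index, skewIdem_mul_unit,
    SkewMonoidAlgebra.smul_single]
  rw [zero_smul, SkewMonoidAlgebra.single_zero]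

/-- Elements of the stabilizer of `a` commute with the idempotent of `a`. -/
theorem stabEmb_mul (a : V) (x y : MonoidAlgebra k (MulAction.stabilizer G a)) :
    stabEmb a (x * y) = stabEmb a x * stabEmb (G := G) (k := k) a y := by
  induction x using MonoidAlgebra.induction_linear with
  | zero => simp
  | add f g hf hg => rw [add_mul, map_add, map_add, hf, hg, add_mul]
  | single g c =>
    induction y using MonoidAlgebra.induction_linear with
    | zero => simp
    | add f g hf hg => rw [mul_add, map_add, map_add, hf, hg, mul_add]
    | single h d =>
      rw [MonoidAlgebra.single_mul_single, stabEmb_single, stabEmb_single, stabEmb_single,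
        smul_mul_smul_comm, Subgroup.coe_mul, unit_mul]
      congr 1
      rw [mul_assoc (skewIdem k V G a), ← mul_assoc (unit k V (g : G)), unit_mul_skewIdem,
        MulAction.mem_stabilizer_iff.1 g.2]
      simp only [← mul_assoc]
      rw [skewIdem_mul_self]

theorem stabEmb_one (a : V) : stabEmb a (1 : MonoidAlgebra k (MulAction.stabilizer G a)) =
    skewIdem k V G a := by
  rw [MonoidAlgebra.one_def, stabEmb_single, one_smul, OneMemClass.coe_one, unit_one, mul_one]

theorem skewIdem_mul_stabEmb (a : V) (x : MonoidAlgebra k (MulAction.stabilizer G a)) :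
    skewIdem k V G a * stabEmb a x = stabEmb a x := by
  rw [← stabEmb_one, ← stabEmb_mul, one_mul]

theorem stabEmb_mul_skewIdem (a : V) (x : MonoidAlgebra k (MulAction.stabilizer G a)) :
    stabEmb a x * skewIdem k V G a = stabEmb a x := by
  rw [← stabEmb_one, ← stabEmb_mul, mul_one]

theorem coeff_stabEmb (a : V) (x : MonoidAlgebra k (MulAction.stabilizer G a))
    (h : MulAction.stabilizer G a) : (stabEmb a x).coeff (h : G) = x.coeff h • idem a := by
  classical
  induction x using MonoidAlgebra.induction_linear with
  | zero => simp
  | add f g hf hg =>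
    rw [map_add, SkewMonoidAlgebra.coeff_add, Finsupp.add_apply, hf, hg, MonoidAlgebra.coeff_add,
      Finsupp.add_apply, add_smul]
  | single g c =>
    rw [stabEmb_single, skewIdem_mul_unit, SkewMonoidAlgebra.smul_single,
      SkewMonoidAlgebra.coeff_single_apply, MonoidAlgebra.coeff_single, Finsupp.single_apply,
      ite_smul, zero_smul]
    simp only [Subtype.ext_iff]

theorem idem_ne_zero (a : V) : (idem a : PathAlgebra k V) ≠ 0 := fun h =>
  one_ne_zero (Finsupp.single_eq_zero.1 h)

theorem stabEmb_injective (a : V) :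
    Function.Injective (stabEmb a : MonoidAlgebra k (MulAction.stabilizer G a) →ₗ[k] _) := by
  rw [injective_iff_map_eq_zero]
  intro x hx
  ext h
  have h1 := coeff_stabEmb a x h
  rw [hx, SkewMonoidAlgebra.coeff_zero, Finsupp.zero_apply] at h1
  simpa [idem_ne_zero] using h1.symm

theorem stabEmb_mem_degZero (a : V) (x : MonoidAlgebra k (MulAction.stabilizer G a)) :
    stabEmb a x ∈ degZero k V G := by
  induction x using MonoidAlgebra.induction_linear with
  | zero => simp
  | add f g hf hg => rw [map_add]; exact add_mem hf hg
  | single g c =>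
    rw [stabEmb_single, skewIdem_mul_unit]
    exact Submodule.smul_mem _ _ (single_mem_coeffIn (idem_mem_vertexSpan a) _)

end

end SkewPathAlgebra

/-! ### Orbit representatives -/

namespace OrbitData

variable {V : Type v} {G : Type z} [Group G] [MulAction G V] (D : OrbitData G V)

theorem eq_of_smul_eq {u v : D.T} {g : G} (h : g • (v : V) = u) : u = v := by
  obtain ⟨r, -, hr⟩ := D.existsUnique_T (u : V)
  have h1 := hr u ⟨u.2, MulAction.mem_orbit_self _⟩
  have h2 := hr v ⟨v.2, ⟨g, h⟩⟩
  exact Subtype.ext (h1.trans h2.symm)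

theorem eq_of_mem_orbit {u v : D.T} {a : V} (hu : a ∈ MulAction.orbit G (u : V))
    (hv : a ∈ MulAction.orbit G (v : V)) : u = v := by
  obtain ⟨g, rfl⟩ := hu
  obtain ⟨h, hh⟩ := hv
  exact D.eq_of_smul_eq (g := g⁻¹ * h) (by rw [mul_smul, show h • (v : V) = g • (u : V) from hh,
    inv_smul_smul])

theorem t_smul' (u : D.T) (a : MulAction.orbit G (u : V)) : D.t (a : V) • (u : V) = a :=
  D.t_smul u u.2 a a.2

theorem bijective_orbit :
    Function.Bijective fun p : (Σ u : D.T, MulAction.orbit G (u : V)) => (p.2 : V) := by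
  constructor
  · rintro ⟨u, a, ha⟩ ⟨v, b, hb⟩ h
    replace h : a = b := h
    subst h
    obtain rfl := D.eq_of_mem_orbit ha hb
    rfl
  · intro a
    obtain ⟨u, ⟨hu, ha⟩, -⟩ := D.existsUnique_T a
    exact ⟨⟨⟨u, hu⟩, ⟨a, ha⟩⟩, rfl⟩

end OrbitData

/-! ### Matrix units of the skew group algebra -/

namespace SkewPathAlgebra

open PathAlgebra

variable {k : Type u} {V : Type v} {G : Type z} [Field k] [Quiver.{w} V] [Fintype V] [Group G]
  [MulSemiringAction G (PathAlgebra k V)] [MulAction G V] [SMulCommClass G k (PathAlgebra k V)]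
  [IsQuiverAction k V G]

theorem unit_inv_mul_skewIdem {g : G} {u a : V} (h : g • u = a) :
    unit k V g⁻¹ * skewIdem k V G a = skewIdem k V G u * unit k V g⁻¹ := by
  rw [unit_mul_skewIdem, ← h, inv_smul_smul]

theorem skewIdem_mul_unit_mul_skewIdem {g : G} {u v : V} (h : g • v ≠ u) :
    skewIdem k V G u * (unit k V g * skewIdem k V G v) = 0 := by
  rw [unit_mul_skewIdem, ← mul_assoc, skewIdem_mul_of_ne h.symm, zero_mul]

variable {D : OrbitData G V}
  {ε : ∀ u : D.T, Irr k (MulAction.stabilizer G (u : V)) →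
    MonoidAlgebra k (MulAction.stabilizer G (u : V))}
  (d : ∀ u : D.T, Irr.IdempotentData (ε u))

/-- The element `t_a v` of the left ideal generated by the idempotent of `(u, ρ)`. -/
def column (u : D.T) (ρ : Irr k (MulAction.stabilizer G (u : V))) (a : V) :
    ρ.Space →ₗ[k] SkewPathAlgebra k V G :=
  (LinearMap.mulLeft k (unit k V (D.t a))).comp ((stabEmb (u : V)).comp ((d u).ι ρ))

/-- The rows dual to the elements `column`. -/
def row (u : D.T) (ρ : Irr k (MulAction.stabilizer G (u : V))) (a : V) (j : Fin ρ.dim) :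
    SkewPathAlgebra k V G :=
  stabEmb (u : V) ((d u).t ρ j) * unit k V (D.t a)⁻¹

section

variable (u : D.T) (ρ : Irr k (MulAction.stabilizer G (u : V)))

theorem column_apply (a : V) (v : ρ.Space) :
    column d u ρ a v = unit k V (D.t a) * stabEmb (u : V) ((d u).ι ρ v) := rfl

theorem row_eq (a : V) (j : Fin ρ.dim) :
    row d u ρ a j = stabEmb (u : V) ((d u).t ρ j) * unit k V (D.t a)⁻¹ := rfl

theorem column_mem_degZero [Finite G] (a : V) (v : ρ.Space) :
    column d u ρ a v ∈ degZero k V G :=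
  mul_mem_degZero (single_one_mem_degZero _) (stabEmb_mem_degZero _ _)

theorem row_mem_degZero [Finite G] (a : V) (j : Fin ρ.dim) :
    row d u ρ a j ∈ degZero k V G :=
  mul_mem_degZero (stabEmb_mem_degZero _ _) (single_one_mem_degZero _)

theorem column_mul (a : V) (v : ρ.Space) :
    column d u ρ a v * stabEmb (u : V) (ε u ρ) = column d u ρ a v := by
  rw [column_apply, mul_assoc, ← stabEmb_mul, (d u).ι_mul]

theorem mul_row (a : V) (j : Fin ρ.dim) :
    stabEmb (u : V) (ε u ρ) * row d u ρ a j = row d u ρ a j := by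
  rw [row_eq, ← mul_assoc, ← stabEmb_mul, (d u).mul_t]

theorem skewIdem_mul_column (a : MulAction.orbit G (u : V)) (v : ρ.Space) :
    skewIdem k V G (a : V) * column d u ρ a v = column d u ρ a v := by
  rw [column_apply, ← skewIdem_mul_stabEmb, ← mul_assoc (unit k V _), unit_mul_skewIdem,
    D.t_smul', ← mul_assoc, ← mul_assoc, skewIdem_mul_self]

theorem row_mul_skewIdem (a : MulAction.orbit G (u : V))
    (j : Fin ρ.dim) : row d u ρ a j * skewIdem k V G (a : V) = row d u ρ a j := by
  rw [row_eq, ← stabEmb_mul_skewIdem, mul_assoc, mul_assoc, unit_inv_mul_skewIdem (D.t_smul' _ a),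
    ← mul_assoc (skewIdem k V G (u : V)), skewIdem_mul_self, mul_assoc]

theorem row_mul_column (a : V) (j : Fin ρ.dim) (v : ρ.Space) :
    row d u ρ a j * column d u ρ a v = v j • stabEmb (u : V) (ε u ρ) := by
  rw [row_eq, column_apply, mul_assoc, ← mul_assoc (unit k V _), unit_inv_mul, one_mul,
    ← stabEmb_mul, (d u).t_mul_ι, map_smul]

end

theorem row_mul_column_of_ne {u v : D.T} (ρ : Irr k (MulAction.stabilizer G (u : V)))
    (σ : Irr k (MulAction.stabilizer G (v : V))) (a : MulAction.orbit G (u : V))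
    (b : MulAction.orbit G (v : V)) (h : (a : V) ≠ b) (j : Fin ρ.dim) (m : σ.Space) :
    row d u ρ a j * column d v σ b m = 0 := by
  rw [← row_mul_skewIdem, ← skewIdem_mul_column, mul_assoc, ← mul_assoc (skewIdem k V G (a : V)),
    skewIdem_mul_of_ne h, zero_mul, mul_zero]

theorem row_mul_column_of_ne_class {u : D.T} {ρ σ : Irr k (MulAction.stabilizer G (u : V))}
    (h : ρ ≠ σ) (a : V) (j : Fin ρ.dim) (m : σ.Space) :
    row d u ρ a j * column d u σ a m = 0 := by
  rw [row_eq, column_apply, mul_assoc, ← mul_assoc (unit k V _), unit_inv_mul, one_mul,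
    ← stabEmb_mul, (d u).t_mul_ι_of_ne _ _ _ _ h, map_zero]

theorem idempotent_mul_self (d : ∀ u : D.T, Irr.IdempotentData (ε u)) (u : D.T) (ρ : Irr k (MulAction.stabilizer G (u : V))) :
    ε u ρ * ε u ρ = ε u ρ := by
  have h := (d u).ι_mul ρ ((d u).v₀ ρ)
  rwa [(d u).ι_v₀] at h

theorem idempotent_ne_zero (d : ∀ u : D.T, Irr.IdempotentData (ε u)) (u : D.T) (ρ : Irr k (MulAction.stabilizer G (u : V))) :
    ε u ρ ≠ 0 := by
  intro h
  obtain ⟨v, hv⟩ := exists_ne (0 : ρ.Space)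
  have h1 := (d u).ι_mul ρ v
  rw [h, mul_zero] at h1
  have h2 := (d u).act_ι ρ v
  rw [← h1, map_zero] at h2
  exact hv h2.symm

variable (k D) in
/-- The index set of the matrix units. -/
abbrev MatrixIndex : Type (max u v z) :=
  Σ x : SkewVertex k D, MulAction.orbit G (x.1 : V) × Fin x.2.dim

section

variable [CharZero k] [Finite G]

instance : Fintype (MatrixIndex k D) :=
  have : Finite (MatrixIndex k D) := inferInstance
  Fintype.ofFinite _

/-- Grouping the indices by the vertex $a$, the inner sum is $t_a e_u t_a^{-1} = e_a$ by
completeness of the dual families in $k[G_u]$. The orbits partition the vertices, so the total is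
$\sum_a e_a = 1$. -/
theorem sum_column_mul_row :
    ∑ i : MatrixIndex k D, column d i.1.1 i.1.2 i.2.1 (Pi.single i.2.2 1) *
      row d i.1.1 i.1.2 i.2.1 i.2.2 = 1 := by
  classical
  have : Fintype D.T := Fintype.ofFinite _
  have (u : D.T) : Fintype (MulAction.orbit G (u : V)) := Fintype.ofFinite _
  let f (p : Σ u : D.T, MulAction.orbit G (u : V))
      (q : Σ ρ : Irr k (MulAction.stabilizer G (p.1 : V)), Fin ρ.dim) : SkewPathAlgebra k V G :=
    column d p.1 q.1 p.2 (Pi.single q.2 1) * row d p.1 q.1 p.2 q.2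
  let φ : MatrixIndex k D ≃ Σ p : (Σ u : D.T, MulAction.orbit G (u : V)),
      (Σ ρ : Irr k (MulAction.stabilizer G (p.1 : V)), Fin ρ.dim) :=
    { toFun := fun i => ⟨⟨i.1.1, i.2.1⟩, ⟨i.1.2, i.2.2⟩⟩
      invFun := fun j => ⟨⟨j.1.1, j.2.1⟩, (j.1.2, j.2.2)⟩
      left_inv := fun _ => rfl
      right_inv := fun _ => rfl }
  have h1 : ∑ i : MatrixIndex k D, column d i.1.1 i.1.2 i.2.1 (Pi.single i.2.2 1) *
      row d i.1.1 i.1.2 i.2.1 i.2.2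
      = ∑ j : (Σ p : (Σ u : D.T, MulAction.orbit G (u : V)),
      (Σ ρ : Irr k (MulAction.stabilizer G (p.1 : V)), Fin ρ.dim)), f j.1 j.2 :=
    Fintype.sum_equiv φ _ _ fun i => rfl
  rw [h1, Fintype.sum_sigma, ← sum_skewIdem]
  refine Fintype.sum_bijective _ D.bijective_orbit _ _ ?_
  rintro ⟨u, a⟩
  have h2 : ∑ q, f ⟨u, a⟩ q = unit k V (D.t a) * stabEmb (u : V)
      (∑ ρ, ∑ j, (d u).ι ρ (Pi.single j 1) * (d u).t ρ j) * unit k V (D.t a)⁻¹ := by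
    simp only [map_sum, Finset.mul_sum, Finset.sum_mul]
    rw [Fintype.sum_sigma]
    refine Finset.sum_congr rfl fun ρ _ => Finset.sum_congr rfl fun j _ => ?_
    rw [stabEmb_mul]
    simp only [f, column_apply, row_eq, mul_assoc]
  change ∑ q, f ⟨u, a⟩ q = skewIdem k V G (a : V)
  rw [h2, (d u).sum, stabEmb_one, unit_mul_skewIdem, D.t_smul', mul_assoc, unit_mul_inv, mul_one]

theorem stabEmb_mul_of_ne {u v : D.T} (h : u ≠ v)
    (x : MonoidAlgebra k (MulAction.stabilizer G (u : V)))
    (y : MonoidAlgebra k (MulAction.stabilizer G (v : V))) :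
    stabEmb (u : V) x * stabEmb (v : V) y = (0 : SkewPathAlgebra k V G) := by
  rw [← stabEmb_mul_skewIdem, ← skewIdem_mul_stabEmb (v : V), mul_assoc,
    ← mul_assoc (skewIdem k V G (u : V)),
    skewIdem_mul_of_ne fun h' => h (Subtype.ext h'), zero_mul, mul_zero]

/-- The matrix units of the skew group algebra. -/
def matrixSystem : MatrixSystem (SkewPathAlgebra k V G) (SkewVertex k D) (MatrixIndex k D) where
  E x := stabEmb (x.1 : V) (ε x.1 x.2)
  c i := i.1
  s i := column d i.1.1 i.1.2 i.2.1 (Pi.single i.2.2 1)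
  t i := row d i.1.1 i.1.2 i.2.1 i.2.2
  E_mul_self x := by rw [← stabEmb_mul, idempotent_mul_self d]
  E_mul_of_ne := by
    rintro ⟨u, ρ⟩ ⟨v, σ⟩ hxy
    by_cases h : u = v
    · subst h
      have h1 := (d u).corner_of_ne ρ σ 1 fun h => hxy (by rw [h])
      rw [mul_one] at h1
      change stabEmb (u : V) (ε u ρ) * stabEmb (u : V) (ε u σ) = _
      rw [← stabEmb_mul, h1, map_zero]
    · exact stabEmb_mul_of_ne h _ _
  s_mul i := column_mul d _ _ _ _
  mul_t i := mul_row d _ _ _ _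
  t_mul_s i := by rw [row_mul_column, Pi.single_eq_same, one_smul]
  t_mul_s_of_ne := by
    rintro ⟨⟨u, ρ⟩, a, i⟩ ⟨⟨v, σ⟩, b, j⟩ h
    by_cases hab : (a : V) = b
    · obtain ⟨a, ha⟩ := a
      obtain ⟨b, hb⟩ := b
      replace hab : a = b := hab
      subst hab
      obtain rfl := D.eq_of_mem_orbit ha hb
      by_cases hρ : ρ = σ
      · subst hρ
        have hij : i ≠ j := fun hij => h (by rw [hij])
        refine (row_mul_column d u ρ a i _).trans ?_
        rw [Pi.single_eq_of_ne hij, zero_smul]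
      · exact row_mul_column_of_ne_class d hρ a i _
    · exact row_mul_column_of_ne d ρ σ a b hab i _
  sum := sum_column_mul_row d

/-- For $w = e_a g$ the product vanishes unless $a = u$ and $gv = u$. In that case $u = v$ because
both are orbit representatives, so $g \in G_u$ and the claim is about the corners of $k[G_u]$: these
are lines if $\rho = \sigma$ and zero otherwise. -/
theorem mul_mul_mem_span {w : SkewPathAlgebra k V G} (hw : w ∈ degZero k V G)
    (x y : SkewVertex k D) : (matrixSystem d).E x * w * (matrixSystem d).E y ∈
      Submodule.span k (Set.range (matrixSystem d).E) := by
  have := Fintype.ofFinite G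
  obtain ⟨u, ρ⟩ := x
  obtain ⟨v, σ⟩ := y
  change stabEmb (u : V) (ε u ρ) * _ * stabEmb (v : V) (ε v σ) ∈ _
  rw [eq_sum_single w, Finset.mul_sum, Finset.sum_mul]
  refine sum_mem fun g _ => ?_
  have key : ∀ a, stabEmb (u : V) (ε u ρ) * SkewMonoidAlgebra.single g (idem a) *
      stabEmb (v : V) (ε v σ) ∈ Submodule.span k (Set.range (matrixSystem d).E) := by
    intro a
    rw [← skewIdem_mul_unit]
    by_cases ha : (u : V) = a
    · by_cases hg : g • (v : V) = u
      · obtain rfl := D.eq_of_smul_eq hg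
        have h1 : skewIdem k V G a * unit k V g
            = stabEmb (u : V) (MonoidAlgebra.single (⟨g, hg⟩ : MulAction.stabilizer G (u : V)) 1) := by
          rw [stabEmb_single, one_smul, ← ha]
        rw [h1, ← stabEmb_mul, ← stabEmb_mul]
        by_cases hρσ : ρ = σ
        · subst hρσ
          obtain ⟨c, hc⟩ := (d u).corner ρ
            (MonoidAlgebra.single (⟨g, hg⟩ : MulAction.stabilizer G (u : V)) 1)
          rw [hc, map_smul]
          exact Submodule.smul_mem _ _ (Submodule.subset_span ⟨⟨u, ρ⟩, rfl⟩)
        · rw [(d u).corner_of_ne ρ σ _ hρσ, map_zero]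
          exact zero_mem _
      · rw [← skewIdem_mul_stabEmb (v : V), ← ha, mul_assoc, mul_assoc (skewIdem k V G _),
          ← mul_assoc (unit k V g), ← mul_assoc (skewIdem k V G _),
          skewIdem_mul_unit_mul_skewIdem hg, zero_mul, mul_zero]
        exact zero_mem _
    · rw [← stabEmb_mul_skewIdem (u : V), ← mul_assoc, mul_assoc (stabEmb _ _),
        skewIdem_mul_of_ne ha, mul_zero, zero_mul, zero_mul]
      exact zero_mem _
  have hg := hw g
  generalize w.coeff g = c at hg
  induction hg using Submodule.span_induction with
  | mem c hc => obtain ⟨a, rfl⟩ := hc; exact key a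
  | zero => rw [SkewMonoidAlgebra.single_zero, mul_zero, zero_mul]; exact zero_mem _
  | add c c' _ _ h h' =>
    rw [SkewMonoidAlgebra.single_add, mul_add, add_mul]
    exact add_mem h h'
  | smul r c _ h =>
    rw [← SkewMonoidAlgebra.smul_single, mul_smul_comm, smul_mul_assoc]
    exact Submodule.smul_mem _ _ h

theorem linearIndependent_E : LinearIndependent k (matrixSystem d).E := by
  rw [Fintype.linearIndependent_iff]
  intro c hc x
  have h1 : (∑ y, c y • (matrixSystem d).E y) * (matrixSystem d).E x = 0 := by rw [hc, zero_mul]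
  rw [Finset.sum_mul, Finset.sum_eq_single x] at h1
  · rw [smul_mul_assoc, (matrixSystem d).E_mul_self] at h1
    refine (smul_eq_zero.1 h1).resolve_right fun h => idempotent_ne_zero d x.1 x.2 ?_
    exact stabEmb_injective _ (h.trans (map_zero _).symm)
  · intro y _ hy
    rw [smul_mul_assoc, (matrixSystem d).E_mul_of_ne _ _ hy, smul_zero]
  · simp

end

end SkewPathAlgebra

/-! ### Coefficients, and the components of elements of degree one -/

namespace SkewPathAlgebra

open PathAlgebra

section Coeff

variable {k : Type u} {V : Type v} {G : Type z} [Field k] [Quiver.{w} V] [Fintype V]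

theorem linearMap_ext {T : Type*} [AddCommGroup T] [Module k T] [Finite G]
    {f f' : SkewMonoidAlgebra (PathAlgebra k V) G →ₗ[k] T}
    (h : ∀ g c, f (SkewMonoidAlgebra.single g c) = f' (SkewMonoidAlgebra.single g c)) : f = f' := by
  have := Fintype.ofFinite G
  refine LinearMap.ext fun x => ?_
  rw [eq_sum_single x, map_sum, map_sum]
  exact Finset.sum_congr rfl fun g _ => h g _

variable (k V) in
/-- The coefficient of a group element, as a linear map. -/
def coeffAt (g : G) : SkewMonoidAlgebra (PathAlgebra k V) G →ₗ[k] PathAlgebra k V :=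
  (Finsupp.lapply g).comp SkewMonoidAlgebra.coeffLinearEquiv.toLinearMap

theorem coeffAt_apply (g : G) (x : SkewMonoidAlgebra (PathAlgebra k V) G) :
    coeffAt k V g x = x.coeff g := rfl

variable [Group G] [MulSemiringAction G (PathAlgebra k V)] [SMulCommClass G k (PathAlgebra k V)]
  [Finite G]

theorem coeff_ofPathAlgebra_mul (c : PathAlgebra k V) (x : SkewPathAlgebra k V G) (g : G) :
    (ofPathAlgebra k V G c * x).coeff g = c * x.coeff g := by
  classical
  refine LinearMap.congr_fun (f := (coeffAt k V g).comp (LinearMap.mulLeft k (ofPathAlgebra k V G c)))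
    (g := (LinearMap.mulLeft k c).comp (coeffAt k V g)) (linearMap_ext fun h c' => ?_) x
  change (SkewMonoidAlgebra.single 1 c * SkewMonoidAlgebra.single h c').coeff g =
    c * (SkewMonoidAlgebra.single h c').coeff g
  rw [SkewMonoidAlgebra.single_mul_single, one_mul, one_smul,
    SkewMonoidAlgebra.coeff_single_apply, SkewMonoidAlgebra.coeff_single_apply, mul_ite, mul_zero]

theorem coeff_unit_mul (h : G) (x : SkewPathAlgebra k V G) (g : G) :
    (unit k V h * x).coeff g = h • x.coeff (h⁻¹ * g) := by
  classical
  refine LinearMap.congr_fun (f := (coeffAt k V g).comp (LinearMap.mulLeft k (unit k V h)))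
    (g := (DistribSMul.toLinearMap k _ h).comp (coeffAt k V (h⁻¹ * g)))
    (linearMap_ext fun h' c' => ?_) x
  change (SkewMonoidAlgebra.single h 1 * SkewMonoidAlgebra.single h' c').coeff g =
    h • (SkewMonoidAlgebra.single h' c').coeff (h⁻¹ * g)
  rw [single_one_mul_single, SkewMonoidAlgebra.coeff_single_apply,
    SkewMonoidAlgebra.coeff_single_apply, smul_ite, smul_zero]
  simp only [eq_inv_mul_iff_mul_eq]

theorem coeff_mul_single (x : SkewPathAlgebra k V G) (h g : G) (c : PathAlgebra k V) :
    (x * SkewMonoidAlgebra.single h c).coeff g = x.coeff (g * h⁻¹) * (g * h⁻¹) • c := by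
  classical
  refine LinearMap.congr_fun
    (f := (coeffAt k V g).comp (LinearMap.mulRight k (SkewMonoidAlgebra.single h c)))
    (g := (LinearMap.mulRight k ((g * h⁻¹) • c)).comp (coeffAt k V (g * h⁻¹)))
    (linearMap_ext fun h' c' => ?_) x
  change (SkewMonoidAlgebra.single h' c' * SkewMonoidAlgebra.single h c).coeff g =
    (SkewMonoidAlgebra.single h' c').coeff (g * h⁻¹) * (g * h⁻¹) • c
  rw [SkewMonoidAlgebra.single_mul_single, SkewMonoidAlgebra.coeff_single_apply,
    SkewMonoidAlgebra.coeff_single_apply, ite_mul, zero_mul]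
  by_cases hg : h' * h = g
  · rw [if_pos hg, if_pos (by rw [← hg, mul_inv_cancel_right]), ← hg, mul_inv_cancel_right]
  · rw [if_neg hg, if_neg fun h'' => hg (by rw [h'', inv_mul_cancel_right])]

variable [MulAction G V] [IsQuiverAction k V G]

theorem coeff_mul_stabEmb {v : V} [Fintype (MulAction.stabilizer G v)]
    (x : SkewPathAlgebra k V G) (c : MonoidAlgebra k (MulAction.stabilizer G v)) (g : G) :
    (x * stabEmb v c).coeff g =
      ∑ h : MulAction.stabilizer G v, c.coeff h • (x.coeff (g * (h : G)⁻¹) * idem (g • v)) := by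
  classical
  induction c using MonoidAlgebra.induction_linear with
  | zero => simp
  | add a b ha hb =>
    rw [map_add, mul_add, SkewMonoidAlgebra.coeff_add, Finsupp.add_apply, ha, hb,
      ← Finset.sum_add_distrib]
    exact Finset.sum_congr rfl fun h _ => by
      rw [MonoidAlgebra.coeff_add, Finsupp.add_apply, add_smul]
  | single h r =>
    rw [Finset.sum_eq_single h]
    · rw [stabEmb_single, skewIdem_mul_unit, mul_smul_comm, SkewMonoidAlgebra.coeff_smul,
        Finsupp.smul_apply, coeff_mul_single, MonoidAlgebra.coeff_single, Finsupp.single_eq_same,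
        IsQuiverAction.smul_idem, mul_smul, MulAction.mem_stabilizer_iff.1 (inv_mem h.2)]
    · intro h' _ hh
      rw [MonoidAlgebra.coeff_single, Finsupp.single_eq_of_ne hh, zero_smul]
    · simp

theorem coeff_unit_mul_stabEmb {v : V} (t : G) (c : MonoidAlgebra k (MulAction.stabilizer G v))
    (h : MulAction.stabilizer G v) :
    (unit k V t * stabEmb v c).coeff (t * h) = c.coeff h • idem (t • v) := by
  rw [coeff_unit_mul, inv_mul_cancel_left, coeff_stabEmb, smul_comm, IsQuiverAction.smul_idem]

theorem unit_mul_stabEmb {v : V} (h : MulAction.stabilizer G v)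
    (c : MonoidAlgebra k (MulAction.stabilizer G v)) :
    unit k V (h : G) * stabEmb v c = stabEmb v (MonoidAlgebra.single h 1 * c) := by
  have h1 := unit_mul_skewIdem (k := k) (h : G) v
  rw [MulAction.mem_stabilizer_iff.1 h.2] at h1
  rw [stabEmb_mul, stabEmb_single, one_smul, ← h1, mul_assoc, skewIdem_mul_stabEmb]

end Coeff

section ArrowSpace

variable {k : Type u} {V : Type v} [Field k] [Quiver.{w} V] [Fintype V] {a b : V}
  {x : PathAlgebra k V}

theorem idem_mul_of_mem_arrowSpace (hx : x ∈ arrowSpace k a b) : idem a * x = x := by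
  rw [← idem_mul_mul_idem_eq k V a b x hx, ← mul_assoc, ← mul_assoc, idem_mul_idem_self]

theorem mul_idem_of_mem_arrowSpace (hx : x ∈ arrowSpace k a b) : x * idem b = x := by
  rw [← idem_mul_mul_idem_eq k V a b x hx, mul_assoc, idem_mul_idem_self]

end ArrowSpace

section Component

variable {k : Type u} {V : Type v} {G : Type z} [Field k] [Quiver.{w} V] [Fintype V] [Group G]
  [MulSemiringAction G (PathAlgebra k V)] [MulAction G V] [SMulCommClass G k (PathAlgebra k V)]
  [IsQuiverAction k V G] [Finite G]

variable (k) in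
/-- The projection of the span of the arrows onto `R_{ab}`. -/
def cut (a b : V) : arrowSpan k V →ₗ[k] arrowSpace k a b :=
  ((LinearMap.mulRight k (idem b)).comp ((LinearMap.mulLeft k (idem a)).comp
    (arrowSpan k V).subtype)).codRestrict _ fun x => idem_mul_mul_idem_mem k V a b x x.2

theorem coe_cut (a b : V) (x : arrowSpan k V) : (cut k a b x : PathAlgebra k V) =
    idem a * (x : PathAlgebra k V) * idem b := rfl

variable (k) in
/-- The coefficient of a group element in an element of degree one. -/
def coeffOne (g : G) : degOne k V G →ₗ[k] arrowSpan k V :=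
  ((coeffAt k V g).comp (degOne k V G).subtype).codRestrict _ fun x => x.2 g

theorem coe_coeffOne (g : G) (x : degOne k V G) :
    (coeffOne k g x : PathAlgebra k V) = x.1.coeff g := rfl

variable {v : V} {η : Irr k (MulAction.stabilizer G v) → MonoidAlgebra k (MulAction.stabilizer G v)}
  (e : Irr.IdempotentData η) (σ : Irr k (MulAction.stabilizer G v)) (t : G) (a b : V)

/-- If `t v = b`, the projection of the elements of degree one of the left ideal generated by the
idempotent of `σ` onto `R_{ab} ⊗ V_σ`. -/
def component : degOne k V G →ₗ[k] arrowSpace k a b ⊗[k] σ.Space :=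
  have := Fintype.ofFinite (MulAction.stabilizer G v)
  ∑ h : MulAction.stabilizer G v, ((TensorProduct.mk k (arrowSpace k a b) σ.Space).flip
    (σ.rep h (e.v₀ σ))).comp ((cut k a b).comp (coeffOne k (t * (h : G))))

theorem component_apply [Fintype (MulAction.stabilizer G v)] (x : degOne k V G) :
    component e σ t a b x = ∑ h : MulAction.stabilizer G v,
      cut k a b (coeffOne k (t * (h : G)) x) ⊗ₜ[k] σ.rep h (e.v₀ σ) := by
  rw [component, LinearMap.sum_apply]
  exact Finset.sum_congr (by ext; simp) fun _ _ => rfl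

/-- The inclusion of `R_{ab} ⊗ V_σ` in the left ideal generated by the idempotent of `σ`. -/
def extend : arrowSpace k a b ⊗[k] σ.Space →ₗ[k] SkewPathAlgebra k V G :=
  TensorProduct.lift ((LinearMap.mul k (SkewPathAlgebra k V G)).compl₁₂
    ((ofPathAlgebra k V G).comp (arrowSpace k a b).subtype)
    ((LinearMap.mulLeft k (unit k V t)).comp ((stabEmb v).comp (e.ι σ))))

theorem extend_tmul (r : arrowSpace k a b) (n : σ.Space) : extend e σ t a b (r ⊗ₜ n) =
    ofPathAlgebra k V G r * (unit k V t * stabEmb v (e.ι σ n)) := rfl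

theorem extend_mul (τ : arrowSpace k a b ⊗[k] σ.Space) :
    extend e σ t a b τ * stabEmb v (η σ) = extend e σ t a b τ := by
  induction τ using TensorProduct.induction_on with
  | zero => rw [map_zero, zero_mul]
  | add x y hx hy => rw [map_add, add_mul, hx, hy]
  | tmul r n => rw [extend_tmul, mul_assoc, mul_assoc, ← stabEmb_mul, e.ι_mul]

theorem skewIdem_mul_extend (τ : arrowSpace k a b ⊗[k] σ.Space) :
    skewIdem k V G a * extend e σ t a b τ = extend e σ t a b τ := by
  induction τ using TensorProduct.induction_on with
  | zero => rw [map_zero, mul_zero]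
  | add x y hx hy => rw [map_add, mul_add, hx, hy]
  | tmul r n =>
    have hr := idem_mul_of_mem_arrowSpace r.2
    rw [extend_tmul, ← mul_assoc]
    change ofPathAlgebra k V G (idem a) * ofPathAlgebra k V G r * _ = _
    rw [← ofPathAlgebra_mul, hr]

variable {t b}

theorem coeff_extend_tmul (ht : t • v = b) (r : arrowSpace k a b) (n : σ.Space)
    (h : MulAction.stabilizer G v) : (extend e σ t a b (r ⊗ₜ n)).coeff (t * h) =
      (e.ι σ n).coeff h • (r : PathAlgebra k V) := by
  have hr := mul_idem_of_mem_arrowSpace r.2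
  rw [extend_tmul, coeff_ofPathAlgebra_mul, coeff_unit_mul_stabEmb, mul_smul_comm, ht, hr]

/-- The coefficients are supported on the coset $tG_v$, whose elements all carry $v$ to $b$. -/
theorem extend_mem_coeffIn (ht : t • v = b) (τ : arrowSpace k a b ⊗[k] σ.Space) :
    extend e σ t a b τ ∈ coeffIn G (arrowSpace k a b) := by
  induction τ using TensorProduct.induction_on with
  | zero => rw [map_zero]; exact zero_mem _
  | add x y hx hy => rw [map_add]; exact add_mem hx hy
  | tmul r n =>
    have hr := mul_idem_of_mem_arrowSpace r.2
    have := Fintype.ofFinite (MulAction.stabilizer G v)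
    intro g
    rw [extend_tmul, coeff_ofPathAlgebra_mul, coeff_unit_mul]
    by_cases hg : t⁻¹ * g ∈ MulAction.stabilizer G v
    · rw [coeff_stabEmb v _ ⟨_, hg⟩, smul_comm, IsQuiverAction.smul_idem, ht, mul_smul_comm, hr]
      exact Submodule.smul_mem _ _ r.2
    · have h1 := coeff_mul_stabEmb (1 : SkewPathAlgebra k V G) (e.ι σ n) (t⁻¹ * g)
      rw [one_mul] at h1
      rw [h1, Finset.sum_eq_zero, smul_zero, mul_zero]
      · exact zero_mem _
      · intro h _
        rw [SkewMonoidAlgebra.coeff_one, Finsupp.single_eq_of_ne, zero_mul, smul_zero]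
        intro h2
        rw [mul_inv_eq_one] at h2
        exact hg (h2 ▸ h.2)

theorem extend_mem_degOne (ht : t • v = b) (τ : arrowSpace k a b ⊗[k] σ.Space) :
    extend e σ t a b τ ∈ degOne k V G :=
  fun g => arrowSpace_le k V a b (extend_mem_coeffIn e σ a ht τ g)

theorem cut_of_mem_of_ne {a b a' b' : V} (h : b' ≠ b) (x : arrowSpan k V)
    (hx : (x : PathAlgebra k V) ∈ arrowSpace k a' b') : cut k a b x = 0 := by
  refine Subtype.ext ?_
  rw [coe_cut, ← idem_mul_mul_idem_eq k V a' b' x hx, mul_assoc, mul_assoc, idem_mul_idem_of_ne h,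
    mul_zero, mul_zero]
  rfl

/-- For $\tau = r \otimes n$ the coefficient at $th$ is $\iota(n)_h\, r$, so the component is $r
\otimes \sum_h \iota(n)_h\, h v_0 = r \otimes \iota(n) v_0 = r \otimes n$. -/
theorem component_extend (ht : t • v = b) (τ : arrowSpace k a b ⊗[k] σ.Space)
    (hτ : extend e σ t a b τ ∈ degOne k V G) : component e σ t a b ⟨extend e σ t a b τ, hτ⟩ = τ := by
  classical
  have := Fintype.ofFinite (MulAction.stabilizer G v)
  let F : arrowSpace k a b ⊗[k] σ.Space →ₗ[k] arrowSpace k a b ⊗[k] σ.Space :=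
    (component e σ t a b).comp ((extend e σ t a b).codRestrict _ (extend_mem_degOne e σ a ht))
  suffices h : F = LinearMap.id from LinearMap.congr_fun h τ
  refine TensorProduct.ext' fun r n => ?_
  have h1 : F (r ⊗ₜ n) = ∑ h : MulAction.stabilizer G v,
      r ⊗ₜ[k] ((e.ι σ n).coeff h • σ.rep h (e.v₀ σ)) := by
    refine (component_apply e σ t a b _).trans (Finset.sum_congr rfl fun h _ => ?_)
    rw [← TensorProduct.smul_tmul]
    congr 1
    refine Subtype.ext ?_
    rw [coe_cut, coe_coeffOne]
    change idem a * (extend e σ t a b (r ⊗ₜ n)).coeff (t * h) * idem b = _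
    rw [coeff_extend_tmul e σ a ht, mul_smul_comm, smul_mul_assoc,
      idem_mul_mul_idem_eq k V a b r r.2]
    rfl
  have h2 : ∑ h : MulAction.stabilizer G v, (e.ι σ n).coeff h • σ.rep h (e.v₀ σ) = n := by
    conv_rhs => rw [← e.act_ι σ n]
    generalize e.ι σ n = c
    induction c using MonoidAlgebra.induction_linear with
    | zero => simp
    | add a b ha hb =>
      rw [map_add, LinearMap.add_apply, ← ha, ← hb, ← Finset.sum_add_distrib]
      exact Finset.sum_congr rfl fun h _ => by
        rw [MonoidAlgebra.coeff_add, Finsupp.add_apply, add_smul]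
    | single h c =>
      rw [Finset.sum_eq_single h, MonoidAlgebra.coeff_single, Finsupp.single_eq_same,
        ← Irr.act_single, ← LinearMap.smul_apply, ← map_smul, MonoidAlgebra.smul_single, smul_eq_mul,
        mul_one]
      · intro h' _ hh
        rw [MonoidAlgebra.coeff_single, Finsupp.single_eq_of_ne hh, zero_smul]
      · simp
  rw [h1, ← TensorProduct.tmul_sum, h2, LinearMap.id_apply]

theorem component_of_mem_coeffIn {a' b' : V} (h : b' ≠ b) (x : degOne k V G)
    (hx : x.1 ∈ coeffIn G (arrowSpace k a' b')) : component e σ t a b x = 0 := by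
  have := Fintype.ofFinite (MulAction.stabilizer G v)
  rw [component_apply]
  refine Finset.sum_eq_zero fun g _ => ?_
  rw [cut_of_mem_of_ne h _ (hx _), TensorProduct.zero_tmul]

theorem unit_mul_mem_coeffIn (g : G) {a b : V} {x : SkewPathAlgebra k V G}
    (hx : x ∈ coeffIn G (arrowSpace k a b)) :
    unit k V g * x ∈ coeffIn G (arrowSpace k (g • a) (g • b)) := by
  intro h
  rw [coeff_unit_mul]
  exact smul_mem_arrowSpace k g (hx _)

/-- Together with `component_extend`, this makes `component` injective on the part supported on one
coset: both sides are the convolution of the coefficients of `x` with those of the idempotent,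
because $\iota(h'v_0)$ is $h'$ times the idempotent. -/
theorem coeff_extend_component (ht : t • v = b) (x : degOne k V G)
    (hx : x.1 * stabEmb v (η σ) = x.1)
    (hx' : ∀ h : MulAction.stabilizer G v, x.1.coeff (t * h) ∈ arrowSpace k a b)
    (h : MulAction.stabilizer G v) :
    (extend e σ t a b (component e σ t a b x)).coeff (t * h) = x.1.coeff (t * h) := by
  have := Fintype.ofFinite (MulAction.stabilizer G v)
  conv_rhs => rw [← hx]
  rw [coeff_mul_stabEmb, component_apply, map_sum]
  rw [← coeffAt_apply, map_sum]
  simp only [coeffAt_apply, coeff_extend_tmul e σ a ht]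
  refine Fintype.sum_equiv ((Equiv.inv _).trans (Equiv.mulRight h)) _ _ fun h' => ?_
  have h1 : e.ι σ (σ.rep h' (e.v₀ σ)) = MonoidAlgebra.single h' 1 * η σ := by
    rw [← Irr.act_single, ← e.mul_ι, e.ι_v₀]
  have h2 : t * (h : G) * ((h'⁻¹ * h : MulAction.stabilizer G v) : G)⁻¹ = t * h' := by
    simp [mul_assoc]
  have hr := mul_idem_of_mem_arrowSpace (hx' h')
  change _ = (η σ).coeff (h'⁻¹ * h) •
    (x.1.coeff (t * (h : G) * ((h'⁻¹ * h : MulAction.stabilizer G v) : G)⁻¹) * _)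
  rw [h2, mul_smul, MulAction.mem_stabilizer_iff.1 h.2, ht, hr, h1, coe_cut, coe_coeffOne,
    idem_mul_mul_idem_eq k V a b _ (hx' h'), MonoidAlgebra.coeff_single_mul_apply, one_mul]

end Component

end SkewPathAlgebra

/-! ### Corners in degree one are spaces of intertwining maps -/

namespace SkewPathAlgebra

open PathAlgebra

variable {k : Type u} {V : Type v} {G : Type z} [Field k] [Quiver.{w} V] [Fintype V] [Group G]
  [MulSemiringAction G (PathAlgebra k V)] [MulAction G V] [SMulCommClass G k (PathAlgebra k V)]
  [IsQuiverAction k V G] [Finite G]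

theorem unit_mul_mem_degOne (g : G) {x : SkewPathAlgebra k V G} (hx : x ∈ degOne k V G) :
    unit k V g * x ∈ degOne k V G :=
  degZero_mul_mem_degOne (single_one_mem_degZero g) hx

variable (k) in
/-- Multiplication by a group element on the elements of degree one. -/
def unitMul (g : G) : degOne k V G →ₗ[k] degOne k V G :=
  (LinearMap.mulLeft k (unit k V g)).restrict fun _ hx => unit_mul_mem_degOne g hx

theorem coe_unitMul (g : G) (x : degOne k V G) : (unitMul k g x).1 = unit k V g * x.1 := rfl

theorem unitMul_unitMul (g h : G) (x : degOne k V G) :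
    unitMul k g (unitMul k h x) = unitMul k (g * h) x :=
  Subtype.ext (by rw [coe_unitMul, coe_unitMul, coe_unitMul, unit_mul, mul_assoc])

section

variable {v : V} {η : Irr k (MulAction.stabilizer G v) → MonoidAlgebra k (MulAction.stabilizer G v)}
  (e : Irr.IdempotentData η) (σ : Irr k (MulAction.stabilizer G v)) {t : G} (a : V) {b : V}

/-- `extend` as a map to the elements of degree one. -/
def extendOne (ht : t • v = b) : arrowSpace k a b ⊗[k] σ.Space →ₗ[k] degOne k V G :=
  (extend e σ t a b).codRestrict _ (extend_mem_degOne e σ a ht)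

theorem component_extendOne (ht : t • v = b) (τ : arrowSpace k a b ⊗[k] σ.Space) :
    component e σ t a b (extendOne e σ a ht τ) = τ :=
  component_extend e σ a ht τ _

/-- The group element `s` fixes both `a` and `b`, so it permutes the coset $tG_v$ and preserves
$R_{ab}$. Passing it through $t$ turns it into $t^{-1}st$, the element acting on $V_\sigma$. -/
theorem component_unitMul (ht : t • v = b)
    (s : ↥(MulAction.stabilizer G a ⊓ MulAction.stabilizer G b)) (x : degOne k V G) :
    component e σ t a b (unitMul k (s : G) x) = TensorProduct.map (arrowRep k G a b s)
      (σ.rep (conjStabilizer t ht _ inf_le_right s)) (component e σ t a b x) := by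
  have := Fintype.ofFinite (MulAction.stabilizer G v)
  rw [component_apply, component_apply, map_sum]
  let s' := conjStabilizer t ht (MulAction.stabilizer G a ⊓ MulAction.stabilizer G b) inf_le_right s
  refine Fintype.sum_equiv (Equiv.mulLeft s'⁻¹) _ _ fun h => ?_
  rw [TensorProduct.map_tmul]
  have hs' : (s' : G) = t⁻¹ * s * t := rfl
  have h1 : σ.rep s' (σ.rep (s'⁻¹ * h) (e.v₀ σ)) = σ.rep h (e.v₀ σ) := by
    rw [← Module.End.mul_apply, ← map_mul, mul_inv_cancel_left]
  have h2 : t * ((s'⁻¹ * h : MulAction.stabilizer G v) : G) = (s : G)⁻¹ * (t * h) := by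
    rw [Subgroup.coe_mul, Subgroup.coe_inv, hs']
    group
  change _ = _ ⊗ₜ (σ.rep s' (σ.rep (s'⁻¹ * h) (e.v₀ σ)))
  rw [h1]
  congr 1
  refine Subtype.ext ?_
  rw [coe_cut, coe_coeffOne, coe_unitMul, coeff_unit_mul]
  change _ = (s : G) • (idem a * x.1.coeff (t * ((s'⁻¹ * h : MulAction.stabilizer G v) : G)) *
    idem b)
  rw [h2, _root_.smul_mul', _root_.smul_mul', IsQuiverAction.smul_idem, IsQuiverAction.smul_idem,
    MulAction.mem_stabilizer_iff.1 s.2.1, MulAction.mem_stabilizer_iff.1 s.2.2]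

theorem component_unitMul_extendOne_of_ne {t' : G} {b' : V} (ht' : t' • v = b')
    (a' : V) {g : G} (hg : g • b' ≠ b) (τ : arrowSpace k a' b' ⊗[k] σ.Space) :
    component e σ t a b (unitMul k g (extendOne e σ a' ht' τ)) = 0 :=
  component_of_mem_coeffIn e σ a hg _ (unit_mul_mem_coeffIn g (extend_mem_coeffIn e σ a' ht' τ))

end

/-- The elements `z` of degree one with `p z = z = z q`. -/
def arrowCorner (p q : SkewPathAlgebra k V G) : Submodule k (SkewPathAlgebra k V G) where
  carrier := {z | z ∈ degOne k V G ∧ p * z = z ∧ z * q = z}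
  zero_mem' := ⟨zero_mem _, mul_zero _, zero_mul _⟩
  add_mem' := fun ⟨h1, h2, h3⟩ ⟨h1', h2', h3'⟩ =>
    ⟨add_mem h1 h1', by rw [mul_add, h2, h2'], by rw [add_mul, h3, h3']⟩
  smul_mem' := fun c _ ⟨h1, h2, h3⟩ =>
    ⟨Submodule.smul_mem _ c h1, by rw [mul_smul_comm, h2], by rw [smul_mul_assoc, h3]⟩

variable {D : OrbitData G V}
  {ε : ∀ u : D.T, Irr k (MulAction.stabilizer G (u : V)) →
    MonoidAlgebra k (MulAction.stabilizer G (u : V))}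
  (d : ∀ u : D.T, Irr.IdempotentData (ε u))
  (u : D.T) (ρ : Irr k (MulAction.stabilizer G (u : V)))
  (v : D.T) (σ : Irr k (MulAction.stabilizer G (v : V)))

variable (D) in
/-- The vector space `⨁_{(a, b) ∈ O_{uv}} Hom_{G_{ab}} (V_ρ, R_{ab} ⊗ V_σ)`. -/
abbrev OrbitHom : Type (max u v w) :=
  ∀ p : D.O u v, Representation.IntertwiningMap
    (transportRep D u ρ p.1.1 (D.O_subset _ _ p.2).1
      (MulAction.stabilizer G p.1.1 ⊓ MulAction.stabilizer G p.1.2) inf_le_left)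
    ((arrowRep k G p.1.1 p.1.2).tprod
      (transportRep D v σ p.1.2 (D.O_subset _ _ p.2).2
        (MulAction.stabilizer G p.1.1 ⊓ MulAction.stabilizer G p.1.2) inf_le_right))

theorem column_mul_mem_degOne (a : V) (m : ρ.Space) {z : SkewPathAlgebra k V G}
    (hz : z ∈ degOne k V G) : column d u ρ a m * z ∈ degOne k V G :=
  degZero_mul_mem_degOne (column_mem_degZero d u ρ a m) hz

/-- The map `m ↦ m z` from the left ideal generated by the idempotent of `ρ`. -/
def columnMul (a : V) {z : SkewPathAlgebra k V G} (hz : z ∈ degOne k V G) :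
    ρ.Space →ₗ[k] degOne k V G :=
  ((LinearMap.mulRight k z).comp (column d u ρ a)).codRestrict _ fun m =>
    column_mul_mem_degOne d u ρ a m hz

theorem coe_columnMul (a : V) {z : SkewPathAlgebra k V G} (hz : z ∈ degOne k V G) (m : ρ.Space) :
    (columnMul d u ρ a hz m).1 = column d u ρ a m * z := rfl

/-- The columns at `a` form a copy of $V_\rho$ on which $G_a$ acts through conjugation by $t_a$,
matching `transportRep`. -/
theorem column_rep {a : V} (h : MulAction.stabilizer G (u : V)) (m : ρ.Space) :
    column d u ρ a (ρ.rep h m) = unit k V (D.t a * h * (D.t a)⁻¹) * column d u ρ a m := by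
  rw [column_apply, column_apply, ← mul_assoc, ← unit_mul, inv_mul_cancel_right, unit_mul, mul_assoc,
    unit_mul_stabEmb, (d u).mul_ι, Irr.act_single]

/-- The intertwining map attached to an element of the corner. -/
def toOrbitHom : arrowCorner (stabEmb (u : V) (ε u ρ)) (stabEmb (v : V) (ε v σ)) →ₗ[k]
    OrbitHom D u ρ v σ where
  toFun z p := LinearMap.intertwiningMap_of_isIntertwiningMap _ _
    ((component (d v) σ (D.t p.1.2) p.1.1 p.1.2).comp (columnMul d u ρ p.1.1 z.2.1)) (by
      intro s m
      have hb := D.t_smul v v.2 p.1.2 (D.O_subset _ _ p.2).2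
      refine Eq.trans ?_ (component_unitMul (d v) σ p.1.1 hb s _)
      refine congrArg (component (d v) σ (D.t p.1.2) p.1.1 p.1.2) (Subtype.ext ?_)
      rw [coe_unitMul]
      refine (congrArg (· * z.1) (column_rep d u ρ (a := p.1.1) _ m)).trans ?_
      rw [coe_columnMul, ← mul_assoc]
      congr 3
      simp [conjStabilizer, mul_assoc])
  map_add' z z' := by
    funext p
    refine Representation.IntertwiningMap.ext (LinearMap.ext fun m => ?_)
    let P := component (d v) σ (D.t p.1.2) p.1.1 p.1.2
    have h : columnMul d u ρ p.1.1 (z + z').2.1 m =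
        columnMul d u ρ p.1.1 z.2.1 m + columnMul d u ρ p.1.1 z'.2.1 m := Subtype.ext (mul_add _ _ _)
    exact (congrArg P h).trans (map_add P _ _)
  map_smul' c z := by
    funext p
    refine Representation.IntertwiningMap.ext (LinearMap.ext fun m => ?_)
    let P := component (d v) σ (D.t p.1.2) p.1.1 p.1.2
    have h : columnMul d u ρ p.1.1 (c • z).2.1 m = c • columnMul d u ρ p.1.1 z.2.1 m :=
      Subtype.ext (mul_smul_comm _ _ _)
    exact (congrArg P h).trans (map_smul P _ _)

/-- The coefficient $z_g$ lies in $R_{u,gv}$, and $(u, gv)$ is a translate of a chosen pair $(a,b)$.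
The vanishing component at $(a,b)$, evaluated on a suitable vector, therefore forces $z_g = 0$. -/
theorem toOrbitHom_injective : Function.Injective (toOrbitHom d u ρ v σ) := by
  rw [injective_iff_map_eq_zero]
  rintro ⟨z, hz, hEz, hzE⟩ h0
  refine Subtype.ext (SkewMonoidAlgebra.coeff_injective (Finsupp.ext fun g => ?_))
  have hu : skewIdem k V G (u : V) * z = z := by
    rw [← hEz, ← mul_assoc, skewIdem_mul_stabEmb]
  obtain ⟨⟨a, b⟩, ⟨hab, ⟨g', hg'⟩⟩, -⟩ := D.existsUnique_O u v (u, g • (v : V))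
    ⟨MulAction.mem_orbit_self _, MulAction.mem_orbit _ _⟩
  have hga : g' • a = u := congrArg Prod.fst hg'
  have hgb : g' • b = g • (v : V) := congrArg Prod.snd hg'
  have ha := D.t_smul u u.2 a (D.O_subset _ _ hab).1
  have hb := D.t_smul v v.2 b (D.O_subset _ _ hab).2
  -- This choice gives $t_a h = g'^{-1}$, so the column of $h v_0$ multiplied by $z$ is $g'^{-1} z$.
  let h : MulAction.stabilizer G (u : V) := ⟨(D.t a)⁻¹ * g'⁻¹, by
    rw [MulAction.mem_stabilizer_iff, mul_smul, inv_smul_eq_iff.2 hga.symm, inv_smul_eq_iff.2 ha.symm]⟩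
  let x : degOne k V G := columnMul d u ρ a hz (ρ.rep h ((d u).v₀ ρ))
  have hx : x.1 = unit k V g'⁻¹ * z := by
    have h1 : unit k V (D.t a * (h : G) * (D.t a)⁻¹) * (unit k V (D.t a) * z) =
        unit k V g'⁻¹ * z := by
      rw [← mul_assoc, ← unit_mul]
      congr 2
      simp [h]
    rw [← h1]
    refine (congrArg (· * z) (column_rep d u ρ (a := a) h ((d u).v₀ ρ))).trans ?_
    rw [column_apply, (d u).ι_v₀, mul_assoc, mul_assoc (unit k V (D.t a)), hEz]
  have hxE : x.1 * stabEmb (v : V) (ε v σ) = x.1 := by rw [hx, mul_assoc, hzE]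
  have h1 : component (d v) σ (D.t b) a b x = 0 :=
    DFunLike.congr_fun (congrFun h0 ⟨(a, b), hab⟩) (ρ.rep h ((d u).v₀ ρ))
  have hcoeff : ∀ g₁, z.coeff g₁ ∈ arrowSpace k (u : V) (g₁ • (v : V)) := by
    intro g₁
    have h2 : z * skewIdem k V G (v : V) = z := by
      rw [← hzE, mul_assoc, stabEmb_mul_skewIdem]
    have h3 : z.coeff g₁ = idem (u : V) * z.coeff g₁ * idem (g₁ • (v : V)) := by
      conv_lhs => rw [← hu, ← h2]
      rw [skewIdem, skewIdem, ← mul_assoc, coeff_mul_single, inv_one, mul_one,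
        IsQuiverAction.smul_idem]
      congr 1
      exact coeff_ofPathAlgebra_mul _ _ _
    rw [h3]
    exact idem_mul_mul_idem_mem k V _ _ _ (hz g₁)
  have hx' : ∀ h' : MulAction.stabilizer G (v : V), x.1.coeff (D.t b * h') ∈ arrowSpace k a b := by
    intro h'
    rw [hx, coeff_unit_mul]
    have h2 := smul_mem_arrowSpace k g'⁻¹ (hcoeff (g'⁻¹⁻¹ * (D.t b * h')))
    rw [inv_inv] at h2 ⊢
    rwa [inv_smul_eq_iff.2 hga.symm, smul_smul, inv_mul_cancel_left, mul_smul,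
      MulAction.mem_stabilizer_iff.1 h'.2, hb] at h2
  -- The coefficient of $g'^{-1}z$ at $t_b h' = g'^{-1}g$ is $g'^{-1} z_g$, the one to be shown
  -- zero.
  let h' : MulAction.stabilizer G (v : V) := ⟨(D.t b)⁻¹ * (g'⁻¹ * g), by
    rw [MulAction.mem_stabilizer_iff, mul_smul, mul_smul, inv_smul_eq_iff.2 hgb.symm,
      inv_smul_eq_iff.2 hb.symm]⟩
  have h2 := coeff_extend_component (d v) σ a hb x hxE hx' h'
  have h3 : D.t b * (h' : G) = g'⁻¹ * g := mul_inv_cancel_left _ _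
  rw [h1, map_zero, h3, hx, coeff_unit_mul, inv_inv, mul_inv_cancel_left] at h2
  change z.coeff g = 0
  have h4 := congrArg (g' • ·) h2
  simpa using h4.symm

section Surjective

variable (φ : OrbitHom D u ρ v σ)

open scoped Classical in
/-- The number of elements of `G_u ≃ G_a` which fix `b`. -/
def fixCard (p : D.O u v) : ℕ :=
  have := Fintype.ofFinite (MulAction.stabilizer G (u : V))
  (Finset.univ.filter fun h : MulAction.stabilizer G (u : V) =>
    (D.t p.1.1 * h * (D.t p.1.1)⁻¹) • p.1.2 = p.1.2).card

theorem fixCard_ne_zero (p : D.O u v) : fixCard u v p ≠ 0 := by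
  refine Finset.card_ne_zero_of_mem (a := 1) ?_
  simp

/-- The equivariant map from `V_ρ` to the elements of degree one attached to a family of
intertwining maps. -/
def induce : ρ.Space →ₗ[k] degOne k V G :=
  have := Fintype.ofFinite (MulAction.stabilizer G (u : V))
  have := Fintype.ofFinite (D.O u v)
  ∑ p : D.O u v, (fixCard u v p : k)⁻¹ • ∑ h : MulAction.stabilizer G (u : V),
    (unitMul k ((h : G) * (D.t p.1.1)⁻¹)).comp
      ((extendOne (d v) σ p.1.1 (D.t_smul v v.2 p.1.2 (D.O_subset _ _ p.2).2)).comp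
        ((φ p).toLinearMap.comp (ρ.rep h⁻¹)))

theorem induce_apply [Fintype (MulAction.stabilizer G (u : V))] [Fintype (D.O u v)] (m : ρ.Space) :
    induce d u ρ v σ φ m = ∑ p : D.O u v, (fixCard u v p : k)⁻¹ •
      ∑ h : MulAction.stabilizer G (u : V), unitMul k ((h : G) * (D.t p.1.1)⁻¹)
        (extendOne (d v) σ p.1.1 (D.t_smul v v.2 p.1.2 (D.O_subset _ _ p.2).2)
          (φ p (ρ.rep h⁻¹ m))) := by
  rw [induce, LinearMap.sum_apply]
  refine Finset.sum_congr (by ext; simp) fun p _ => ?_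
  rw [LinearMap.smul_apply, LinearMap.sum_apply]
  congr 1
  exact Finset.sum_congr (by ext; simp) fun h _ => rfl

/-- Summing over the whole of $G_u$ makes the map equivariant: left translation reindexes the sum.
-/
theorem unitMul_induce (h : MulAction.stabilizer G (u : V)) (m : ρ.Space) :
    unitMul k (h : G) (induce d u ρ v σ φ m) = induce d u ρ v σ φ (ρ.rep h m) := by
  have := Fintype.ofFinite (MulAction.stabilizer G (u : V))
  have := Fintype.ofFinite (D.O u v)
  rw [induce_apply, induce_apply, map_sum]
  refine Finset.sum_congr rfl fun p _ => ?_
  rw [map_smul, map_sum]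
  congr 1
  refine Fintype.sum_equiv (Equiv.mulLeft h) _ _ fun h' => ?_
  rw [unitMul_unitMul, Equiv.coe_mulLeft, Subgroup.coe_mul, mul_assoc, mul_inv_rev,
    ← Module.End.mul_apply, ← map_mul, inv_mul_cancel_right]

theorem skewIdem_mul_induce (m : ρ.Space) :
    skewIdem k V G (u : V) * (induce d u ρ v σ φ m).1 = (induce d u ρ v σ φ m).1 := by
  have := Fintype.ofFinite (MulAction.stabilizer G (u : V))
  have := Fintype.ofFinite (D.O u v)
  rw [induce_apply]
  simp only [AddSubmonoidClass.coe_finsetSum, Submodule.coe_smul, Finset.mul_sum, mul_smul_comm]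
  refine Finset.sum_congr rfl fun p _ => ?_
  congr 1
  refine Finset.sum_congr rfl fun h _ => ?_
  have ha := D.t_smul u u.2 p.1.1 (D.O_subset _ _ p.2).1
  have h1 := unit_mul_skewIdem (k := k) ((h : G) * (D.t p.1.1)⁻¹) p.1.1
  have h2 : ((h : G) * (D.t p.1.1)⁻¹) • p.1.1 = u := by
    rw [mul_smul, inv_smul_eq_iff.2 ha.symm, MulAction.mem_stabilizer_iff.1 h.2]
  rw [h2] at h1
  rw [coe_unitMul, ← mul_assoc, ← h1, mul_assoc]
  congr 1
  exact skewIdem_mul_extend _ _ _ _ _ _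

theorem induce_mul (m : ρ.Space) :
    (induce d u ρ v σ φ m).1 * stabEmb (v : V) (ε v σ) = (induce d u ρ v σ φ m).1 := by
  have := Fintype.ofFinite (MulAction.stabilizer G (u : V))
  have := Fintype.ofFinite (D.O u v)
  rw [induce_apply]
  simp only [AddSubmonoidClass.coe_finsetSum, Submodule.coe_smul, Finset.sum_mul, smul_mul_assoc]
  refine Finset.sum_congr rfl fun p _ => ?_
  congr 1
  refine Finset.sum_congr rfl fun h _ => ?_
  rw [coe_unitMul, mul_assoc]
  congr 1
  exact extend_mul _ _ _ _ _ _

theorem stabEmb_mul_induce (c : MonoidAlgebra k (MulAction.stabilizer G (u : V))) (m : ρ.Space) :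
    stabEmb (u : V) c * (induce d u ρ v σ φ m).1 = (induce d u ρ v σ φ (ρ.act c m)).1 := by
  induction c using MonoidAlgebra.induction_linear with
  | zero => simp
  | add a b ha hb =>
    rw [map_add, add_mul, ha, hb, map_add, LinearMap.add_apply, map_add, Submodule.coe_add]
  | single h r =>
    have h1 : (MonoidAlgebra.single h r : MonoidAlgebra k (MulAction.stabilizer G (u : V))) =
        r • MonoidAlgebra.single h 1 := by rw [MonoidAlgebra.smul_single, smul_eq_mul, mul_one]
    have h2 := congrArg Subtype.val (unitMul_induce d u ρ v σ φ h m)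
    rw [coe_unitMul] at h2
    rw [h1, map_smul, map_smul, LinearMap.smul_apply, map_smul, Irr.act_single, smul_mul_assoc,
      stabEmb_single, one_smul, Submodule.coe_smul, mul_assoc, h2, skewIdem_mul_induce]

variable [CharZero k]

/-- At the pair $p = (a,b)$ the term of $h$ survives only if $t_a h t_a^{-1}$ fixes $b$. It then
lies in $G_{ab}$, and the intertwining property makes the term equal to $\varphi_p(m)$. There are
`fixCard u v p` such terms, and this is the factor divided out, which is possible in characteristic
zero. -/
theorem component_unitMul_induce (p : D.O u v) (m : ρ.Space) :
    component (d v) σ (D.t p.1.2) p.1.1 p.1.2 (unitMul k (D.t p.1.1) (induce d u ρ v σ φ m)) =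
      φ p m := by
  classical
  have := Fintype.ofFinite (MulAction.stabilizer G (u : V))
  have := Fintype.ofFinite (D.O u v)
  have hb := D.t_smul v v.2 p.1.2 (D.O_subset _ _ p.2).2
  rw [induce_apply, map_sum, map_sum, Finset.sum_eq_single p]
  · rw [map_smul, map_smul, map_sum, map_sum, inv_smul_eq_iff₀ (by exact_mod_cast fixCard_ne_zero u v p)]
    have h1 : ∀ h : MulAction.stabilizer G (u : V),
        component (d v) σ (D.t p.1.2) p.1.1 p.1.2 (unitMul k (D.t p.1.1)
          (unitMul k ((h : G) * (D.t p.1.1)⁻¹) (extendOne (d v) σ p.1.1 hb (φ p (ρ.rep h⁻¹ m))))) =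
        if (D.t p.1.1 * h * (D.t p.1.1)⁻¹) • p.1.2 = p.1.2 then φ p m else 0 := by
      intro h
      rw [unitMul_unitMul, ← mul_assoc]
      split_ifs with hh
      · have ha := D.t_smul u u.2 p.1.1 (D.O_subset _ _ p.2).1
        have ha' : (D.t p.1.1 * h * (D.t p.1.1)⁻¹) • p.1.1 = p.1.1 := by
          rw [mul_smul, mul_smul, inv_smul_eq_iff.2 ha.symm, MulAction.mem_stabilizer_iff.1 h.2, ha]
        let s : ↥(MulAction.stabilizer G p.1.1 ⊓ MulAction.stabilizer G p.1.2) :=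
          ⟨D.t p.1.1 * h * (D.t p.1.1)⁻¹, ha', hh⟩
        refine (component_unitMul (d v) σ p.1.1 hb s _).trans ?_
        rw [component_extendOne]
        refine ((φ p).isIntertwining _ _ s _).symm.trans ?_
        congr 1
        have hs : conjStabilizer (D.t p.1.1) ha _ inf_le_left s = h := by
          refine Subtype.ext ?_
          change (D.t p.1.1)⁻¹ * (D.t p.1.1 * h * (D.t p.1.1)⁻¹) * D.t p.1.1 = h
          group
        change ρ.rep (conjStabilizer (D.t p.1.1) ha _ inf_le_left s) _ = _
        rw [hs, ← Module.End.mul_apply, ← map_mul, mul_inv_cancel, map_one, Module.End.one_apply]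
      · exact component_unitMul_extendOne_of_ne _ _ _ _ _ hh _
    rw [Finset.sum_congr rfl fun h _ => h1 h, ← Finset.sum_filter, Finset.sum_const, fixCard,
      Nat.cast_smul_eq_nsmul]
    congr 1
    refine congrArg Finset.card ?_
    ext
    simp
  · intro q _ hq
    rw [map_smul, map_smul, map_sum, map_sum, Finset.sum_eq_zero, smul_zero]
    intro h _
    rw [unitMul_unitMul]
    -- A nonzero contribution from another pair `q` would need a group element carrying `q` to `p`,
    -- contradicting the choice of one representative per orbit.
    refine component_unitMul_extendOne_of_ne _ _ _ _ _ (fun hh => hq ?_) _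
    have ha := D.t_smul u u.2 p.1.1 (D.O_subset _ _ p.2).1
    have ha' := D.t_smul u u.2 q.1.1 (D.O_subset _ _ q.2).1
    have h2 : (D.t p.1.1 * ((h : G) * (D.t q.1.1)⁻¹)) • q.1.1 = p.1.1 := by
      rw [mul_smul, mul_smul, inv_smul_eq_iff.2 ha'.symm, MulAction.mem_stabilizer_iff.1 h.2, ha]
    obtain ⟨r, -, hr⟩ := D.existsUnique_O u v p.1 (D.O_subset _ _ p.2)
    exact Subtype.ext ((hr q.1 ⟨q.2, ⟨_, Prod.ext h2 hh⟩⟩).trans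
      (hr p.1 ⟨p.2, MulAction.mem_orbit_self _⟩).symm)
  · simp

/-- The preimage is the value of the induced equivariant map at $v_0$, the vector which corresponds
to the idempotent of `ρ`. -/
theorem toOrbitHom_surjective : Function.Surjective (toOrbitHom d u ρ v σ) := by
  intro φ
  refine ⟨⟨(induce d u ρ v σ φ ((d u).v₀ ρ)).1, (induce d u ρ v σ φ ((d u).v₀ ρ)).2, ?_,
    induce_mul d u ρ v σ φ _⟩, ?_⟩
  · rw [stabEmb_mul_induce, ← (d u).ι_v₀, (d u).act_ι]
  · funext p
    refine Representation.IntertwiningMap.ext (LinearMap.ext fun m => ?_)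
    refine Eq.trans ?_ (component_unitMul_induce d u ρ v σ φ p m)
    refine congrArg (component (d v) σ (D.t p.1.2) p.1.1 p.1.2) (Subtype.ext ?_)
    rw [coe_unitMul, coe_columnMul, column_apply, mul_assoc, stabEmb_mul_induce, (d u).act_ι]

/-- The elements of degree one in a corner of the skew group algebra correspond to the
intertwining maps whose bases are the arrows of `Q_G`. -/
def orbitHomEquiv : arrowCorner (stabEmb (u : V) (ε u ρ)) (stabEmb (v : V) (ε v σ)) ≃ₗ[k]
    OrbitHom D u ρ v σ :=
  LinearEquiv.ofBijective (toOrbitHom d u ρ v σ)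
    ⟨toOrbitHom_injective d u ρ v σ, toOrbitHom_surjective d u ρ v σ⟩

end Surjective

end SkewPathAlgebra

/-! ### The corner is the path algebra of $Q_G$, and the map $r$ -/

theorem MatrixSystem.linearIndependent_of_corners {k R X I : Type*} {A : X → X → Type*} [Field k]
    [Ring R] [Algebra k R] [Fintype I] (S : MatrixSystem R X I) {b : (Σ x y : X, A x y) → R}
    (hbl : ∀ f, S.E f.1 * b f = b f) (hbr : ∀ f, b f * S.E f.2.1 = b f)
    (hb : ∀ x y, LinearIndependent k fun f : A x y => b ⟨x, y, f⟩) : LinearIndependent k b := by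
  classical
  rw [linearIndependent_iff']
  rintro s g hg ⟨x, y, f⟩ hf
  have hinj : Function.Injective fun f : A x y => (⟨x, y, f⟩ : Σ x y : X, A x y) := by
    intro f f' h
    simpa using h
  -- Multiplying by `S.E x` and `S.E y` keeps only the terms indexed by arrows from `x` to `y`.
  have h1 := congrArg (fun r => S.E x * r * S.E y) hg
  simp only [mul_zero, zero_mul, Finset.mul_sum, Finset.sum_mul, mul_smul_comm,
    smul_mul_assoc] at h1
  rw [← Finset.sum_preimage (fun f : A x y => (⟨x, y, f⟩ : Σ x y : X, A x y)) s hinj.injOn] at h1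
  · have h2 := linearIndependent_iff'.1 (hb x y) (s.preimage _ hinj.injOn)
      (fun f => g ⟨x, y, f⟩) ?_ f (by simpa using hf)
    · exact h2
    · rw [← h1]
      refine Finset.sum_congr rfl fun f _ => ?_
      rw [hbl ⟨x, y, f⟩, hbr ⟨x, y, f⟩]
  · rintro ⟨x', y', f'⟩ _ hr
    by_cases hx : x = x'
    · subst hx
      by_cases hy : y' = y
      · subst hy
        exact absurd ⟨f', rfl⟩ hr
      · rw [← hbr, mul_assoc, mul_assoc, S.E_mul_of_ne _ _ hy, mul_zero, mul_zero, smul_zero]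
    · rw [← hbl, ← mul_assoc, S.E_mul_of_ne _ _ hx, zero_mul, zero_mul, smul_zero]

namespace SkewPathAlgebra

open PathAlgebra

variable {k : Type u} {V : Type v} {G : Type z} [Field k] [CharZero k] [Quiver.{w} V] [Fintype V]
  [Group G] [MulSemiringAction G (PathAlgebra k V)] [MulAction G V]
  [SMulCommClass G k (PathAlgebra k V)] [IsQuiverAction k V G] [Finite G] {D : OrbitData G V}
  {ε : ∀ u : D.T, Irr k (MulAction.stabilizer G (u : V)) →
    MonoidAlgebra k (MulAction.stabilizer G (u : V))}
  (d : ∀ u : D.T, Irr.IdempotentData (ε u))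

/-- The basis of a corner given by the arrows of `Q_G`. -/
def arrowBasis (x y : SkewVertex k D) :
    Module.Basis (x ⟶ y) k (arrowCorner ((matrixSystem d).E x) ((matrixSystem d).E y)) :=
  (Module.Basis.ofVectorSpace k (ArrowHom D x y)).map (orbitHomEquiv d x.1 x.2 y.1 y.2).symm

/-- The corner of the skew group algebra at the idempotent `e` is the path algebra of `Q_G`. -/
theorem exists_pathAlgebra_equiv {e : SkewPathAlgebra k V G} (hMe : e = (matrixSystem d).e)
    (he : IsIdempotentElem e) :
    ∃ Φ : PathAlgebra k (SkewVertex k D) ≃+* he.Corner, (∀ (c : k) p, Φ (c • p) = c • Φ p) ∧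
      ∀ x, (Φ (PathAlgebra.idem x)).1 = (matrixSystem d).E x := by
  classical
  let b : (Σ x y : SkewVertex k D, x ⟶ y) → SkewPathAlgebra k V G :=
    fun f => (arrowBasis d f.1 f.2.1 f.2.2).1
  have hbl f : (matrixSystem d).E f.1 * b f = b f := (arrowBasis d f.1 f.2.1 f.2.2).2.2.1
  have hbr f : b f * (matrixSystem d).E f.2.1 = b f := (arrowBasis d f.1 f.2.1 f.2.2).2.2.2
  refine (matrixSystem d).exists_corner_equiv (degZero k V G) (degOne k V G)
    (fun x hx y hy => mul_mem_degZero hx hy) (fun x hx y hy => degZero_mul_mem_degOne hx hy)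
    (fun x hx y hy => mul_degZero_mem_degOne hx hy) mem_of_mul_mem
    (fun f₀ f₁ => exists_lift (T := Matrix (MatrixIndex k D) (MatrixIndex k D)
      (PathAlgebra k (SkewVertex k D))) f₀ f₁)
    (fun x => stabEmb_mem_degZero _ _) (fun i => column_mem_degZero d _ _ _ _)
    (fun i => row_mem_degZero d _ _ _ _) (fun w hw x y => mul_mul_mem_span d hw x y)
    (linearIndependent_E d) b ?_ (fun f => (arrowBasis d f.1 f.2.1 f.2.2).2.1) hbl hbr ?_ hMe he
  · refine (matrixSystem d).linearIndependent_of_corners hbl hbr fun x y => ?_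
    exact (arrowBasis d x y).linearIndependent.map' (Submodule.subtype _) (Submodule.ker_subtype _)
  · intro w hw x y
    -- The degree-one part between `x` and `y` is all of `arrowCorner`, of which the arrows of $Q_G$
    -- give a basis.
    have h1 : (matrixSystem d).E x * w * (matrixSystem d).E y ∈
        arrowCorner ((matrixSystem d).E x) ((matrixSystem d).E y) := by
      refine ⟨mul_degZero_mem_degOne (degZero_mul_mem_degOne (stabEmb_mem_degZero _ _) hw)
        (stabEmb_mem_degZero _ _), ?_, ?_⟩
      · rw [← mul_assoc, ← mul_assoc, (matrixSystem d).E_mul_self]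
      · rw [mul_assoc, (matrixSystem d).E_mul_self]
    have h2 := (arrowBasis d x y).mem_span ⟨_, h1⟩
    have h3 := Submodule.mem_map_of_mem (f := Submodule.subtype _) h2
    rw [Submodule.map_span] at h3
    refine Submodule.span_mono ?_ h3
    rintro _ ⟨_, ⟨f, rfl⟩, rfl⟩
    exact ⟨⟨x, y, f⟩, rfl⟩

/-- A vertex `(u, ρ)` of $Q_G$ contributes $\dim V_\rho$ indices lying at `a` when `a` is in $O_u$,
and none otherwise. -/
theorem rMap_eq_sum [DecidableEq V] (β : SkewVertex k D → ℕ) (a : V) :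
    rMap D (fun x => (β x : ℤ)) a = (∑ i : MatrixIndex k D with (i.2.1 : V) = a, β i.1 : ℕ) := by
  classical
  have (x : SkewVertex k D) : Fintype (MulAction.orbit G (x.1 : V)) := Fintype.ofFinite _
  have h1 : (∑ i : MatrixIndex k D with (i.2.1 : V) = a, β i.1) = ∑ x : SkewVertex k D,
      ∑ o : MulAction.orbit G (x.1 : V), ∑ j : Fin x.2.dim, if (o : V) = a then β x else 0 := by
    rw [Finset.sum_filter]
    simp only [← Fintype.sum_prod_type']
    rw [← Fintype.sum_sigma']
    exact Finset.sum_congr (by ext; simp) fun _ _ => rfl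
  rw [h1, rMap, LinearMap.sum_apply, Finset.sum_apply, Nat.cast_sum]
  refine Finset.sum_congr rfl fun x _ => ?_
  rw [LinearMap.smulRight_apply, Pi.smul_apply, LinearMap.proj_apply]
  split_ifs with h
  · rw [Finset.sum_eq_single ⟨a, h⟩]
    · simp [mul_comm]
    · intro o _ ho
      simp only [if_neg fun h' => ho (Subtype.ext h'), Finset.sum_const_zero]
    · simp
  · rw [smul_zero, Finset.sum_eq_zero, Nat.cast_zero]
    intro o _
    simp only [if_neg fun h' : (o : V) = a => h (h' ▸ o.2), Finset.sum_const_zero]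

/-- This is `dimVector_eq_sum` for the matrix units, each column starting in the idempotent of its
vertex `a`. It yields both parts of the theorem. -/
theorem rMap_dimVector (M : Type*) [AddCommGroup M] [Module k M] [Module (SkewPathAlgebra k V G) M]
    [IsScalarTower k (SkewPathAlgebra k V G) M] [FiniteDimensional k M] :
    rMap D (fun x => (dimVector k (matrixSystem d).E M x : ℤ)) =
      fun a => (dimVector k (skewIdem k V G) M a : ℤ) := by
  classical
  funext a
  rw [rMap_eq_sum, (matrixSystem d).dimVector_eq_sum (skewIdem k V G) (fun i => (i.2.1 : V))
    skewIdem_mul_self]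
  · rfl
  · exact fun i => skewIdem_mul_column d i.1.1 i.1.2 i.2.1 _
  · intro i b hb
    refine (congrArg _ (skewIdem_mul_column d i.1.1 i.1.2 i.2.1 _).symm).trans ?_
    rw [← mul_assoc, skewIdem_mul_of_ne hb, zero_mul]

end SkewPathAlgebra

/-! ### The equivalence between modules over an algebra and over its corner -/

section CornerPart

variable {k : Type u} {R : Type v} [Field k] [Ring R] [Algebra k R] {e : R}
  (he : IsIdempotentElem e)

theorem mul_corner (τ : he.Corner) : e * τ.1 = τ.1 := ((Subsemigroup.mem_corner_iff he).1 τ.2).1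

variable (M : Type w) [AddCommGroup M] [Module k M] [Module R M] [IsScalarTower k R M]

/-- The part `e M` of a module. -/
def CornerPart (_ : IsIdempotentElem e) : Submodule k M :=
  LinearMap.ker (Algebra.lsmul k k M e - LinearMap.id)

variable {M} in
theorem mem_cornerPart {m : M} : m ∈ CornerPart (k := k) M he ↔ e • m = m := by
  rw [CornerPart, LinearMap.mem_ker, LinearMap.sub_apply, Algebra.lsmul_coe, LinearMap.id_apply,
    sub_eq_zero]

instance : Module he.Corner (CornerPart (k := k) M he) where
  smul τ m := ⟨τ.1 • m.1, by rw [mem_cornerPart, ← mul_smul, mul_corner]⟩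
  one_smul m := Subtype.ext ((mem_cornerPart (k := k) he).1 m.2)
  mul_smul a b m := Subtype.ext (mul_smul a.1 b.1 m.1)
  smul_zero a := Subtype.ext (smul_zero a.1)
  smul_add a x y := Subtype.ext (smul_add a.1 x.1 y.1)
  add_smul a b x := Subtype.ext (add_smul a.1 b.1 x.1)
  zero_smul x := Subtype.ext (zero_smul R x.1)

theorem CornerPart.coe_smul (τ : he.Corner) (m : CornerPart (k := k) M he) :
    ((τ • m : CornerPart (k := k) M he) : M) = τ.1 • (m : M) := rfl

instance : IsScalarTower k he.Corner (CornerPart (k := k) M he) where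
  smul_assoc c τ m := Subtype.ext (smul_assoc c τ.1 m.1)

end CornerPart

theorem isScalarTower_compHom {k A B N : Type*} [Field k] [Ring A] [Algebra k A] [Ring B]
    [Algebra k B] [AddCommGroup N] [Module k N] [Module B N] [IsScalarTower k B N] (φ : A →+* B)
    (hφ : ∀ (c : k) a, φ (c • a) = c • φ a) :
    letI := Module.compHom N φ
    IsScalarTower k A N := by
  let := Module.compHom N φ
  refine ⟨fun c a n => ?_⟩
  change φ (c • a) • n = c • φ a • n
  rw [hφ, smul_assoc]

namespace MatrixSystem

variable {k : Type u} {R : Type v} {X : Type w} {I : Type*} [Field k] [Ring R] [Algebra k R]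
  [Fintype X] [Fintype I] (S : MatrixSystem R X I) {e : R} (he : IsIdempotentElem e)

theorem mul_E (hSe : e = S.e) (x : X) : e * S.E x = S.E x := by rw [hSe, S.e_mul_E]

theorem E_mul (hSe : e = S.e) (x : X) : S.E x * e = S.E x := by rw [hSe, S.E_mul_e]

theorem coe_toCorner_E (hSe : e = S.e) (x : X) : (toCorner he (S.E x)).1 = S.E x := by
  change e * S.E x * e = _
  rw [S.mul_E hSe, S.E_mul hSe]

variable (N : Type z) [AddCommGroup N] [Module k N] [Module he.Corner N]
  [IsScalarTower k he.Corner N]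

theorem exists_embed_eq (hSe : e = S.e) {x : X} {f : CornerHom he N} (hf : S.E x • f = f) :
    ∃ n, CornerHom.embed (k := k) he N n = f := by
  rw [← CornerHom.smul_eq_self_iff, ← hf, ← mul_smul, S.mul_E hSe]

/-- Each subspace cut out by an idempotent `S.E x` lies in the image of `N`, and finitely many of
them determine the module. -/
theorem finiteDimensional_cornerHom (hSe : e = S.e) [FiniteDimensional k N] :
    FiniteDimensional k (CornerHom he N) := by
  refine S.finiteDimensional_of_range fun x => ?_
  refine Submodule.finiteDimensional_of_le
    (S₂ := LinearMap.range (CornerHom.embed (k := k) he N)) fun f hf => ?_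
  exact S.exists_embed_eq he N hSe ((mem_range_lsmul_iff (S.E_mul_self x) f).1 hf)

theorem dimVector_cornerHom (hSe : e = S.e) :
    dimVector k S.E (CornerHom he N) = dimVector k (fun x => toCorner he (S.E x)) N := by
  funext x
  refine (dimVector_eq_of_injective (CornerHom.embed (k := k) he N)
    (CornerHom.embed_injective he N) S.E _ S.E_mul_self (fun x n => ?_) x
    fun f hf => S.exists_embed_eq he N hSe hf).symm
  rw [CornerHom.embed_smul, S.coe_toCorner_E he hSe]

variable (k) in
/-- The modules `N` and `Hom_{eRe} (eR, N)` have the same submodules. -/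
def cornerHomOrderIso (hSe : e = S.e) :
    Submodule R (CornerHom he N) ≃o Submodule he.Corner N :=
  S.submoduleOrderIso (CornerHom.embed (k := k) he N).toAddMonoidHom
    (CornerHom.embed_injective (k := k) he N)
    (fun f => by rw [← hSe]; exact CornerHom.smul_eq_self_iff (k := k) he N f)
    (fun τ => ⟨τ.1, fun n => CornerHom.embed_smul (k := k) he N τ n⟩)
    (fun r => ⟨toCorner he r, fun n => by
      have h := (CornerHom.smul_eq_self_iff (k := k) he N _).2 ⟨n, rfl⟩
      refine (CornerHom.embed_smul (k := k) he N (toCorner he r) n).trans ?_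
      change (e * r * e) • CornerHom.embed (k := k) he N n =
        S.e • r • CornerHom.embed (k := k) he N n
      rw [mul_smul, h, mul_smul, ← hSe]⟩)

variable (M : Type z) [AddCommGroup M] [Module k M] [Module R M] [IsScalarTower k R M]

theorem dimVector_cornerPart (hSe : e = S.e) :
    dimVector k (fun x => toCorner he (S.E x)) (CornerPart (k := k) M he) = dimVector k S.E M := by
  funext x
  refine dimVector_eq_of_injective (Submodule.subtype _) (Submodule.injective_subtype _) S.E _
    S.E_mul_self (fun x n => ?_) x fun m hm => ?_
  · exact congrArg (· • (n : M)) (S.coe_toCorner_E he hSe x)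
  · refine ⟨⟨m, ?_⟩, rfl⟩
    rw [mem_cornerPart, ← hm, ← mul_smul, S.mul_E hSe]

/-- The modules `M` and `e M` have the same submodules. -/
def cornerPartOrderIso (hSe : e = S.e) :
    Submodule R M ≃o Submodule he.Corner (CornerPart (k := k) M he) :=
  S.submoduleOrderIso (Submodule.subtype (CornerPart (k := k) M he)).toAddMonoidHom
    (Submodule.injective_subtype _)
    (fun m => by
      rw [← hSe, ← mem_cornerPart (k := k) he]
      exact ⟨fun h => ⟨⟨m, h⟩, rfl⟩, fun ⟨n, hn⟩ => hn ▸ n.2⟩)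
    (fun τ => ⟨τ.1, fun n => rfl⟩)
    (fun r => ⟨toCorner he r, fun n => by
      change (e * r * e) • (n : M) = S.e • r • (n : M)
      rw [mul_smul, (mem_cornerPart (k := k) he).1 n.2, mul_smul, ← hSe]⟩)

end MatrixSystem

/-- Modules over isomorphic algebras have the same submodules. -/
def compHomOrderIso {A B N : Type*} [Ring A] [Ring B] [AddCommGroup N] [Module B N] (φ : A ≃+* B) :
    letI := Module.compHom N φ.toRingHom
    Submodule A N ≃o Submodule B N :=
  letI := Module.compHom N φ.toRingHom
  Equiv.toOrderIso
    { toFun := fun K =>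
        { K.toAddSubmonoid with
          smul_mem' := fun b n hn => by
            have h : φ.symm b • n ∈ K := K.smul_mem _ hn
            change φ (φ.symm b) • n ∈ K at h
            rwa [φ.apply_symm_apply] at h }
      invFun := fun K =>
        { K.toAddSubmonoid with smul_mem' := fun a n hn => K.smul_mem (φ a) hn }
      left_inv := fun _ => rfl
      right_inv := fun _ => rfl } (fun _ _ h => h) (fun _ _ h => h)

/-- Representations of finite dimension can be moved to coordinate spaces. -/
theorem exists_coordinate_module {k : Type u} {R : Type v} {X : Type w} [Field k] [Ring R]
    [Algebra k R] (M : Type z) [AddCommGroup M] [Module k M] [Module R M] [IsScalarTower k R M]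
    [FiniteDimensional k M] (h : IsIndecomposableModule R M) (ε : X → R)
    (hε : ∀ x, ε x * ε x = ε x) :
    ∃ (M' : Type u) (_ : AddCommGroup M') (_ : Module k M') (_ : Module R M')
      (_ : IsScalarTower k R M'), FiniteDimensional k M' ∧ IsIndecomposableModule R M' ∧
      dimVector k ε M' = dimVector k ε M := by
  let b : (Fin (Module.finrank k M) → k) ≃ₗ[k] M := (Module.finBasis k M).equivFun.symm
  let := b.toAddEquiv.module R
  have := b.isScalarTower R
  let b' : (Fin (Module.finrank k M) → k) ≃ₗ[R] M := b.toAddEquiv.linearEquiv R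
  refine ⟨Fin (Module.finrank k M) → k, inferInstance, inferInstance, inferInstance, inferInstance,
    inferInstance, (isIndecomposableModule_iff_of_orderIso
      (Submodule.orderIsoMapComap b')).2 h, ?_⟩
  funext x
  exact dimVector_eq_of_injective b.toLinearMap b.injective ε ε hε (fun x n => b'.map_smul (ε x) n)
    x fun m _ => ⟨b.symm m, b.apply_symm_apply m⟩

/-! ### Roots of $Q_G$ and $G$-roots of $Q$ -/

section Final

open SkewPathAlgebra

variable {k : Type u} {V : Type v} {G : Type z} [Field k] [CharZero k] [Quiver.{w} V] [Fintype V]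
  [Group G] [MulSemiringAction G (PathAlgebra k V)] [MulAction G V]
  [SMulCommClass G k (PathAlgebra k V)] [IsQuiverAction k V G] [Finite G] {D : OrbitData G V}
  {ε : ∀ u : D.T, Irr k (MulAction.stabilizer G (u : V)) →
    MonoidAlgebra k (MulAction.stabilizer G (u : V))}
  (d : ∀ u : D.T, Irr.IdempotentData (ε u))

include d

/-- The representation of $Q_G$ is $eM$, with the path algebra acting through its isomorphism with
the corner. -/
theorem IsGRoot.exists_isQuiverRoot {α : V → ℕ} (h : IsGRoot k V G α) :
    ∃ β : SkewVertex k D → ℕ, IsQuiverRoot k (SkewVertex k D) β ∧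
      rMap D (fun x => (β x : ℤ)) = fun a => (α a : ℤ) := by
  obtain ⟨M, _, _, _, _, hfin, hM, rfl⟩ := h
  have he := (matrixSystem d).isIdempotentElem_e
  obtain ⟨Φ, hΦ, hΦE⟩ := exists_pathAlgebra_equiv d rfl he
  refine ⟨dimVector k (matrixSystem d).E M, ?_, rMap_dimVector d M⟩
  let N := CornerPart (k := k) M he
  let := Module.compHom N Φ.toRingHom
  have := isScalarTower_compHom (N := N) Φ.toRingHom hΦ
  refine ⟨N, inferInstance, inferInstance, inferInstance, inferInstance, inferInstance, ?_, ?_⟩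
  · rw [isIndecomposableModule_iff_of_orderIso (compHomOrderIso Φ),
      ← isIndecomposableModule_iff_of_orderIso ((matrixSystem d).cornerPartOrderIso he M rfl)]
    exact hM
  · rw [← (matrixSystem d).dimVector_cornerPart he M rfl]
    funext x
    refine dimVector_eq_of_injective (LinearMap.id : N →ₗ[k] N) Function.injective_id
      (fun x => toCorner he ((matrixSystem d).E x)) _ (fun x => ?_) (fun x n => ?_) x
      fun m _ => ⟨m, rfl⟩
    · refine Subtype.ext ?_
      change (toCorner he ((matrixSystem d).E x)).1 * (toCorner he ((matrixSystem d).E x)).1 = _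
      rw [(matrixSystem d).coe_toCorner_E he rfl, (matrixSystem d).E_mul_self]
    · change Φ (PathAlgebra.idem x) • n = _
      congr 1
      refine Subtype.ext ?_
      rw [hΦE, (matrixSystem d).coe_toCorner_E he rfl]

/-- The $AG$-module is the coinduced module $\operatorname{Hom}_{e(AG)e}(eAG, N)$. -/
theorem IsQuiverRoot.exists_isGRoot {β : SkewVertex k D → ℕ}
    (h : IsQuiverRoot k (SkewVertex k D) β) : ∃ α : V → ℕ, IsGRoot k V G α ∧
      rMap D (fun x => (β x : ℤ)) = fun a => (α a : ℤ) := by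
  obtain ⟨N, _, _, _, _, hfin, hN, rfl⟩ := h
  have he := (matrixSystem d).isIdempotentElem_e
  obtain ⟨Φ, hΦ, hΦE⟩ := exists_pathAlgebra_equiv d rfl he
  have hΦ' (c : k) (τ : he.Corner) : Φ.symm (c • τ) = c • Φ.symm τ := by
    rw [RingEquiv.symm_apply_eq, hΦ, Φ.apply_symm_apply]
  let := Module.compHom N Φ.symm.toRingHom
  have := isScalarTower_compHom (N := N) Φ.symm.toRingHom hΦ'
  have := (matrixSystem d).finiteDimensional_cornerHom (k := k) he N rfl
  have h1 : IsIndecomposableModule he.Corner N :=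
    (isIndecomposableModule_iff_of_orderIso (compHomOrderIso Φ.symm)).2 hN
  have h2 : IsIndecomposableModule (SkewPathAlgebra k V G) (CornerHom he N) :=
    (isIndecomposableModule_iff_of_orderIso
      ((matrixSystem d).cornerHomOrderIso k he N rfl)).2 h1
  -- The coinduced module may live in a larger universe than `IsGRoot` allows; being
  -- finite-dimensional, it moves to a coordinate space.
  obtain ⟨M, i₁, i₂, i₃, i₄, hM, hM', hdim⟩ := exists_coordinate_module (k := k) _ h2 (skewIdem k V G)
    skewIdem_mul_self
  refine ⟨_, ⟨M, i₁, i₂, i₃, i₄, hM, hM', rfl⟩, ?_⟩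
  rw [hdim, ← rMap_dimVector d, (matrixSystem d).dimVector_cornerHom he N rfl]
  congr 1
  funext x
  congr 1
  refine dimVector_eq_of_injective (LinearMap.id : N →ₗ[k] N) Function.injective_id
    (fun x => toCorner he ((matrixSystem d).E x)) _ (fun x => ?_) (fun x n => ?_) x
    fun m _ => ⟨m, rfl⟩
  · refine Subtype.ext ?_
    change (toCorner he ((matrixSystem d).E x)).1 * (toCorner he ((matrixSystem d).E x)).1 = _
    rw [(matrixSystem d).coe_toCorner_E he rfl, (matrixSystem d).E_mul_self]
  · have h : Φ.symm (toCorner he ((matrixSystem d).E x)) = PathAlgebra.idem x := by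
      rw [RingEquiv.symm_apply_eq]
      refine Subtype.ext ?_
      rw [hΦE, (matrixSystem d).coe_toCorner_E he rfl]
    exact congrArg (· • n) h.symm

end Final

end

theorem mainTheorem9 {k : Type u} {V : Type v} {G : Type z} [Field k] [CharZero k]
    [Quiver.{w} V] [Fintype V] [∀ a b : V, Finite (a ⟶ b)] [Group G] [Finite G]
    [MulSemiringAction G (PathAlgebra k V)] [SMulCommClass G k (PathAlgebra k V)] [MulAction G V]
    [IsQuiverAction k V G] (D : OrbitData G V)
    (hsplit : ∀ (a : V) (ρ : Irr k (MulAction.stabilizer G a)),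
      Module.finrank k (Representation.IntertwiningMap ρ.rep ρ.rep) = 1) :
    (∀ ε : ∀ x : SkewVertex k D, MonoidAlgebra k (MulAction.stabilizer G (x.1 : V)),
      IsPrimitiveIdempotentFamily k D ε →
      ∃ he : IsIdempotentElem (∑ x, stabilizerEmb (x.1 : V) (ε x) : SkewPathAlgebra k V G),
        ∀ (N : Type u) [AddCommGroup N] [Module k N] [Module he.Corner N]
          [IsScalarTower k he.Corner N] [FiniteDimensional k N],
          rMap D (fun x =>
              (dimVector k (fun x => toCorner he (stabilizerEmb (x.1 : V) (ε x))) N x : ℤ)) =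
            fun a => (dimVector k (skewIdem k V G) (CornerHom he N) a : ℤ)) ∧
    ∀ α : V → ℕ,
      IsGRoot k V G α ↔
        ∃ β : SkewVertex k D → ℕ, IsQuiverRoot k (SkewVertex k D) β ∧
          rMap D (fun x => (β x : ℤ)) = fun a => (α a : ℤ) := by
  constructor
  · intro ε hε
    have d (u : D.T) : Irr.IdempotentData fun ρ => ε ⟨u, ρ⟩ :=
      (Irr.nonempty_idempotentData (hsplit u) _ fun ρ => hε ⟨u, ρ⟩).some
    -- By definition this sum is the idempotent `e` of `matrixSystem d`; the chosen dual data do not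
    -- enter it.
    have he : IsIdempotentElem
        (∑ x, stabilizerEmb (x.1 : V) (ε x) : SkewPathAlgebra k V G) :=
      (SkewPathAlgebra.matrixSystem d).isIdempotentElem_e
    refine ⟨he, fun N _ _ _ _ _ => ?_⟩
    have := (SkewPathAlgebra.matrixSystem d).finiteDimensional_cornerHom (k := k) he N rfl
    rw [← SkewPathAlgebra.rMap_dimVector d,
      (SkewPathAlgebra.matrixSystem d).dimVector_cornerHom he N rfl]
    rfl
  · intro α
    -- The second part mentions no idempotents, so a family has to be supplied.
    choose ε hε using fun u : D.T => Irr.exists_idempotents (hsplit u)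
    have d (u : D.T) : Irr.IdempotentData (ε u) :=
      (Irr.nonempty_idempotentData (hsplit u) _ (hε u)).some
    refine ⟨fun h => h.exists_isQuiverRoot d, fun ⟨β, hβ, h⟩ => ?_⟩
    obtain ⟨α', hα', h'⟩ := hβ.exists_isGRoot d
    -- The $G$-root produced from `β` has dimension vector $r(\beta)$, hence is `α` itself.
    have : α' = α := funext fun a => by exact_mod_cast congrFun (h'.symm.trans h) a
    exact this ▸ hα'
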